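/- Let $1<p<9$ and $b\in\mathbf R$. For real-valued $\phi\in H^2(\mathbf R)$ put $$I[\phi]=\tfrac12\int_{\mathbf R}\big(|\phi''|^2-b|\phi'|^2\big)\,dx-\tfrac1{p+1}\int_{\mathbf R}|\phi|^{p+1}\,dx,\qquad m(\lambda)=m_b(\lambda)=\inf\{I[\phi]:\phi\in H^2(\mathbf R),\ \|\phi\|_{L^2}^2=\lambda\}\quad(\lambda>0).$$ A minimizer at $\lambda$ is a $\phi\in H^2(\mathbf R)$ with $\|\phi\|_{L^2}^2=\lambda$ and $I[\phi]=m(\lambda)$. A Lagrange multiplier of $\phi$ is a number $\omega$ such that $\phi''''+b\phi''+\omega\phi-|\phi|^{p-1}\phi=0$ in the sense of distributions, tested against $H^2(\mathbf R)$. A limit wave at $\lambda$ is a minimizer $\Phi$ at $\lambda$ for which there are $\delta_j\to0$, $\delta_j\neq0$, minimizers $\phi_j$ at $\lambda+\delta_j$ and $y_j\in\mathbf R$ with $\|\phi_j(\cdot+y_j)-\Phi\|_{H^2}\to0$. (a) On $(0,\infty)$ the function $m$ is finite, concave, Lipschitz on every bounded interval, and differentiable almost everywhere. If $b>0$, then $m$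 is negative and strictly decreasing on $(0,\infty)$. Moreover, there is $\Lambda=\Lambda_{b,p}\ge0$, with $\Lambda=0$ if $p<5$, such that the following holds. (b) On $(\Lambda,\infty)$ the function $m$ is negative and strictly decreasing. For every $\lambda>\Lambda$ there is a minimizer at $\lambda$, and every minimizer $\phi$ at $\lambda$ has exactly one Lagrange multiplier, denoted $\omega(\lambda,\phi)$. (c) Let $\mathcal A_m=\{\lambda>\Lambda: m'(\lambda)\text{ exists}\}$. For $\lambda\in\mathcal A_m$ and every minimizer $\phi$ at $\lambda$, $$m'(\lambda)=-\frac{\omega(\lambda,\phi)}2 .$$ In particular $\omega(\lambda,\phi)=:\omega_\lambda$ does not depend on $\phi$ if $\lambda\in\mathcal A_m$. The function $\omega_\lambda$, which is defined for almost every $\lambda>\Lambda$, is locally integrable on $(\Lambda,\infty)$, and for $\Lambda<\lambda_1<\lambda_2$ $$m(\lambda_2)-m(\lambda_1)=-\frac12\int_{\lambda_1}^{\lambda_2}\omega_\lambda\,d\lambda .$$ (d) The function $\lambda\mapsto\omega_\lambda$ is strictly increasing on $\mathcal A_m$. Its derivative (as a function on $\mathcal A_m$) exists for $\lambda$ in a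 subset $\mathcal A_\omega\subset\mathcal A_m$ of full measure in $(\Lambda,\infty)$, and for every $\lambda\in\mathcal A_\omega$ and every minimizer $\phi$ at $\lambda$ $$\omega'(\lambda)>\frac{p-1}{2\lambda^2}\|\phi\|_{L^{p+1}}^{p+1}>0 .$$ (e) For every $\lambda>\Lambda$, in particular for $\lambda\notin\mathcal A_m$, the one-sided derivatives $m'(\lambda\pm)=\lim_{\epsilon\to0\pm}\frac{m(\lambda+\epsilon)-m(\lambda)}{\epsilon}$ exist, and every minimizer $\phi$ at $\lambda$ satisfies $$m'(\lambda+)\le-\frac{\omega(\lambda,\phi)}2\le m'(\lambda-).$$ (f) For every $\lambda>\Lambda$, in particular for $\lambda\notin\mathcal A_\omega$, and every limit wave $\Phi$ at $\lambda$, one has $-\frac{\omega(\lambda,\Phi)}2=m'(\lambda+)$ or $-\frac{\omega(\lambda,\Phi)}2=m'(\lambda-)$. (g) If $\lambda>\Lambda$ and the minimizer at $\lambda$ is unique up to translations, the reflection $x\mapsto-x$ and the change of sign, then $\lambda\in\mathcal A_m$ and $\omega$, as a function on $\mathcal A_m$, is continuous at $\lambda$. In particular, if this uniqueness holds for all $\lambda>\Lambda$,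 then $\mathcal A_m=(\Lambda,\infty)$ and $\lambda\mapsto\omega_\lambda$ is continuous there. -/

import Mathlib

open MeasureTheory Set Filter Topology
open scoped NNReal

namespace Kawahara

/-- `g` is the weak derivative of `f` on the real line. -/
def HasWeakDeriv (f g : ℝ → ℝ) : Prop :=
  ∀ η : ℝ → ℝ, ContDiff ℝ (⊤ : ℕ∞) η → HasCompactSupport η →
    ∫ x, f x * deriv η x = -∫ x, g x * η x

/-- A real-valued element of `H²(ℝ)`: a square integrable function (up to null sets), together
with square integrable first and second weak derivatives, which it determines a.e. -/
structure H2 where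
  toFun : ℝ → ℝ
  d1 : ℝ → ℝ
  d2 : ℝ → ℝ
  memLp : MemLp toFun 2 volume
  memLp_d1 : MemLp d1 2 volume
  memLp_d2 : MemLp d2 2 volume
  weak_d1 : HasWeakDeriv toFun d1
  weak_d2 : HasWeakDeriv d1 d2

instance : CoeFun H2 (fun _ => ℝ → ℝ) := ⟨H2.toFun⟩

/-- The squared `L²` norm. -/
noncomputable def mass (φ : H2) : ℝ := ∫ x, φ x ^ 2

/-- `‖φ‖_{L^{p+1}}^{p+1}`. -/
noncomputable def potential (p : ℝ) (φ : H2) : ℝ := ∫ x, |φ x| ^ (p + 1)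

/-- `I[φ] = ½ ∫ (|φ''|² - b |φ'|²) - (p+1)⁻¹ ∫ |φ|^{p+1}`. -/
noncomputable def energy (p b : ℝ) (φ : H2) : ℝ :=
  (1 / 2) * (∫ x, (φ.d2 x ^ 2 - b * φ.d1 x ^ 2)) - 1 / (p + 1) * potential p φ

/-- The set of energies of the `H²` functions of mass `lam`. -/
def energies (p b lam : ℝ) : Set ℝ := energy p b '' {φ : H2 | mass φ = lam}

/-- The cost function `m_b(lam)`. -/
noncomputable def cost (p b lam : ℝ) : ℝ := sInf (energies p b lam)

/-- `φ` has mass `lam` and has the least energy among the `H²` functions of mass `lam`. -/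
def IsMinimizer (p b lam : ℝ) (φ : H2) : Prop :=
  mass φ = lam ∧ ∀ ψ : H2, mass ψ = lam → energy p b φ ≤ energy p b ψ

/-- `ω` is a Lagrange multiplier of `φ`: `φ` is a distributional solution of
`φ'''' + b φ'' + ω φ - |φ|^{p-1} φ = 0`. -/
def IsMultiplier (p b : ℝ) (φ : H2) (ω : ℝ) : Prop :=
  ∀ h : H2, ∫ x, (φ.d2 x * h.d2 x + b * φ.d2 x * h x + ω * φ x * h x
    - |φ x| ^ (p - 1) * φ x * h x) = 0

/-- The squared `H²` distance between `φ(· + y)` and `ψ`. -/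
noncomputable def shiftDistSq (φ : H2) (y : ℝ) (ψ : H2) : ℝ :=
  (∫ x, (φ (x + y) - ψ x) ^ 2) + (∫ x, (φ.d1 (x + y) - ψ.d1 x) ^ 2)
    + ∫ x, (φ.d2 (x + y) - ψ.d2 x) ^ 2

/-- `Φ` is a limit wave at `lam`: a minimizer that is the limit in `H²` of translates of
minimizers `φ j` of mass `lam + δ j`, with `δ j ≠ 0` and `δ j → 0`. -/
def IsLimitWave (p b lam : ℝ) (Φ : H2) : Prop :=
  IsMinimizer p b lam Φ ∧
  ∃ (δ y : ℕ → ℝ) (φ : ℕ → H2),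
    (∀ j, δ j ≠ 0) ∧ Tendsto δ atTop (𝓝 0) ∧
    (∀ j, IsMinimizer p b (lam + δ j) (φ j)) ∧
    Tendsto (fun j => shiftDistSq (φ j) (y j) Φ) atTop (𝓝 0)

/-- The minimizer of mass `lam` is unique up to the symmetries of the problem: translations,
the reflection `x ↦ -x` and the change of sign. -/
def UniqueMinimizer (p b lam : ℝ) : Prop :=
  ∀ φ ψ : H2, IsMinimizer p b lam φ → IsMinimizer p b lam ψ →
    ∃ σ τ y : ℝ, (σ = 1 ∨ σ = -1) ∧ (τ = 1 ∨ τ = -1) ∧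
      ∀ᵐ x : ℝ, ψ x = σ * φ (τ * x + y)

/-- The points above `Λ` at which the cost function is differentiable. -/
def diffSet (p b Λ : ℝ) : Set ℝ := {lam | Λ < lam ∧ DifferentiableAt ℝ (cost p b) lam}

end Kawahara

/-! Amplitude scaling drives the proof. Write Q for the quadratic part of the energy and V for the
integral of |φ|^{p+1}. Along the ray t ↦ √t φ the energy is t Q - t^{(p+1)/2} V/(p+1), which is
strictly concave in t when V > 0. As an infimum of such functions of the mass, m is concave
(`concaveOn_cost`). The ray through a minimizer at λ touches m from above at λ with slope -ω/2, so
-ω/2 is a strict supergradient (`IsMinimizer.cost_lt`). This yields m' = -ω/2 where m' exists, the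
bounds by the one-sided derivatives, and the strict monotonicity of ω. The integral formula is the
absolute continuity of the locally Lipschitz function m.

Existence: with κ = max(b,0)²/8 the symbol satisfies (ξ⁴ - bξ²)/2 ≥ -κ, so Q ≥ -κ · mass. If m(λ) <
-κλ, the potential of a minimizing sequence stays away from zero, hence so does its supremum. After
translation the weak limit is nonzero, and the superlinear power of t forbids loss of mass
(`exists_minimizer_tendsto`). Since m(λ)/λ is nonincreasing, the condition persists once it holds,
and Λ is the infimum of the masses where it does (`exists_threshold`). For p < 5, long wave packets
at the frequency minimizing the symbol satisfy it at every mass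
(`cost_lt_threshold_of_subcritical`).

For the lower bound of ω', the amplitude and the length scale of a minimizer are varied together
(`IsMinimizer.exists_trial`). By the Pohozaev identity the dilation, at rate c, does not change the
first derivative, while the second derivative gains a mixed term linear in c. A small c > 0 makes
the inequality strict, and a touching argument transfers it to m (`neg_two_mul_le_of_touching`).

For limit waves and uniqueness, the multiplier of a minimizer is a function of λ, m(λ) and V alone
(`IsMinimizer.mult_eq`), so convergence of V suffices to pass to the limit. Multipliers at λ + δ are
squeezed between difference quotients of m (`tendsto_supergradient`), so their limits are one-sided
derivatives. Both one-sided derivatives are multipliers of minimizers at λ, and uniqueness makes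
them equal. -/

namespace Kawahara

/-! ### Square integrable functions -/

lemma integrable_mul_of_memLp {f g : ℝ → ℝ} (hf : MemLp f 2 volume) (hg : MemLp g 2 volume) :
    Integrable (fun x => f x * g x) := MemLp.integrable_mul hf hg

lemma integrable_abs_mul_of_memLp {f g : ℝ → ℝ} (hf : MemLp f 2 volume)
    (hg : MemLp g 2 volume) : Integrable (fun x => |f x| * |g x|) := by
  simpa only [abs_mul] using (integrable_mul_of_memLp hf hg).abs

/-- The Cauchy–Schwarz inequality. -/
lemma integral_abs_mul_le {f g : ℝ → ℝ} (hf : MemLp f 2 volume) (hg : MemLp g 2 volume) :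
    ∫ x, |f x| * |g x| ≤ √(∫ x, f x ^ 2) * √(∫ x, g x ^ 2) := by
  have h := integral_mul_le_Lp_mul_Lq_of_nonneg (μ := (volume : Measure ℝ))
    Real.HolderConjugate.two_two (f := fun x => |f x|) (g := fun x => |g x|)
    (.of_forall fun x => abs_nonneg _) (.of_forall fun x => abs_nonneg _)
    (by simpa using! hf.abs) (by simpa using! hg.abs)
  simpa [Real.sqrt_eq_rpow] using h

lemma abs_integral_mul_le {f g : ℝ → ℝ} (hf : MemLp f 2 volume) (hg : MemLp g 2 volume) :
    |∫ x, f x * g x| ≤ √(∫ x, f x ^ 2) * √(∫ x, g x ^ 2) := by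
  refine le_trans (abs_integral_le_integral_abs) ?_
  simpa only [abs_mul] using integral_abs_mul_le hf hg

lemma locallyIntegrable_of_memLp {f : ℝ → ℝ} (hf : MemLp f 2 volume) :
    LocallyIntegrable f volume := hf.locallyIntegrable (by norm_num)

lemma memLp_two_of_continuous {f : ℝ → ℝ} (hf : Continuous f) (hs : HasCompactSupport f) :
    MemLp f 2 volume := hf.memLp_of_hasCompactSupport hs

/-! ### Primitives of locally integrable functions -/

/-- `F` is a primitive of the locally integrable function `f`. -/
structure IsPrimitive (F f : ℝ → ℝ) : Prop where
  locallyIntegrable : LocallyIntegrable f volume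
  sub_eq : ∀ a b, F b - F a = ∫ x in a..b, f x

namespace IsPrimitive

variable {F f G g : ℝ → ℝ}

lemma intervalIntegrable (h : IsPrimitive F f) (a b : ℝ) : IntervalIntegrable f volume a b :=
  (h.locallyIntegrable.integrableOn_isCompact isCompact_uIcc).intervalIntegrable

lemma eq_add (h : IsPrimitive F f) (a : ℝ) : F = fun x => F a + ∫ t in a..x, f t := by
  ext x; rw [← h.sub_eq a x]; ring

lemma absolutelyContinuousOnInterval (h : IsPrimitive F f) (a b : ℝ) :
    AbsolutelyContinuousOnInterval F a b := by
  rw [h.eq_add a]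
  have hc : AbsolutelyContinuousOnInterval (fun _ : ℝ => F a) a b :=
    (LipschitzWith.const (F a)).lipschitzOnWith (s := uIcc a b) |>.absolutelyContinuousOnInterval
  exact hc.fun_add
    ((h.intervalIntegrable a b).absolutelyContinuousOnInterval_intervalIntegral left_mem_uIcc)

lemma ae_hasDerivAt (h : IsPrimitive F f) : ∀ᵐ x, HasDerivAt F (f x) x := by
  filter_upwards [LocallyIntegrable.ae_hasDerivAt_integral h.locallyIntegrable] with x hx
  rw [h.eq_add 0]
  exact (hx 0).const_add _

lemma continuous (h : IsPrimitive F f) : Continuous F := by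
  rw [h.eq_add 0]
  exact continuous_const.add (intervalIntegral.continuous_primitive h.intervalIntegrable 0)

lemma mul_sub_mul (hF : IsPrimitive F f) (hG : IsPrimitive G g) (a b : ℝ) :
    F b * G b - F a * G a = ∫ x in a..b, (f x * G x + F x * g x) := by
  rw [← (hF.absolutelyContinuousOnInterval a b).integral_deriv_mul_eq_sub
    (hG.absolutelyContinuousOnInterval a b)]
  apply intervalIntegral.integral_congr_ae
  filter_upwards [hF.ae_hasDerivAt, hG.ae_hasDerivAt] with x h1 h2 _
  rw [h1.deriv, h2.deriv]

end IsPrimitive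

/-- `H t - H (-t)` tends to the integral of `h` and is itself integrable in `t`, so its limit can
only be zero. This lets products of L² functions be integrated by parts without a separate proof of
decay. -/
lemma integral_eq_zero_of_sub_eq {H h : ℝ → ℝ} (hH : Integrable H) (hh : Integrable h)
    (hsub : ∀ a b, H b - H a = ∫ x in a..b, h x) : ∫ x, h x = 0 := by
  have h1 : Tendsto (fun t : ℝ => H t - H (-t)) atTop (𝓝 (∫ x, h x)) := by
    simp_rw [hsub]
    exact intervalIntegral_tendsto_integral hh tendsto_neg_atTop_atBot tendsto_id
  have h2 : Integrable (fun t : ℝ => H t - H (-t)) := hH.sub hH.comp_neg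
  refine (h2.integrableAtFilter atTop).eq_zero_of_tendsto ?_ h1
  intro s hs
  obtain ⟨a, ha⟩ := mem_atTop_sets.1 hs
  exact top_le_iff.1 (by simpa using measure_mono (μ := volume) (show Ici a ⊆ s from ha))

lemma isPrimitive_of_hasDerivAt {F f : ℝ → ℝ} (hd : ∀ x, HasDerivAt F (f x) x)
    (hf : Continuous f) : IsPrimitive F f where
  locallyIntegrable := hf.locallyIntegrable
  sub_eq a b := (intervalIntegral.integral_eq_sub_of_hasDerivAt (fun x _ => hd x)
    (hf.intervalIntegrable a b)).symm

lemma IsPrimitive.integral_mul_deriv {F f η : ℝ → ℝ} (hF : IsPrimitive F f)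
    (hη : ContDiff ℝ (⊤ : ℕ∞) η) (hs : HasCompactSupport η) :
    ∫ x, F x * deriv η x = -∫ x, f x * η x := by
  have hη' : Continuous (deriv η) := hη.continuous_deriv (by simp)
  have hp : IsPrimitive η (deriv η) :=
    isPrimitive_of_hasDerivAt (fun x => (hη.differentiable (by simp) x).hasDerivAt) hη'
  have i1 : Integrable (fun x => F x * deriv η x) :=
    (hF.continuous.mul hη').integrable_of_hasCompactSupport hs.deriv.mul_left
  have i2 : Integrable (fun x => f x * η x) := by
    have := hF.locallyIntegrable.integrable_smul_left_of_hasCompactSupport hη.continuous hs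
    simpa [mul_comm] using this
  have i3 : Integrable (fun x => F x * η x) :=
    (hF.continuous.mul hη.continuous).integrable_of_hasCompactSupport hs.mul_left
  have := integral_eq_zero_of_sub_eq i3 (i2.add i1) (fun a b => hF.mul_sub_mul hp a b)
  simp only [Pi.add_apply] at this
  rw [integral_add i2 i1] at this
  linarith

/-- The primitive started left of the support vanishes to the right of it because the total integral
is zero. -/
lemma exists_test_deriv_eq {g : ℝ → ℝ} (hg : ContDiff ℝ (⊤ : ℕ∞) g) (hs : HasCompactSupport g)
    (h0 : ∫ x, g x = 0) :
    ∃ η : ℝ → ℝ, ContDiff ℝ (⊤ : ℕ∞) η ∧ HasCompactSupport η ∧ deriv η = g := by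
  obtain ⟨R, hR⟩ := hs.isCompact.isBounded.subset_closedBall 0
  have hsub : Function.support g ⊆ Icc (-R) R := by
    have := (subset_tsupport g).trans hR
    rwa [Real.closedBall_eq_Icc, zero_sub, zero_add] at this
  have hd : ∀ x, HasDerivAt (fun x => ∫ t in (-R)..x, g t) (g x) x := fun x =>
    hg.continuous.integral_hasStrictDerivAt (-R) x |>.hasDerivAt
  have hder : deriv (fun x => ∫ t in (-R)..x, g t) = g := funext fun x => (hd x).deriv
  have hz : ∀ x, x ∉ Icc (-R) R → g x = 0 := fun x hx => by
    by_contra h; exact hx (hsub h)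
  refine ⟨fun x => ∫ t in (-R)..x, g t, ?_, ?_, hder⟩
  · rw [contDiff_infty_iff_deriv, hder]
    exact ⟨fun x => (hd x).differentiableAt, hg⟩
  · refine HasCompactSupport.of_support_subset_isCompact (isCompact_Icc (a := -R) (b := R)) ?_
    intro x hx
    by_contra hxn
    apply hx
    rw [mem_Icc, not_and_or, not_le, not_le] at hxn
    rcases hxn with h | h
    · refine (intervalIntegral.integral_congr_ae (g := fun _ => 0) ?_).trans (by simp)
      have hne : ∀ᵐ t : ℝ, t ≠ -R := by simp [ae_iff]
      filter_upwards [hne] with t ht1 ht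
      rw [uIoc_of_ge h.le] at ht
      exact hz t fun h' => ht1 (le_antisymm ht.2 h'.1)
    · rw [← h0]
      change ∫ t in (-R)..x, g t = _
      have hne : ∀ᵐ t : ℝ, t ≠ -R := by simp [ae_iff]
      by_cases hRx : -R ≤ x
      · rw [intervalIntegral.integral_of_le hRx, ← integral_indicator measurableSet_Ioc]
        apply integral_congr_ae
        filter_upwards [hne] with t ht1
        by_cases ht : t ∈ Ioc (-R) x
        · simp [ht]
        · rw [indicator_of_notMem ht]
          refine (hz t fun h' => ht ⟨lt_of_le_of_ne h'.1 (Ne.symm ht1), h'.2.trans h.le⟩).symm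
      -- Here `R < x < -R`, so `R` is negative and the ball containing the support is empty.
      · have : g = 0 := funext fun t => hz t fun h' => by
          linarith [h'.1, h'.2]
        simp [this]

/-- A locally integrable function with locally integrable weak derivative agrees almost everywhere
with a primitive of it. -/
lemma HasWeakDeriv.exists_isPrimitive {f g : ℝ → ℝ} (h : HasWeakDeriv f g)
    (hf : LocallyIntegrable f volume) (hg : LocallyIntegrable g volume) :
    ∃ F, IsPrimitive F g ∧ f =ᵐ[volume] F := by
  set F0 : ℝ → ℝ := fun x => ∫ t in (0 : ℝ)..x, g t
  have hi : ∀ a b, IntervalIntegrable g volume a b := fun a b =>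
    (hg.integrableOn_isCompact isCompact_uIcc).intervalIntegrable
  have hF0 : IsPrimitive F0 g :=
    ⟨hg, fun a b => intervalIntegral.integral_interval_sub_left (hi _ _) (hi _ _)⟩
  have hl : LocallyIntegrable (fun x => f x - F0 x) volume :=
    hf.sub hF0.continuous.locallyIntegrable
  have hint : ∀ {u η : ℝ → ℝ}, LocallyIntegrable u volume → Continuous η → HasCompactSupport η →
      Integrable (fun x => u x * η x) := fun hu hη hs => by
    simpa [mul_comm] using hu.integrable_smul_left_of_hasCompactSupport hη hs
  have key : ∀ η : ℝ → ℝ, ContDiff ℝ (⊤ : ℕ∞) η → HasCompactSupport η →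
      ∫ x, (f x - F0 x) * deriv η x = 0 := fun η hη hs => by
    have hη' : Continuous (deriv η) := hη.continuous_deriv (by simp)
    simp_rw [sub_mul]
    rw [integral_sub (hint hf hη' hs.deriv) (hint hF0.continuous.locallyIntegrable hη' hs.deriv),
      h η hη hs, hF0.integral_mul_deriv hη hs, sub_self]
  let ρ : ContDiffBump (0 : ℝ) := ⟨1, 2, one_pos, by norm_num⟩
  set r : ℝ → ℝ := ρ.normed volume
  have hr : ContDiff ℝ (⊤ : ℕ∞) r := ρ.contDiff_normed
  have hrs : HasCompactSupport r := ρ.hasCompactSupport_normed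
  set c := ∫ x, (f x - F0 x) * r x
  have hmain : ∀ᵐ x, (f x - F0 x) - c = 0 := by
    refine ae_eq_zero_of_integral_contDiff_smul_eq_zero
      (hl.sub continuous_const.locallyIntegrable) fun ζ hζ hζs => ?_
    set I := ∫ x, ζ x
    have iζ : Integrable ζ := hζ.continuous.integrable_of_hasCompactSupport hζs
    have ir : Integrable r := hr.continuous.integrable_of_hasCompactSupport hrs
    -- The du Bois-Reymond argument: subtracting a multiple of the normalized bump `r` makes any
    -- test function a derivative of a test function, against which `f - F0` integrates to zero.
    have hg0 : ∫ x, (ζ x - I * r x) = 0 := by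
      rw [integral_sub iζ (ir.const_mul I), integral_const_mul, ρ.integral_normed, mul_one, sub_self]
    obtain ⟨η, hη, hηs, hd⟩ := exists_test_deriv_eq (g := fun x => ζ x - I * r x)
      (hζ.sub (contDiff_const.mul hr)) (hζs.sub (hrs.mul_left)) hg0
    have hk := key η hη hηs
    rw [hd] at hk
    have i1 := hint hl hζ.continuous hζs
    have i2 := hint hl hr.continuous hrs
    have e1 : ∫ x, (f x - F0 x) * (ζ x - I * r x) = (∫ x, (f x - F0 x) * ζ x) - I * c := by
      rw [← integral_const_mul, ← integral_sub i1 (i2.const_mul I)]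
      congr 1; ext x; ring
    have e2 : ∫ x, ζ x • (f x - F0 x - c) = (∫ x, (f x - F0 x) * ζ x) - c * I := by
      rw [← integral_const_mul, ← integral_sub i1 (iζ.const_mul c)]
      congr 1; ext x; simp only [smul_eq_mul]; ring
    rw [e2]
    change ∫ x, (f x - F0 x) * (ζ x - I * r x) = 0 at hk
    rw [e1] at hk; linarith
  refine ⟨fun x => F0 x + c, ⟨hg, fun a b => by rw [← hF0.sub_eq]; ring⟩, ?_⟩
  filter_upwards [hmain] with x hx
  linarith

/-- Integration by parts for square integrable functions. -/
lemma HasWeakDeriv.integral_mul_eq_neg {f g u v : ℝ → ℝ} (h : HasWeakDeriv f g)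
    (k : HasWeakDeriv u v) (hf : MemLp f 2 volume) (hg : MemLp g 2 volume) (hu : MemLp u 2 volume)
    (hv : MemLp v 2 volume) : ∫ x, f x * v x = -∫ x, g x * u x := by
  obtain ⟨F, hF, hfF⟩ := h.exists_isPrimitive (locallyIntegrable_of_memLp hf)
    (locallyIntegrable_of_memLp hg)
  obtain ⟨U, hU, huU⟩ := k.exists_isPrimitive (locallyIntegrable_of_memLp hu)
    (locallyIntegrable_of_memLp hv)
  have hF2 := hf.ae_eq hfF
  have hU2 := hu.ae_eq huU
  have i1 := integrable_mul_of_memLp hg hU2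
  have i2 := integrable_mul_of_memLp hF2 hv
  have := integral_eq_zero_of_sub_eq (integrable_mul_of_memLp hF2 hU2) (i1.add i2)
    (fun a b => hF.mul_sub_mul hU a b)
  simp only [Pi.add_apply] at this
  rw [integral_add i1 i2] at this
  have e1 : ∫ x, f x * v x = ∫ x, F x * v x := integral_congr_ae (hfF.mul (ae_eq_refl v))
  have e2 : ∫ x, g x * u x = ∫ x, g x * U x := integral_congr_ae ((ae_eq_refl g).mul huU)
  linarith

lemma not_integrable_of_le {H : ℝ → ℝ} {ε : ℝ} (hε : 0 < ε) (h : ∀ x, ε ≤ H x) :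
    ¬ Integrable H := fun hi => by
  have : Integrable (fun _ : ℝ => ε) := hi.mono' aestronglyMeasurable_const
    (.of_forall fun x => by rw [Real.norm_of_nonneg hε.le]; exact h x)
  rw [integrable_const_iff] at this
  rcases this with h0 | h1
  · exact hε.ne' h0
  · exact absurd h1 (by simp [isFiniteMeasure_iff])

/-- The derivative of F² is 2Ff, so F² varies by at most K over the line. If F² exceeded K at one
point, it would be bounded below by a positive constant everywhere, against integrability. -/
lemma IsPrimitive.sq_le {F f : ℝ → ℝ} (h : IsPrimitive F f) (hF : MemLp F 2 volume)
    (hf : MemLp f 2 volume) (x : ℝ) : F x ^ 2 ≤ 2 * (√(∫ x, F x ^ 2) * √(∫ x, f x ^ 2)) := by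
  by_contra! hlt
  set K := 2 * (√(∫ x, F x ^ 2) * √(∫ x, f x ^ 2))
  refine not_integrable_of_le (sub_pos.2 hlt) (fun y => ?_) hF.integrable_sq
  have h1 := h.mul_sub_mul h y x
  have h2 : |∫ t in y..x, (f t * F t + F t * f t)| ≤ K := by
    have hi := integrable_abs_mul_of_memLp hF hf
    simp only [← Real.norm_eq_abs] at hi ⊢
    calc ‖∫ t in y..x, (f t * F t + F t * f t)‖
        ≤ ∫ t in uIoc y x, ‖f t * F t + F t * f t‖ :=
          intervalIntegral.norm_integral_le_integral_norm_uIoc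
      _ = ∫ t in uIoc y x, 2 * (‖F t‖ * ‖f t‖) := by
          congr 1; ext t
          rw [show f t * F t + F t * f t = 2 * (F t * f t) by ring, norm_mul, norm_mul]; norm_num
      _ ≤ ∫ t, 2 * (‖F t‖ * ‖f t‖) :=
          setIntegral_le_integral (hi.const_mul 2) (.of_forall fun t => by positivity)
      _ ≤ K := by
          rw [integral_const_mul]
          exact mul_le_mul_of_nonneg_left (integral_abs_mul_le hF hf) (by norm_num)
  have h3 := (abs_le.1 h2).2
  nlinarith

/-! ### Operations on `H2` -/

lemma IsPrimitive.hasWeakDeriv {F f : ℝ → ℝ} (h : IsPrimitive F f) : HasWeakDeriv F f :=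
  fun _ hη hs => h.integral_mul_deriv hη hs

lemma HasWeakDeriv.add_const_mul {f g u v : ℝ → ℝ} (h : HasWeakDeriv f g) (k : HasWeakDeriv u v)
    (hf : MemLp f 2 volume) (hg : MemLp g 2 volume) (hu : MemLp u 2 volume)
    (hv : MemLp v 2 volume) (t : ℝ) :
    HasWeakDeriv (fun x => f x + t * u x) (fun x => g x + t * v x) := fun η hη hs => by
  have m1 := memLp_two_of_continuous hη.continuous hs
  have m2 := memLp_two_of_continuous (hη.continuous_deriv (by simp)) hs.deriv
  have e : ∀ {a b c : ℝ → ℝ}, MemLp a 2 volume → MemLp b 2 volume → MemLp c 2 volume →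
      ∫ x, (a x + t * b x) * c x = (∫ x, a x * c x) + t * ∫ x, b x * c x := fun ha hb hc => by
    rw [← integral_const_mul, ← integral_add (integrable_mul_of_memLp ha hc)
      ((integrable_mul_of_memLp hb hc).const_mul t)]
    congr 1; ext x; ring
  rw [e hf hu m2, e hg hv m1, h η hη hs, k η hη hs]
  ring

lemma integral_comp_affine (k : ℝ → ℝ) (s y : ℝ) :
    ∫ x, k (s * x + y) = |s⁻¹| * ∫ x, k x := by
  rw [Measure.integral_comp_mul_left (fun x => k (x + y)) s, integral_add_right_eq_self, smul_eq_mul]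

lemma integrable_comp_affine {k : ℝ → ℝ} (hk : Integrable k) {s : ℝ} (hs : s ≠ 0) (y : ℝ) :
    Integrable fun x => k (s * x + y) :=
  (hk.comp_add_right y).comp_mul_left' hs

lemma memLp_comp_affine {k : ℝ → ℝ} (hk : MemLp k 2 volume) {s : ℝ} (hs : s ≠ 0) (c y : ℝ) :
    MemLp (fun x => c * k (s * x + y)) 2 volume := by
  have h1 : Measure.QuasiMeasurePreserving (fun x : ℝ => s * x + y) := by
    refine (measurePreserving_add_right volume y).quasiMeasurePreserving.comp (f := fun x => s * x) ?_
    refine ⟨by fun_prop, ?_⟩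
    rw [Real.map_volume_mul_left hs]
    exact Measure.smul_absolutelyContinuous
  have h2 : AEStronglyMeasurable (fun x => k (s * x + y)) volume :=
    hk.aestronglyMeasurable.comp_quasiMeasurePreserving h1
  refine MemLp.const_mul ?_ c
  rw [memLp_two_iff_integrable_sq h2]
  exact integrable_comp_affine hk.integrable_sq hs y

lemma HasWeakDeriv.comp_affine {f g : ℝ → ℝ} (h : HasWeakDeriv f g) {s : ℝ} (hs : 0 < s)
    (c y : ℝ) : HasWeakDeriv (fun x => c * f (s * x + y)) (fun x => c * s * g (s * x + y)) := by
  intro η hη hηs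
  have hinv : ∀ x, (s * x + y - y) / s = x := fun x => by field_simp; ring
  have hd : ∀ z, HasDerivAt (fun z => η ((z - y) / s)) (deriv η ((z - y) / s) * (1 / s)) z := fun z =>
    ((hη.differentiable (by simp) _).hasDerivAt).comp z
      (((hasDerivAt_id z).sub_const y).div_const s)
  have hζ : ContDiff ℝ (⊤ : ℕ∞) (fun z => η ((z - y) / s)) := by fun_prop
  have hζs : HasCompactSupport (fun z => η ((z - y) / s)) := by
    refine hηs.comp_isClosedEmbedding (g := fun z => (z - y) / s) ?_
    exact (((Homeomorph.subRight y).trans (Homeomorph.mulRight₀ s⁻¹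
      (inv_ne_zero hs.ne'))).isClosedEmbedding : _)
  have key := h _ hζ hζs
  rw [show deriv (fun z => η ((z - y) / s)) = fun z => deriv η ((z - y) / s) * (1 / s) from
    funext fun z => (hd z).deriv] at key
  have e1 := integral_comp_affine (fun z => f z * (deriv η ((z - y) / s) * (1 / s))) s y
  have e2 := integral_comp_affine (fun z => g z * η ((z - y) / s)) s y
  simp only [hinv] at e1 e2
  have e3 : ∫ x, c * f (s * x + y) * deriv η x
      = c * s * ∫ x, f (s * x + y) * (deriv η x * (1 / s)) := by
    rw [← integral_const_mul]; congr 1; ext x; field_simp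
  have e4 : ∫ x, c * s * g (s * x + y) * η x = c * s * ∫ x, g (s * x + y) * η x := by
    rw [← integral_const_mul]; congr 1; ext x; ring
  rw [e3, e4, e1, e2, key]; ring

namespace H2

/-- The squared `L²` norm of the first derivative. -/
noncomputable def gradSq (φ : H2) : ℝ := ∫ x, φ.d1 x ^ 2

/-- The squared `L²` norm of the second derivative. -/
noncomputable def bendSq (φ : H2) : ℝ := ∫ x, φ.d2 x ^ 2

/-- The quadratic part of the energy. -/
noncomputable def quad (b : ℝ) (φ : H2) : ℝ := (1 / 2) * (φ.bendSq - b * φ.gradSq)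

lemma mass_nonneg (φ : H2) : 0 ≤ mass φ := integral_nonneg fun _ => sq_nonneg _
lemma gradSq_nonneg (φ : H2) : 0 ≤ φ.gradSq := integral_nonneg fun _ => sq_nonneg _
lemma bendSq_nonneg (φ : H2) : 0 ≤ φ.bendSq := integral_nonneg fun _ => sq_nonneg _
lemma potential_nonneg (p : ℝ) (φ : H2) : 0 ≤ potential p φ :=
  integral_nonneg fun _ => Real.rpow_nonneg (abs_nonneg _) _

lemma energy_eq (p b : ℝ) (φ : H2) :
    energy p b φ = φ.quad b - 1 / (p + 1) * potential p φ := by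
  unfold energy quad bendSq gradSq
  rw [integral_sub φ.memLp_d2.integrable_sq (φ.memLp_d1.integrable_sq.const_mul b),
    integral_const_mul]

/-- `φ + t ψ`. -/
def addMul (φ ψ : H2) (t : ℝ) : H2 where
  toFun x := φ x + t * ψ x
  d1 x := φ.d1 x + t * ψ.d1 x
  d2 x := φ.d2 x + t * ψ.d2 x
  memLp := φ.memLp.add (ψ.memLp.const_mul t)
  memLp_d1 := φ.memLp_d1.add (ψ.memLp_d1.const_mul t)
  memLp_d2 := φ.memLp_d2.add (ψ.memLp_d2.const_mul t)
  weak_d1 := φ.weak_d1.add_const_mul ψ.weak_d1 φ.memLp φ.memLp_d1 ψ.memLp ψ.memLp_d1 t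
  weak_d2 := φ.weak_d2.add_const_mul ψ.weak_d2 φ.memLp_d1 φ.memLp_d2 ψ.memLp_d1 ψ.memLp_d2 t

/-- `c φ(s · + y)`. -/
def affine (φ : H2) (c : ℝ) {s : ℝ} (hs : 0 < s) (y : ℝ) : H2 where
  toFun x := c * φ (s * x + y)
  d1 x := c * s * φ.d1 (s * x + y)
  d2 x := c * s * s * φ.d2 (s * x + y)
  memLp := memLp_comp_affine φ.memLp hs.ne' c y
  memLp_d1 := memLp_comp_affine φ.memLp_d1 hs.ne' (c * s) y
  memLp_d2 := memLp_comp_affine φ.memLp_d2 hs.ne' (c * s * s) y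
  weak_d1 := φ.weak_d1.comp_affine hs c y
  weak_d2 := φ.weak_d2.comp_affine hs (c * s) y

/-- A compactly supported `C²` function as an element of `H²`. -/
def ofHasDerivAt {f f' f'' : ℝ → ℝ} (h1 : ∀ x, HasDerivAt f (f' x) x)
    (h2 : ∀ x, HasDerivAt f' (f'' x) x) (h3 : Continuous f'') (hs : HasCompactSupport f) : H2 where
  toFun := f
  d1 := f'
  d2 := f''
  memLp := memLp_two_of_continuous
    (continuous_iff_continuousAt.2 fun x => (h1 x).continuousAt) hs
  memLp_d1 := memLp_two_of_continuous
    (continuous_iff_continuousAt.2 fun x => (h2 x).continuousAt)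
    (by rw [← show deriv f = f' from funext fun x => (h1 x).deriv]; exact hs.deriv)
  memLp_d2 := memLp_two_of_continuous h3 (by
    rw [← show deriv f' = f'' from funext fun x => (h2 x).deriv,
      ← show deriv f = f' from funext fun x => (h1 x).deriv]
    exact hs.deriv.deriv)
  weak_d1 := (isPrimitive_of_hasDerivAt h1
    (continuous_iff_continuousAt.2 fun x => (h2 x).continuousAt)).hasWeakDeriv
  weak_d2 := (isPrimitive_of_hasDerivAt h2 h3).hasWeakDeriv

lemma integral_sq_affine (k : ℝ → ℝ) (c : ℝ) {s : ℝ} (hs : 0 < s) (y : ℝ) :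
    ∫ x, (c * k (s * x + y)) ^ 2 = c ^ 2 * s⁻¹ * ∫ x, k x ^ 2 := by
  simp_rw [mul_pow]
  rw [integral_const_mul, integral_comp_affine (fun x => k x ^ 2) s y, abs_of_pos (inv_pos.2 hs)]
  ring

lemma mass_affine (φ : H2) (c : ℝ) {s : ℝ} (hs : 0 < s) (y : ℝ) :
    mass (φ.affine c hs y) = c ^ 2 * s⁻¹ * mass φ := integral_sq_affine φ c hs y

lemma gradSq_affine (φ : H2) (c : ℝ) {s : ℝ} (hs : 0 < s) (y : ℝ) :
    (φ.affine c hs y).gradSq = c ^ 2 * s * φ.gradSq := by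
  refine (integral_sq_affine φ.d1 (c * s) hs y).trans ?_
  rw [gradSq]; field_simp

lemma bendSq_affine (φ : H2) (c : ℝ) {s : ℝ} (hs : 0 < s) (y : ℝ) :
    (φ.affine c hs y).bendSq = c ^ 2 * s ^ 3 * φ.bendSq := by
  refine (integral_sq_affine φ.d2 (c * s * s) hs y).trans ?_
  rw [bendSq]; field_simp

lemma potential_affine (p : ℝ) (φ : H2) (c : ℝ) {s : ℝ} (hs : 0 < s) (y : ℝ) :
    potential p (φ.affine c hs y) = |c| ^ (p + 1) * s⁻¹ * potential p φ := by
  have : ∀ x, |(φ.affine c hs y) x| ^ (p + 1) = |c| ^ (p + 1) * |φ (s * x + y)| ^ (p + 1) :=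
    fun x => by
      rw [← Real.mul_rpow (abs_nonneg _) (abs_nonneg _), ← abs_mul]; rfl
  unfold potential
  simp_rw [this]
  rw [integral_const_mul, integral_comp_affine (fun x => |φ x| ^ (p + 1)) s y,
    abs_of_pos (inv_pos.2 hs)]
  ring

lemma integral_sq_addMul {f g : ℝ → ℝ} (hf : MemLp f 2 volume) (hg : MemLp g 2 volume) (t : ℝ) :
    ∫ x, (f x + t * g x) ^ 2
      = (∫ x, f x ^ 2) + 2 * t * (∫ x, f x * g x) + t ^ 2 * ∫ x, g x ^ 2 := by
  have i1 := hf.integrable_sq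
  have i2 := (integrable_mul_of_memLp hf hg).const_mul (2 * t)
  have i3 := hg.integrable_sq.const_mul (t ^ 2)
  have i12 : Integrable (fun x => f x ^ 2 + 2 * t * (f x * g x)) := i1.add i2
  rw [← integral_const_mul, ← integral_const_mul, ← integral_add i1 i2,
    ← integral_add i12 i3]
  congr 1; ext x; ring

lemma mass_addMul (φ ψ : H2) (t : ℝ) : mass (φ.addMul ψ t)
    = mass φ + 2 * t * (∫ x, φ x * ψ x) + t ^ 2 * mass ψ :=
  integral_sq_addMul φ.memLp ψ.memLp t

lemma gradSq_addMul (φ ψ : H2) (t : ℝ) : (φ.addMul ψ t).gradSq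
    = φ.gradSq + 2 * t * (∫ x, φ.d1 x * ψ.d1 x) + t ^ 2 * ψ.gradSq :=
  integral_sq_addMul φ.memLp_d1 ψ.memLp_d1 t

lemma bendSq_addMul (φ ψ : H2) (t : ℝ) : (φ.addMul ψ t).bendSq
    = φ.bendSq + 2 * t * (∫ x, φ.d2 x * ψ.d2 x) + t ^ 2 * ψ.bendSq :=
  integral_sq_addMul φ.memLp_d2 ψ.memLp_d2 t

/-! ### The continuous representative and the interpolation inequalities -/

lemma exists_rep (φ : H2) : ∃ F, IsPrimitive F φ.d1 ∧ φ =ᵐ[volume] F :=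
  φ.weak_d1.exists_isPrimitive (locallyIntegrable_of_memLp φ.memLp) (locallyIntegrable_of_memLp φ.memLp_d1)

/-- The continuous representative. -/
noncomputable def rep (φ : H2) : ℝ → ℝ := φ.exists_rep.choose

lemma isPrimitive_rep (φ : H2) : IsPrimitive φ.rep φ.d1 := φ.exists_rep.choose_spec.1
lemma ae_eq_rep (φ : H2) : φ =ᵐ[volume] φ.rep := φ.exists_rep.choose_spec.2
lemma continuous_rep (φ : H2) : Continuous φ.rep := φ.isPrimitive_rep.continuous
lemma memLp_rep (φ : H2) : MemLp φ.rep 2 volume := φ.memLp.ae_eq φ.ae_eq_rep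

lemma integral_rep_sq (φ : H2) : ∫ x, φ.rep x ^ 2 = mass φ :=
  integral_congr_ae (by filter_upwards [φ.ae_eq_rep] with x hx; rw [hx])

lemma rep_sq_le (φ : H2) (x : ℝ) : φ.rep x ^ 2 ≤ 2 * (√(mass φ) * √φ.gradSq) := by
  have := φ.isPrimitive_rep.sq_le φ.memLp_rep φ.memLp_d1 x
  rwa [φ.integral_rep_sq] at this

/-- An upper bound of `|φ|`, by the Gagliardo–Nirenberg inequality. -/
noncomputable def sup (φ : H2) : ℝ := √(2 * (√(mass φ) * √φ.gradSq))

lemma sup_nonneg (φ : H2) : 0 ≤ φ.sup := Real.sqrt_nonneg _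

lemma abs_rep_le (φ : H2) (x : ℝ) : |φ.rep x| ≤ φ.sup := Real.abs_le_sqrt (φ.rep_sq_le x)

lemma ae_abs_le (φ : H2) : ∀ᵐ x, |φ x| ≤ φ.sup := by
  filter_upwards [φ.ae_eq_rep] with x hx
  rw [hx]; exact φ.abs_rep_le x

lemma integral_d1_mul_d1 (φ h : H2) : ∫ x, φ.d1 x * h.d1 x = -∫ x, φ.d2 x * h x :=
  φ.weak_d2.integral_mul_eq_neg h.weak_d1 φ.memLp_d1 φ.memLp_d2 h.memLp h.memLp_d1

lemma gradSq_eq (φ : H2) : φ.gradSq = -∫ x, φ.d2 x * φ x := by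
  rw [← integral_d1_mul_d1]; simp only [gradSq, sq]

/-- Integration by parts followed by Cauchy–Schwarz. -/
lemma gradSq_le (φ : H2) : φ.gradSq ≤ √(mass φ) * √φ.bendSq := by
  rw [gradSq_eq, mul_comm]
  exact (neg_le_abs _).trans (abs_integral_mul_le φ.memLp_d2 φ.memLp)

/-- The quadratic part of the energy is bounded below by a multiple of the mass. -/
lemma le_quad (b : ℝ) (φ : H2) : -((max b 0) ^ 2 / 8) * mass φ ≤ φ.quad b := by
  unfold quad
  rcases le_total b 0 with hb | hb
  · rw [max_eq_right hb]
    nlinarith [φ.bendSq_nonneg, φ.gradSq_nonneg]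
  · rw [max_eq_left hb]
    -- Completing the square: ξ⁴ - bξ² = (ξ² - b/2)² - b²/4, read off from the norm of φ'' + (b/2)
    -- φ.
    have h1 := integral_sq_addMul φ.memLp_d2 φ.memLp (b / 2)
    have h2 : 0 ≤ ∫ x, (φ.d2 x + b / 2 * φ x) ^ 2 := integral_nonneg fun _ => sq_nonneg _
    have h3 := φ.gradSq_eq
    change _ = φ.bendSq + _ + _ * mass φ at h1
    nlinarith

end H2

/-! ### The potential energy -/

lemma abs_rpow_sub_abs_rpow_le {r m x y : ℝ} (hr : 1 < r) (hx : |x| ≤ m) (hy : |y| ≤ m) :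
    |(|x| ^ r) - |y| ^ r| ≤ r * m ^ (r - 1) * |x - y| := by
  have hm : 0 ≤ m := (abs_nonneg x).trans hx
  have h := Convex.norm_image_sub_le_of_norm_hasDerivWithin_le (f := fun x : ℝ => |x| ^ r)
    (f' := fun x => r * |x| ^ (r - 2) * x) (s := Icc (-m) m) (C := r * m ^ (r - 1))
    (fun z _ => (hasDerivAt_abs_rpow z hr).hasDerivWithinAt) (fun z hz => ?_) (convex_Icc _ _)
    (abs_le.1 hy) (abs_le.1 hx)
  · simpa [Real.norm_eq_abs] using h
  · rw [Real.norm_eq_abs, abs_mul, abs_mul, abs_of_pos (by linarith : 0 < r),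
      abs_of_nonneg (Real.rpow_nonneg (abs_nonneg z) _), mul_assoc]
    refine mul_le_mul_of_nonneg_left ?_ (by linarith)
    rcases eq_or_ne z 0 with rfl | h0
    · simpa using Real.rpow_nonneg hm _
    · have : |z| ^ (r - 2) * |z| = |z| ^ (r - 1) := by
        rw [← Real.rpow_add_one (abs_ne_zero.2 h0)]; ring_nf
      rw [this]
      exact Real.rpow_le_rpow (abs_nonneg _) (abs_le.2 hz) (by linarith)

lemma abs_rpow_le {r B a : ℝ} (hr : 2 ≤ r) (ha : |a| ≤ B) : |a| ^ r ≤ B ^ (r - 2) * a ^ 2 := by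
  have hr' : r = (r - 2) + 2 := by ring
  conv_lhs => rw [hr']
  rw [Real.rpow_add_of_nonneg (abs_nonneg _) (by linarith) (by norm_num), Real.rpow_two, sq_abs]
  exact mul_le_mul_of_nonneg_right (Real.rpow_le_rpow (abs_nonneg _) ha (by linarith)) (sq_nonneg _)

/-- For |a| ≤ |b| the mean value theorem on the interval of radius 2|b| controls |a+b|^r - |b|^r,
and |a|^r is at most a multiple of |a||b|. The bilinear right-hand side is small after integration
when the two functions hardly overlap. -/
lemma abs_add_rpow_sub_sub_le {r B a b : ℝ} (hr : 2 ≤ r) (ha : |a| ≤ B) (hb : |b| ≤ B) :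
    |(|a + b| ^ r) - |a| ^ r - |b| ^ r|
      ≤ (2 * r * (2 * B) ^ (r - 2) + B ^ (r - 2)) * (|a| * |b|) := by
  wlog hab : |a| ≤ |b| generalizing a b
  · have := this hb ha (le_of_not_ge hab)
    rw [add_comm b a, mul_comm |b|] at this
    rwa [sub_right_comm]
  have hB : 0 ≤ B := (abs_nonneg a).trans ha
  have h1 : |(|a + b| ^ r) - |b| ^ r| ≤ r * (2 * |b|) ^ (r - 1) * |a| := by
    have := abs_rpow_sub_abs_rpow_le (r := r) (m := 2 * |b|) (x := a + b) (y := b) (by linarith)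
      ((abs_add_le a b).trans (by linarith)) (by linarith [abs_nonneg b])
    simpa using this
  have h2 : (2 * |b|) ^ (r - 1) ≤ (2 * B) ^ (r - 2) * (2 * |b|) := by
    rw [show r - 1 = (r - 2) + 1 by ring, Real.rpow_add_of_nonneg (by positivity) (by linarith)
      (by norm_num), Real.rpow_one]
    exact mul_le_mul_of_nonneg_right (Real.rpow_le_rpow (by positivity) (by linarith)
      (by linarith)) (by positivity)
  have h3 : |a| ^ r ≤ B ^ (r - 2) * (|a| * |b|) := by
    refine (abs_rpow_le hr ha).trans (mul_le_mul_of_nonneg_left ?_ (Real.rpow_nonneg hB _))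
    rw [← sq_abs, sq]
    exact mul_le_mul_of_nonneg_left hab (abs_nonneg _)
  have h4 : 0 ≤ |a| ^ r := Real.rpow_nonneg (abs_nonneg _) _
  have h5 : r * (2 * |b|) ^ (r - 1) * |a| ≤ r * ((2 * B) ^ (r - 2) * (2 * |b|)) * |a| := by
    gcongr
  calc |(|a + b| ^ r) - |a| ^ r - |b| ^ r|
      = |((|a + b| ^ r) - |b| ^ r) - |a| ^ r| := by rw [sub_right_comm]
    _ ≤ |(|a + b| ^ r) - |b| ^ r| + |a| ^ r := by
        refine (abs_sub _ _).trans ?_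
        rw [abs_of_nonneg h4]
    _ ≤ _ := by nlinarith

namespace H2

variable {p : ℝ}

lemma aestronglyMeasurable_abs_rpow (φ : H2) (r : ℝ) :
    AEStronglyMeasurable (fun x => |φ x| ^ r) volume :=
  (φ.memLp.aestronglyMeasurable.aemeasurable.abs.pow_const r).aestronglyMeasurable

lemma integrable_abs_rpow (φ : H2) {r : ℝ} (hr : 2 ≤ r) : Integrable (fun x => |φ x| ^ r) := by
  refine (φ.memLp.integrable_sq.const_mul (φ.sup ^ (r - 2))).mono'
    (φ.aestronglyMeasurable_abs_rpow r) ?_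
  filter_upwards [φ.ae_abs_le] with x hx
  rw [Real.norm_of_nonneg (Real.rpow_nonneg (abs_nonneg _) _)]
  exact abs_rpow_le hr hx

lemma potential_le (hp : 1 < p) (φ : H2) : potential p φ ≤ φ.sup ^ (p - 1) * mass φ := by
  unfold potential mass
  rw [← integral_const_mul]
  refine integral_mono_ae (φ.integrable_abs_rpow (by linarith))
    (φ.memLp.integrable_sq.const_mul _) ?_
  filter_upwards [φ.ae_abs_le] with x hx
  have := abs_rpow_le (r := p + 1) (by linarith) hx
  rwa [show p + 1 - 2 = p - 1 by ring] at this

lemma potential_pos (hp : 1 < p) {φ : H2} (h : 0 < mass φ) : 0 < potential p φ := by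
  refine lt_of_le_of_ne (potential_nonneg p φ) fun h0 => h.ne' ?_
  have h1 := (integral_eq_zero_iff_of_nonneg (fun x => Real.rpow_nonneg (abs_nonneg _) _)
    (φ.integrable_abs_rpow (r := p + 1) (by linarith))).1 h0.symm
  refine integral_eq_zero_of_ae ?_
  filter_upwards [h1] with x hx
  have := (Real.rpow_eq_zero (abs_nonneg _) (by linarith : p + 1 ≠ 0)).1 hx
  simp [abs_eq_zero.1 this]

/-- The potential is almost additive on functions that hardly overlap. -/
lemma abs_potential_add_sub_sub_le (hp : 1 < p) {B : ℝ} (φ ψ : H2) (hφ : φ.sup ≤ B)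
    (hψ : ψ.sup ≤ B) :
    |potential p (φ.addMul ψ 1) - potential p φ - potential p ψ|
      ≤ (2 * (p + 1) * (2 * B) ^ (p - 1) + B ^ (p - 1)) * ∫ x, |φ x| * |ψ x| := by
  have hp2 : 2 ≤ p + 1 := by linarith
  have i1 := (φ.addMul ψ 1).integrable_abs_rpow hp2
  have i2 := φ.integrable_abs_rpow hp2
  have i3 := ψ.integrable_abs_rpow hp2
  have i12 : Integrable fun x => |(φ.addMul ψ 1) x| ^ (p + 1) - |φ x| ^ (p + 1) := i1.sub i2
  unfold potential
  rw [← integral_sub i1 i2, ← integral_sub i12 i3, ← integral_const_mul]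
  refine abs_integral_le_integral_abs.trans (integral_mono_ae (i12.sub i3).abs
    ((integrable_abs_mul_of_memLp φ.memLp ψ.memLp).const_mul _) ?_)
  filter_upwards [φ.ae_abs_le, ψ.ae_abs_le] with x hx hy
  have := abs_add_rpow_sub_sub_le hp2 (hx.trans hφ) (hy.trans hψ)
  simpa [addMul, show p + 1 - 2 = p - 1 by ring] using this

/-- The derivative of the potential along a line. -/
lemma hasDerivAt_potential_addMul (hp : 1 < p) (φ h : H2) :
    Integrable (fun x => |φ x| ^ (p - 1) * φ x * h x) ∧
    HasDerivAt (fun t => potential p (φ.addMul h t))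
      ((p + 1) * ∫ x, |φ x| ^ (p - 1) * φ x * h x) 0 := by
  set B := φ.sup + h.sup
  have key := hasDerivAt_integral_of_dominated_loc_of_deriv_le (μ := (volume : Measure ℝ)) (𝕜 := ℝ)
    (F := fun t x => |φ x + t * h x| ^ (p + 1))
    (F' := fun t x => ((p + 1) * |φ x + t * h x| ^ (p + 1 - 2) * (φ x + t * h x)) * h x)
    (x₀ := 0) (s := Ioo (-1) 1)
    (bound := fun x => (p + 1) * B ^ (p - 1) * ((|φ x| * |h x|) + h x ^ 2))
    (Ioo_mem_nhds (by norm_num) (by norm_num))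
    (.of_forall fun t => (φ.addMul h t).aestronglyMeasurable_abs_rpow (p + 1))
    (by simpa using φ.integrable_abs_rpow (r := p + 1) (by linarith))
    ?_ ?_ (((integrable_abs_mul_of_memLp φ.memLp h.memLp).add h.memLp.integrable_sq).const_mul _) ?_
  · obtain ⟨k1, k2⟩ := key
    simp only [zero_mul, add_zero, show p + 1 - 2 = p - 1 by ring] at k1 k2
    constructor
    · refine (k1.const_mul (p + 1)⁻¹).congr (.of_forall fun x => ?_)
      have : p + 1 ≠ 0 := by linarith
      simp only []
      field_simp
    · rw [← integral_const_mul]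
      have e : (fun x => (p + 1) * (|φ x| ^ (p - 1) * φ x * h x))
          = fun x => (p + 1) * |φ x| ^ (p - 1) * φ x * h x := by ext x; ring
      rw [e]
      exact k2
  · simp only [zero_mul, add_zero]
    exact (((φ.aestronglyMeasurable_abs_rpow _).const_mul (p + 1)).mul
      φ.memLp.aestronglyMeasurable).mul h.memLp.aestronglyMeasurable
  · filter_upwards [φ.ae_abs_le, h.ae_abs_le] with x h1 h2 t ht
    have ht' : |t| ≤ 1 := abs_le.2 ⟨ht.1.le, ht.2.le⟩
    have e1 : |t * h x| ≤ |h x| := by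
      rw [abs_mul]; exact mul_le_of_le_one_left (abs_nonneg _) ht'
    have e2 : |φ x + t * h x| ≤ |φ x| + |h x| := (abs_add_le _ _).trans (by linarith)
    rw [Real.norm_eq_abs, abs_mul, abs_mul, abs_mul, abs_of_pos (by linarith : 0 < p + 1),
      abs_of_nonneg (Real.rpow_nonneg (abs_nonneg _) _), show p + 1 - 2 = p - 1 by ring]
    have e3 : |φ x + t * h x| ^ (p - 1) ≤ B ^ (p - 1) :=
      Real.rpow_le_rpow (abs_nonneg _) (by linarith) (by linarith)
    have e4 : |φ x| * |h x| + h x ^ 2 = (|φ x| + |h x|) * |h x| := by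
      rw [← sq_abs]; ring
    rw [e4, mul_assoc]
    have := φ.sup_nonneg
    have := h.sup_nonneg
    have : 0 ≤ B := by positivity
    gcongr
  · refine .of_forall fun x t _ => ?_
    have hd : HasDerivAt (fun t => φ x + t * h x) (h x) t := by
      simpa using ((hasDerivAt_id t).mul_const (h x)).const_add (φ x)
    exact (hasDerivAt_abs_rpow (φ x + t * h x) (p := p + 1) (by linarith)).comp t hd

/-! ### Coercivity -/

/-- A sublinear power is absorbed by a linear term. The share 1/8 is chosen so that two such errors
turn the coefficient 1/2 of the second-derivative term into 1/4. -/
lemma exists_mul_rpow_le {γ : ℝ} (hγ0 : 0 ≤ γ) (hγ : γ < 1) {c : ℝ} (hc : 0 ≤ c) :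
    ∃ C, 0 ≤ C ∧ ∀ T : ℝ, 0 ≤ T → c * T ^ γ ≤ T / 8 + C := by
  have h := (tendsto_rpow_neg_atTop (sub_pos.2 hγ)).eventually
    (eventually_le_nhds (show 0 < 1 / (8 * (c + 1)) by positivity))
  obtain ⟨X, hX⟩ := eventually_atTop.1 (h.and (eventually_gt_atTop 0))
  refine ⟨c * (max X 0) ^ γ, by positivity, fun T hT => ?_⟩
  rcases le_total T (max X 0) with h1 | h1
  · have := Real.rpow_le_rpow hT h1 hγ0
    have := mul_le_mul_of_nonneg_left this hc
    linarith
  · obtain ⟨h2, hT0⟩ := hX T ((le_max_left _ _).trans h1)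
    replace h2 := mul_le_mul_of_nonneg_right h2 hT
    rw [← Real.rpow_add_one hT0.ne', show -(1 - γ) + 1 = γ by ring] at h2
    have h3 : 0 ≤ c * (max X 0) ^ γ := by positivity
    have h4 : c * T ^ γ ≤ c * (1 / (8 * (c + 1)) * T) := mul_le_mul_of_nonneg_left h2 hc
    have h5 : c * (1 / (8 * (c + 1)) * T) ≤ T / 8 := by
      rw [show c * (1 / (8 * (c + 1)) * T) = (c / (c + 1)) * (T / 8) by field_simp]
      refine mul_le_of_le_one_left (by positivity) ?_
      rw [div_le_one (by positivity)]; linarith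
    linarith

lemma gradSq_le_of_mass_le {L : ℝ} {φ : H2} (h : mass φ ≤ L) : φ.gradSq ≤ √L * √φ.bendSq :=
  φ.gradSq_le.trans (mul_le_mul_of_nonneg_right (Real.sqrt_le_sqrt h) (Real.sqrt_nonneg _))

/-- Two interpolations combined: sup² is of order √(mass · gradSq)^{1/2 · 2}, and gradSq is at most
√mass · √bendSq, so the supremum grows only like the power 1/8 of `bendSq`. -/
lemma sup_le_of_mass_le {L : ℝ} {φ : H2} (h : mass φ ≤ L) :
    φ.sup ≤ √(2 * (√L * √√L)) * φ.bendSq ^ (1 / 8 : ℝ) := by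
  have e : φ.bendSq ^ (1 / 8 : ℝ) = √√√φ.bendSq := by
    rw [Real.sqrt_eq_rpow, Real.sqrt_eq_rpow, Real.sqrt_eq_rpow, ← Real.rpow_mul φ.bendSq_nonneg,
      ← Real.rpow_mul φ.bendSq_nonneg]
    norm_num
  rw [e, ← Real.sqrt_mul (by positivity)]
  refine Real.sqrt_le_sqrt ?_
  have h1 : √φ.gradSq ≤ √√L * √√φ.bendSq := by
    rw [← Real.sqrt_mul (Real.sqrt_nonneg _)]
    exact Real.sqrt_le_sqrt (gradSq_le_of_mass_le h)
  have h2 := mul_le_mul (Real.sqrt_le_sqrt h) h1 (Real.sqrt_nonneg _) (Real.sqrt_nonneg _)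
  linarith

/-- The energy controls the second derivative on bounded sets of `L²`. -/
lemma exists_le_energy (hp1 : 1 < p) (hp9 : p < 9) (b : ℝ) {L : ℝ} (hL : 0 ≤ L) :
    ∃ C, 0 ≤ C ∧ ∀ φ : H2, mass φ ≤ L → φ.bendSq / 4 - C ≤ energy p b φ := by
  set k := √(2 * (√L * √√L))
  obtain ⟨C1, hC1, h1⟩ := exists_mul_rpow_le (γ := 1 / 2) (by norm_num) (by norm_num)
    (c := |b| / 2 * √L) (by positivity)
  -- The potential grows like `bendSq` to the power (p-1)/8, which is sublinear exactly because p <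
  -- 9.
  obtain ⟨C2, hC2, h2⟩ := exists_mul_rpow_le (γ := (p - 1) / 8) (by linarith) (by linarith)
    (c := 1 / (p + 1) * (k ^ (p - 1) * L)) (by positivity)
  refine ⟨C1 + C2, by positivity, fun φ hφ => ?_⟩
  rw [energy_eq, quad]
  have hT := φ.bendSq_nonneg
  have e1 := h1 _ hT
  have e2 := h2 _ hT
  have e3 : b * φ.gradSq ≤ |b| * (√L * √φ.bendSq) :=
    mul_le_mul (le_abs_self b) (gradSq_le_of_mass_le hφ) φ.gradSq_nonneg (abs_nonneg b)
  have e4 : potential p φ ≤ k ^ (p - 1) * L * φ.bendSq ^ ((p - 1) / 8) := by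
    have hs : φ.sup ^ (p - 1) ≤ k ^ (p - 1) * φ.bendSq ^ ((p - 1) / 8) := by
      refine (Real.rpow_le_rpow φ.sup_nonneg (sup_le_of_mass_le hφ) (by linarith)).trans ?_
      rw [Real.mul_rpow (Real.sqrt_nonneg _) (Real.rpow_nonneg hT _), ← Real.rpow_mul hT]
      exact le_of_eq (by congr 2; ring)
    have hk : 0 ≤ k ^ (p - 1) * φ.bendSq ^ ((p - 1) / 8) := by positivity
    refine (potential_le hp1 φ).trans ((mul_le_mul hs hφ φ.mass_nonneg hk).trans ?_)
    exact le_of_eq (by ring)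
  have e5 := mul_le_mul_of_nonneg_left e4 (show 0 ≤ 1 / (p + 1) by positivity)
  rw [← Real.sqrt_eq_rpow] at e1
  linarith

/-- Bounds in `L²` and for the energy give bounds for the derivatives and the supremum. -/
lemma exists_bound (hp1 : 1 < p) (hp9 : p < 9) (b : ℝ) (L K : ℝ) :
    ∃ B, 0 ≤ B ∧ ∀ φ : H2, mass φ ≤ L → energy p b φ ≤ K →
      φ.bendSq ≤ B ∧ φ.gradSq ≤ B ∧ φ.sup ≤ B := by
  obtain ⟨C, hC, h⟩ := exists_le_energy hp1 hp9 b (le_max_right L 0)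
  set L' := max L 0
  set B1 := max (4 * (K + C)) 0
  have hB1 : 0 ≤ B1 := le_max_right _ _
  refine ⟨max B1 (max (√L' * √B1) (√(2 * (√L' * √√L')) * B1 ^ (1 / 8 : ℝ))), by positivity,
    fun φ hφ hE => ?_⟩
  have hφ' : mass φ ≤ L' := hφ.trans (le_max_left _ _)
  have hT : φ.bendSq ≤ B1 := le_max_of_le_left (by linarith [h φ hφ'])
  refine ⟨le_max_of_le_left hT, le_max_of_le_right (le_max_of_le_left ?_),
    le_max_of_le_right (le_max_of_le_right ?_)⟩
  · exact (gradSq_le_of_mass_le hφ').trans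
      (mul_le_mul_of_nonneg_left (Real.sqrt_le_sqrt hT) (Real.sqrt_nonneg _))
  · exact (sup_le_of_mass_le hφ').trans (mul_le_mul_of_nonneg_left
      (Real.rpow_le_rpow φ.bendSq_nonneg hT (by norm_num)) (Real.sqrt_nonneg _))

end H2

namespace H2

/-! ### Change of amplitude and dilation -/

/-- `√(t s) φ(s ·)`, which multiplies the mass by `t`. -/
noncomputable def resize (φ : H2) (t : ℝ) {s : ℝ} (hs : 0 < s) : H2 := φ.affine √(t * s) hs 0

variable {p b t s : ℝ} (φ : H2)

lemma mass_resize (ht : 0 ≤ t) (hs : 0 < s) : mass (φ.resize t hs) = t * mass φ := by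
  rw [resize, mass_affine, Real.sq_sqrt (by positivity)]; field_simp

lemma gradSq_resize (ht : 0 ≤ t) (hs : 0 < s) :
    (φ.resize t hs).gradSq = t * s ^ 2 * φ.gradSq := by
  rw [resize, gradSq_affine, Real.sq_sqrt (by positivity)]; ring

lemma bendSq_resize (ht : 0 ≤ t) (hs : 0 < s) :
    (φ.resize t hs).bendSq = t * s ^ 4 * φ.bendSq := by
  rw [resize, bendSq_affine, Real.sq_sqrt (by positivity)]; ring

lemma potential_resize (ht : 0 ≤ t) (hs : 0 < s) :
    potential p (φ.resize t hs) = t ^ ((p + 1) / 2) * s ^ ((p - 1) / 2) * potential p φ := by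
  rw [resize, potential_affine, abs_of_nonneg (Real.sqrt_nonneg _), Real.sqrt_eq_rpow,
    ← Real.rpow_mul (by positivity), show 1 / 2 * (p + 1) = (p + 1) / 2 by ring,
    Real.mul_rpow ht hs.le, mul_assoc _ _ s⁻¹, ← Real.rpow_neg_one s, ← Real.rpow_add hs,
    show (p + 1) / 2 + -1 = (p - 1) / 2 by ring]

lemma energy_resize (ht : 0 ≤ t) (hs : 0 < s) : energy p b (φ.resize t hs)
    = t * ((1 / 2) * (s ^ 4 * φ.bendSq - b * (s ^ 2 * φ.gradSq)))
      - 1 / (p + 1) * (t ^ ((p + 1) / 2) * s ^ ((p - 1) / 2) * potential p φ) := by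
  rw [energy_eq, quad, gradSq_resize φ ht, bendSq_resize φ ht, potential_resize φ ht]; ring

lemma energy_resize_one (ht : 0 ≤ t) : energy p b (φ.resize t one_pos)
    = t * φ.quad b - 1 / (p + 1) * (t ^ ((p + 1) / 2) * potential p φ) := by
  rw [energy_resize φ ht, quad]; simp

lemma exists_mass_pos : ∃ φ : H2, 0 < mass φ := by
  let ρ : ContDiffBump (0 : ℝ) := ⟨1, 2, one_pos, by norm_num⟩
  have h0 : ContDiff ℝ 2 ρ := ρ.contDiff
  have h1 : ContDiff ℝ 1 (deriv ρ) := h0.deriv'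
  let φ : H2 := ofHasDerivAt (f := ρ) (f' := deriv ρ) (f'' := deriv (deriv ρ))
    (fun x => (h0.differentiable (by norm_num) x).hasDerivAt)
    (fun x => (h1.differentiable (by norm_num) x).hasDerivAt)
    (h1.continuous_deriv le_rfl) ρ.hasCompactSupport
  refine ⟨φ, ?_⟩
  have hc : Continuous fun x => ρ x ^ 2 := ρ.continuous.pow 2
  refine hc.integral_pos_of_hasCompactSupport_nonneg_nonzero (x := 0)
    ?_ (fun x => sq_nonneg _) ?_
  · exact ρ.hasCompactSupport.comp_left (g := fun x => x ^ 2) (by simp)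
  · have : ρ 0 = 1 := ρ.one_of_mem_closedBall (by simp [ρ])
    change ρ 0 ^ 2 ≠ 0
    simp [this]

lemma exists_mass_eq {lam : ℝ} (h : 0 ≤ lam) : ∃ φ : H2, mass φ = lam := by
  obtain ⟨φ, hφ⟩ := exists_mass_pos
  exact ⟨φ.resize (lam / mass φ) one_pos, by rw [mass_resize _ (by positivity)]; field_simp⟩

end H2

/-! ### The cost function -/

section cost

variable {p b : ℝ}

lemma energies_nonempty {lam : ℝ} (h : 0 ≤ lam) : (energies p b lam).Nonempty := by
  obtain ⟨φ, hφ⟩ := H2.exists_mass_eq h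
  exact ⟨_, φ, hφ, rfl⟩

lemma energies_bddBelow (hp1 : 1 < p) (hp9 : p < 9) (lam : ℝ) : BddBelow (energies p b lam) := by
  obtain ⟨C, _, h⟩ := H2.exists_le_energy hp1 hp9 b (le_max_right lam 0)
  refine ⟨-C, ?_⟩
  rintro _ ⟨φ, hφ, rfl⟩
  linarith [h φ (hφ.le.trans (le_max_left _ _)), φ.bendSq_nonneg]

lemma cost_le (hp1 : 1 < p) (hp9 : p < 9) (φ : H2) : cost p b (mass φ) ≤ energy p b φ :=
  csInf_le (energies_bddBelow hp1 hp9 _) ⟨φ, rfl, rfl⟩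

lemma cost_le_resize (hp1 : 1 < p) (hp9 : p < 9) (φ : H2) {t s : ℝ} (ht : 0 ≤ t) (hs : 0 < s) :
    cost p b (t * mass φ) ≤ t * ((1 / 2) * (s ^ 4 * φ.bendSq - b * (s ^ 2 * φ.gradSq)))
      - 1 / (p + 1) * (t ^ ((p + 1) / 2) * s ^ ((p - 1) / 2) * potential p φ) := by
  rw [← φ.energy_resize ht hs, ← φ.mass_resize ht hs]
  exact cost_le hp1 hp9 _

lemma cost_le_amplitude (hp1 : 1 < p) (hp9 : p < 9) (φ : H2) {t : ℝ} (ht : 0 ≤ t) :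
    cost p b (t * mass φ)
      ≤ t * φ.quad b - 1 / (p + 1) * (t ^ ((p + 1) / 2) * potential p φ) := by
  rw [← φ.energy_resize_one ht, ← φ.mass_resize ht one_pos]
  exact cost_le hp1 hp9 _

lemma exists_energy_lt {lam ε : ℝ} (h : 0 ≤ lam) (hε : 0 < ε) :
    ∃ φ : H2, mass φ = lam ∧ energy p b φ < cost p b lam + ε := by
  obtain ⟨_, ⟨φ, hφ, rfl⟩, h2⟩ := exists_lt_of_csInf_lt (energies_nonempty (p := p) (b := b) h)
    (show sInf (energies p b lam) < cost p b lam + ε from lt_add_of_pos_right _ hε)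
  exact ⟨φ, hφ, h2⟩

/-- With this value, concavity on the closed half line compares slopes of m with slopes from the
origin. -/
lemma cost_zero (hp1 : 1 < p) (hp9 : p < 9) : cost p b 0 = 0 := by
  apply le_antisymm
  · obtain ⟨φ, -⟩ := H2.exists_mass_pos
    have := cost_le_amplitude (b := b) hp1 hp9 φ le_rfl
    rwa [zero_mul, zero_mul, Real.zero_rpow (by linarith : (p + 1) / 2 ≠ 0), zero_mul, mul_zero,
      sub_zero] at this
  · refine le_csInf (energies_nonempty le_rfl) ?_
    rintro _ ⟨φ, hφ, rfl⟩
    change mass φ = 0 at hφ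
    have hD : φ.gradSq = 0 := le_antisymm (by simpa [hφ] using φ.gradSq_le) φ.gradSq_nonneg
    have hV : potential p φ = 0 :=
      le_antisymm (by simpa [hφ] using H2.potential_le hp1 φ) (H2.potential_nonneg p φ)
    rw [H2.energy_eq, H2.quad, hD, hV]
    linarith [φ.bendSq_nonneg]

/-- A function φ of mass z = αx + βy is rescaled in amplitude to the masses x and y. The quadratic
part is linear in the mass ratio and the power (p+1)/2 is convex, so the weighted mean of the two
energies is at most the energy of φ. Then the infimum is taken over φ. -/
lemma concaveOn_cost (hp1 : 1 < p) (hp9 : p < 9) : ConcaveOn ℝ (Ici 0) (cost p b) := by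
  refine ⟨convex_Ici 0, fun x hx y hy α β hα hβ hαβ => ?_⟩
  simp only [mem_Ici, smul_eq_mul] at *
  have hz : 0 ≤ α * x + β * y := by positivity
  -- At mass zero there is nothing to rescale by; every weighted term then vanishes.
  rcases hz.eq_or_lt with h0 | hpos
  · have h1 : α * x = 0 := by nlinarith [mul_nonneg hα hx, mul_nonneg hβ hy]
    have h2 : β * y = 0 := by nlinarith [mul_nonneg hα hx, mul_nonneg hβ hy]
    have aux : ∀ a z : ℝ, a * z = 0 → a * cost p b z = 0 := fun a z h => by
      rcases mul_eq_zero.1 h with h | h <;> simp [h, cost_zero hp1 hp9]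
    rw [← h0, cost_zero hp1 hp9, aux _ _ h1, aux _ _ h2, add_zero]
  · refine le_csInf (energies_nonempty hz) ?_
    rintro _ ⟨φ, hφ, rfl⟩
    change mass φ = _ at hφ
    set z := α * x + β * y
    have k1 := cost_le_amplitude (b := b) hp1 hp9 φ (t := x / z) (by positivity)
    have k2 := cost_le_amplitude (b := b) hp1 hp9 φ (t := y / z) (by positivity)
    rw [hφ, div_mul_cancel₀ _ hpos.ne'] at k1 k2
    have hc := (convexOn_rpow (p := (p + 1) / 2) (by linarith)).2 (x := x / z) (y := y / z)
      (show 0 ≤ x / z by positivity) (show 0 ≤ y / z by positivity) hα hβ hαβ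
    have e1 : α * (x / z) + β * (y / z) = 1 := by
      rw [mul_div_assoc', mul_div_assoc', ← add_div, div_self hpos.ne']
    simp only [smul_eq_mul] at hc
    rw [e1, Real.one_rpow] at hc
    rw [H2.energy_eq]
    have hV : 0 ≤ 1 / (p + 1) * potential p φ :=
      mul_nonneg (by positivity) (H2.potential_nonneg p φ)
    have k3 := mul_le_mul_of_nonneg_left k1 hα
    have k4 := mul_le_mul_of_nonneg_left k2 hβ
    have k5 := mul_le_mul_of_nonneg_right hc hV
    have k6 : (α * (x / z) + β * (y / z)) * φ.quad b = φ.quad b := by rw [e1, one_mul]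
    nlinarith

/-- Bounds the slopes from above down to the origin, where concavity alone would allow them to be
infinite. -/
lemma exists_cost_le_mul (hp1 : 1 < p) (hp9 : p < 9) :
    ∃ K, ∀ lam, 0 ≤ lam → cost p b lam ≤ K * lam := by
  obtain ⟨φ, hφ⟩ := H2.exists_mass_eq zero_le_one
  refine ⟨φ.quad b, fun lam h => ?_⟩
  have k := cost_le_amplitude (b := b) hp1 hp9 φ h
  rw [hφ, mul_one] at k
  have : 0 ≤ 1 / (p + 1) * (lam ^ ((p + 1) / 2) * potential p φ) :=
    mul_nonneg (by positivity) (mul_nonneg (by positivity) (H2.potential_nonneg p φ))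
  linarith

end cost

/-! ### Concave functions on the half line -/

section concave

variable {f : ℝ → ℝ}

lemma slope_le_slope_zero (hf : ConcaveOn ℝ (Ici 0) f) {x y : ℝ} (hx : 0 < x) (hxy : x < y) :
    (f y - f x) / (y - x) ≤ (f x - f 0) / (x - 0) :=
  hf.slope_anti_adjacent (mem_Ici.2 le_rfl) (mem_Ici.2 (hx.le.trans hxy.le)) hx hxy

/-- Slopes of a concave function decrease, so those on [0, c] lie between the slope `S` over [c,
c+1] and the bound `K` for slopes from the origin. -/
lemma exists_lipschitzOnWith (hf : ConcaveOn ℝ (Ici 0) f) (h0 : f 0 = 0) {K : ℝ}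
    (hK : ∀ x, 0 ≤ x → f x ≤ K * x) (c : ℝ) : ∃ K' : ℝ≥0, LipschitzOnWith K' f (Icc 0 c) := by
  set S := f (c + 1) - f c
  refine ⟨Real.toNNReal (max |K| |S|), LipschitzOnWith.of_dist_le' fun x hx y hy => ?_⟩
  wlog hxy : x < y generalizing x y
  · rcases (not_lt.1 hxy).eq_or_lt with rfl | h
    · simp
    · rw [dist_comm, dist_comm x y]; exact this y hy x hx h
  have hyx : 0 < y - x := sub_pos.2 hxy
  have h1 : (f y - f x) / (y - x) ≤ K := by
    rcases hx.1.eq_or_lt with rfl | hx0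
    · rw [h0, sub_zero, sub_zero, div_le_iff₀ (by linarith)]; exact hK y hy.1
    · refine (slope_le_slope_zero hf hx0 hxy).trans ?_
      rw [h0, sub_zero, sub_zero, div_le_iff₀ hx0]; exact hK x hx.1
  have h2 : S ≤ (f y - f x) / (y - x) := by
    have hc0 : 0 ≤ c := hx.1.trans hx.2
    have hyc : y < c + 1 := by linarith [hy.2]
    have e1 := hf.slope_anti_adjacent hx.1 (mem_Ici.2 (by linarith : 0 ≤ c + 1)) hxy hyc
    refine le_trans ?_ e1
    rcases hy.2.eq_or_lt with rfl | hyc'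
    · simp [S]
    · have hne : 0 < c + 1 - y := by linarith
      have a1 : 0 ≤ 1 / (c + 1 - y) := by positivity
      have a2 : 0 ≤ (c - y) / (c + 1 - y) := by apply div_nonneg <;> linarith
      have := hf.2 hy.1 (mem_Ici.2 (by linarith : 0 ≤ c + 1)) a1 a2 (by field_simp; ring)
      simp only [smul_eq_mul] at this
      rw [show 1 / (c + 1 - y) * y + (c - y) / (c + 1 - y) * (c + 1) = c by field_simp; ring] at this
      rw [le_div_iff₀ hne]
      have e2 := mul_le_mul_of_nonneg_right this hne.le
      rw [show (1 / (c + 1 - y) * f y + (c - y) / (c + 1 - y) * f (c + 1)) * (c + 1 - y)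
        = f y + (c - y) * f (c + 1) by field_simp] at e2
      simp only [S]; nlinarith
  rw [Real.dist_eq, Real.dist_eq, abs_sub_comm, abs_sub_comm x y, abs_of_pos hyx,
    ← div_le_iff₀ hyx]
  rw [show |f y - f x| / (y - x) = |(f y - f x) / (y - x)| by rw [abs_div, abs_of_pos hyx]]
  refine abs_le.2 ⟨?_, h1.trans ((le_abs_self K).trans (le_max_left _ _))⟩
  linarith [le_max_right |K| |S|, neg_abs_le S]

end concave

/-! ### Regularity and monotonicity of the cost. -/

section cost

variable {p b : ℝ}

lemma cost_lipschitzOnWith (hp1 : 1 < p) (hp9 : p < 9) (c : ℝ) :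
    ∃ K : ℝ≥0, LipschitzOnWith K (cost p b) (Icc 0 c) := by
  obtain ⟨K, hK⟩ := exists_cost_le_mul (b := b) hp1 hp9
  exact exists_lipschitzOnWith (concaveOn_cost hp1 hp9) (cost_zero hp1 hp9) hK c

lemma continuousOn_cost (hp1 : 1 < p) (hp9 : p < 9) : ContinuousOn (cost p b) (Ici 0) := by
  intro x hx
  obtain ⟨K, hK⟩ := cost_lipschitzOnWith (b := b) hp1 hp9 (x + 1)
  have h1 := hK.continuousOn x ⟨hx, by linarith⟩
  refine h1.mono_of_mem_nhdsWithin ?_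
  filter_upwards [self_mem_nhdsWithin, mem_nhdsWithin_of_mem_nhds (Iio_mem_nhds (lt_add_one x))]
    with y h2 h3 using ⟨h2, le_of_lt h3⟩

lemma continuousAt_cost (hp1 : 1 < p) (hp9 : p < 9) {lam : ℝ} (h : 0 < lam) :
    ContinuousAt (cost p b) lam :=
  (continuousOn_cost hp1 hp9).continuousAt (Ici_mem_nhds h)

/-- For `0 < μ`, a negative cost at `μ` makes the cost strictly decreasing beyond `μ`. -/
lemma cost_lt_cost (hp1 : 1 < p) (hp9 : p < 9) {lam μ : ℝ} (hμ : 0 < μ) (hneg : cost p b μ < 0)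
    (h : μ < lam) : cost p b lam < cost p b μ := by
  have h1 := slope_le_slope_zero (concaveOn_cost (b := b) hp1 hp9) hμ h
  rw [cost_zero hp1 hp9, sub_zero, sub_zero] at h1
  have h2 : (cost p b lam - cost p b μ) / (lam - μ) < 0 := h1.trans_lt (div_neg_of_neg_of_pos hneg hμ)
  rw [div_lt_iff₀ (sub_pos.2 h)] at h2
  linarith

/-- Concavity and the value zero at the origin: m(ν)/ν is nonincreasing. This is the subadditivity
used against splitting of mass. -/
lemma div_mul_cost_le (hp1 : 1 < p) (hp9 : p < 9) {lam ν : ℝ} (h0 : 0 ≤ ν) (hl : 0 < lam)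
    (h : ν ≤ lam) : ν / lam * cost p b lam ≤ cost p b ν := by
  have := (concaveOn_cost (b := b) hp1 hp9).2 (mem_Ici.2 hl.le) (mem_Ici.2 le_rfl)
    (show 0 ≤ ν / lam by positivity)
    (show 0 ≤ 1 - ν / lam by rw [sub_nonneg, div_le_one hl]; exact h) (by ring)
  simp only [smul_eq_mul, mul_zero, add_zero, cost_zero hp1 hp9] at this
  rwa [div_mul_cancel₀ _ hl.ne'] at this

/-! ### Minimizers and multipliers -/

/-- The value a Lagrange multiplier of `φ` must have. -/
noncomputable def H2.mult (p b : ℝ) (φ : H2) : ℝ := (potential p φ - 2 * φ.quad b) / mass φ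

lemma IsMinimizer.energy_eq_cost {lam : ℝ} {φ : H2} (h : IsMinimizer p b lam φ) :
    energy p b φ = cost p b lam := by
  have hl : IsLeast (energies p b lam) (energy p b φ) := by
    refine ⟨⟨φ, h.1, rfl⟩, ?_⟩
    rintro _ ⟨ψ, hψ, rfl⟩
    exact h.2 ψ hψ
  exact hl.csInf_eq.symm

lemma isMinimizer_of_energy_le (hp1 : 1 < p) (hp9 : p < 9) {lam : ℝ} {φ : H2} (hm : mass φ = lam)
    (h : energy p b φ ≤ cost p b lam) : IsMinimizer p b lam φ :=
  ⟨hm, fun ψ hψ => h.trans (hψ ▸ cost_le hp1 hp9 ψ)⟩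

/-- The quadratic part is eliminated through the value of the minimum. At a given mass the
multiplier thus depends on the minimizer only through its potential. -/
lemma IsMinimizer.mult_eq (hp1 : 1 < p) {lam : ℝ} {φ : H2} (h : IsMinimizer p b lam φ) :
    φ.mult p b = ((p - 1) / (p + 1) * potential p φ - 2 * cost p b lam) / lam := by
  have h1 := h.energy_eq_cost
  rw [H2.energy_eq] at h1
  rw [H2.mult, h.1, ← h1]
  have : p + 1 ≠ 0 := by linarith
  congr 1
  field_simp
  ring

/-- The multiplier of a minimizer is a strict supergradient of the cost. -/
lemma IsMinimizer.cost_lt (hp1 : 1 < p) (hp9 : p < 9) {lam μ : ℝ} (hl : 0 < lam) {φ : H2}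
    (h : IsMinimizer p b lam φ) (hμ : 0 ≤ μ) (hne : μ ≠ lam) :
    cost p b μ < cost p b lam + -φ.mult p b / 2 * (μ - lam) := by
  have k := cost_le_amplitude (b := b) hp1 hp9 φ (t := μ / lam) (by positivity)
  rw [h.1, div_mul_cancel₀ _ hl.ne'] at k
  have hV : 0 < potential p φ := H2.potential_pos hp1 (h.1 ▸ hl)
  -- Strict Bernoulli inequality: the power (p+1)/2 of the mass ratio lies strictly above its
  -- tangent at 1, so the ray lies strictly below its own.
  have hB := one_add_mul_self_lt_rpow_one_add (s := μ / lam - 1)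
    (by linarith [show 0 ≤ μ / lam by positivity])
    (by rw [sub_ne_zero, ne_eq, div_eq_one_iff_eq hl.ne']; exact hne)
    (p := (p + 1) / 2) (by linarith)
  rw [add_sub_cancel] at hB
  have hq := mul_lt_mul_of_pos_right hB (show 0 < 1 / (p + 1) * potential p φ by positivity)
  have e : cost p b lam + -φ.mult p b / 2 * (μ - lam)
      = μ / lam * φ.quad b
        - (1 + (p + 1) / 2 * (μ / lam - 1)) * (1 / (p + 1) * potential p φ) := by
    rw [← h.energy_eq_cost, H2.energy_eq, H2.mult, h.1]
    have : p + 1 ≠ 0 := by linarith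
    field_simp
    ring
  rw [e]
  linarith

lemma integral_multiplier_terms (hp : 1 < p) (φ h : H2) (w : ℝ) :
    ∫ x, (φ.d2 x * h.d2 x + b * φ.d2 x * h x + w * φ x * h x - |φ x| ^ (p - 1) * φ x * h x)
      = (∫ x, φ.d2 x * h.d2 x) - b * (∫ x, φ.d1 x * h.d1 x) + w * (∫ x, φ x * h x)
        - ∫ x, |φ x| ^ (p - 1) * φ x * h x := by
  have i1 := integrable_mul_of_memLp φ.memLp_d2 h.memLp_d2
  have i2 := (integrable_mul_of_memLp φ.memLp_d2 h.memLp).const_mul b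
  have i3 := (integrable_mul_of_memLp φ.memLp h.memLp).const_mul w
  have i4 := (H2.hasDerivAt_potential_addMul hp φ h).1
  have i12 : Integrable fun x => φ.d2 x * h.d2 x + b * (φ.d2 x * h x) := i1.add i2
  have i123 : Integrable fun x => φ.d2 x * h.d2 x + b * (φ.d2 x * h x) + w * (φ x * h x) :=
    i12.add i3
  simp only [mul_assoc b, mul_assoc w]
  rw [integral_sub i123 i4, integral_add i12 i3, integral_add i1 i2, integral_const_mul,
    integral_const_mul, H2.integral_d1_mul_d1]
  ring

/-- The equation tested against φ itself determines the multiplier. -/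
lemma IsMultiplier.eq_mult (hp : 1 < p) {φ : H2} (hm : 0 < mass φ) {w : ℝ}
    (h : IsMultiplier p b φ w) : w = φ.mult p b := by
  have h1 := h φ
  rw [integral_multiplier_terms hp] at h1
  have e : ∀ x, |φ x| ^ (p - 1) * φ x * φ x = |φ x| ^ (p + 1) := fun x => by
    rw [show p + 1 = (p - 1) + 2 by ring, Real.rpow_add_of_nonneg (abs_nonneg _) (by linarith)
      (by norm_num), Real.rpow_two, sq_abs]
    ring
  simp_rw [e, ← sq] at h1
  change φ.bendSq - b * φ.gradSq + w * mass φ - potential p φ = 0 at h1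
  rw [H2.mult, H2.quad, eq_div_iff hm.ne']
  linarith

/-- The variation φ + t k is returned to mass λ by a change of amplitude, with mass ratio λ / mass(φ
+ t k). The resulting energy is minimal at t = 0, and its vanishing derivative is the equation. -/
lemma IsMinimizer.isMultiplier (hp1 : 1 < p) (hp9 : p < 9) {lam : ℝ} (hl : 0 < lam) {φ : H2}
    (h : IsMinimizer p b lam φ) : IsMultiplier p b φ (φ.mult p b) := by
  intro k
  rw [integral_multiplier_terms hp1]
  set Mx := ∫ x, φ x * k x
  set Dx := ∫ x, φ.d1 x * k.d1 x
  set Tx := ∫ x, φ.d2 x * k.d2 x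
  set Vx := ∫ x, |φ x| ^ (p - 1) * φ x * k x
  have quadr : ∀ a c d : ℝ, HasDerivAt (fun t : ℝ => a + 2 * t * c + t ^ 2 * d) (2 * c) 0 := by
    intro a c d
    have h1 : HasDerivAt (fun t : ℝ => 2 * t * c) (2 * c) 0 := by
      simpa using ((hasDerivAt_id (0 : ℝ)).const_mul 2).mul_const c
    have h2 : HasDerivAt (fun t : ℝ => t ^ 2 * d) 0 0 := by
      simpa using ((hasDerivAt_id (0 : ℝ)).pow 2).mul_const d
    exact ((h1.const_add a).add h2).congr_deriv (add_zero _)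
  have hM : HasDerivAt (fun t => mass (φ.addMul k t)) (2 * Mx) 0 := by
    simp_rw [H2.mass_addMul]; exact quadr _ _ _
  have hQ : HasDerivAt (fun t => (φ.addMul k t).quad b) (Tx - b * Dx) 0 := by
    unfold H2.quad
    simp_rw [H2.gradSq_addMul, H2.bendSq_addMul]
    refine (((quadr φ.bendSq Tx k.bendSq).sub
      ((quadr φ.gradSq Dx k.gradSq).const_mul b)).const_mul (1 / 2)).congr_deriv ?_
    ring
  have hV := (H2.hasDerivAt_potential_addMul hp1 φ k).2
  change HasDerivAt _ ((p + 1) * Vx) 0 at hV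
  have z0 : mass (φ.addMul k 0) = lam := by rw [H2.mass_addMul]; simp [h.1]
  have z1 : (φ.addMul k 0).quad b = φ.quad b := by
    rw [H2.quad, H2.gradSq_addMul, H2.bendSq_addMul, H2.quad]; simp
  have z2 : potential p (φ.addMul k 0) = potential p φ := by simp [potential, H2.addMul]
  have hθ : HasDerivAt (fun t => lam / mass (φ.addMul k t)) (-(2 * Mx) / lam) 0 := by
    have := (hasDerivAt_const (0 : ℝ) lam).div hM (by rw [z0]; exact hl.ne')
    refine this.congr_deriv ?_
    rw [z0]; field_simp; ring
  have hθq : HasDerivAt (fun t => (lam / mass (φ.addMul k t)) ^ ((p + 1) / 2))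
      (-(2 * Mx) / lam * ((p + 1) / 2)) 0 := by
    have := hθ.rpow_const (p := (p + 1) / 2) (Or.inr (by linarith))
    refine this.congr_deriv ?_
    rw [z0, div_self hl.ne', Real.one_rpow]; ring
  have hG := (hθ.mul hQ).sub ((hθq.mul hV).const_mul (1 / (p + 1)))
  have hmin : IsLocalMin ((fun t => lam / mass (φ.addMul k t)) * (fun t => (φ.addMul k t).quad b)
      - fun t => 1 / (p + 1) * ((fun t => (lam / mass (φ.addMul k t)) ^ ((p + 1) / 2)) *
        fun t => potential p (φ.addMul k t)) t) 0 := by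
    have hpos : ∀ᶠ t in 𝓝 (0 : ℝ), 0 < mass (φ.addMul k t) :=
      hM.continuousAt.eventually (lt_mem_nhds (z0.symm ▸ hl : 0 < mass (φ.addMul k 0)))
    filter_upwards [hpos] with t ht
    simp only [Pi.sub_apply, Pi.mul_apply]
    rw [z0, z1, z2, div_self hl.ne', Real.one_rpow, one_mul, one_mul, ← H2.energy_eq,
      h.energy_eq_cost]
    have := cost_le_amplitude (b := b) hp1 hp9 (φ.addMul k t) (t := lam / mass (φ.addMul k t))
      (by positivity)
    rwa [div_mul_cancel₀ _ ht.ne'] at this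
  have hz := hmin.hasDerivAt_eq_zero hG
  rw [z0, z1, z2, div_self hl.ne', Real.one_rpow] at hz
  rw [H2.mult, h.1]
  have hp0 : p + 1 ≠ 0 := by linarith
  rw [← hz]
  field_simp
  ring

end cost

/-! ### Weak limits -/

/-- Riesz representation moves the sequence to the dual of L², where Banach–Alaoglu applies. -/
lemma exists_weak_limit {f : ℕ → ℝ → ℝ} (hf : ∀ n, MemLp (f n) 2 volume) {B : ℝ}
    (hB : ∀ n, ∫ x, f n x ^ 2 ≤ B) :
    ∃ g : ℝ → ℝ, MemLp g 2 volume ∧ ∃ ns : ℕ → ℕ, StrictMono ns ∧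
      ∀ h : ℝ → ℝ, MemLp h 2 volume →
        Tendsto (fun n => ∫ x, f (ns n) x * h x) atTop (𝓝 (∫ x, g x * h x)) := by
  have hinner : ∀ {u v : ℝ → ℝ} (hu : MemLp u 2 volume) (hv : MemLp v 2 volume),
      inner ℝ (hu.toLp u) (hv.toLp v) = ∫ x, u x * v x := fun {u v} hu hv => by
    rw [L2.inner_def]
    refine integral_congr_ae ?_
    filter_upwards [hu.coeFn_toLp, hv.coeFn_toLp] with x h1 h2
    rw [h1, h2]; simp [mul_comm]
  have : Fact ((1 : ENNReal) ≤ 2) := ⟨by norm_num⟩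
  have : Fact ((2 : ENNReal) ≠ ⊤) := ⟨by norm_num⟩
  -- Separability of L² is what makes weak-* closed balls sequentially compact.
  have : SecondCountableTopology (Lp ℝ 2 (volume : Measure ℝ)) := Lp.SecondCountableTopology
  let E := Lp ℝ 2 (volume : Measure ℝ)
  let u : ℕ → E := fun n => (hf n).toLp (f n)
  have hu : ∀ n, ‖u n‖ ≤ √B := fun n => by
    rw [← Real.sqrt_sq (norm_nonneg (u n)), ← real_inner_self_eq_norm_sq]
    refine Real.sqrt_le_sqrt ?_
    rw [hinner (hf n) (hf n)]
    simpa only [sq] using hB n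
  let U : ℕ → WeakDual ℝ E := fun n => StrongDual.toWeakDual (InnerProductSpace.toDual ℝ E (u n))
  obtain ⟨a, -, ns, hns, hlim⟩ := WeakDual.isSeqCompact_closedBall ℝ E 0 √B (x := U) (fun n => by
    simpa [U] using hu n)
  let g : E := (InnerProductSpace.toDual ℝ E).symm (WeakDual.toStrongDual a)
  refine ⟨g, Lp.memLp g, ns, hns, fun h hh => ?_⟩
  have h1 : Tendsto (fun n => U (ns n) (hh.toLp h)) atTop (𝓝 (a (hh.toLp h))) :=
    ((WeakDual.eval_continuous (hh.toLp h)).tendsto a).comp hlim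
  have e1 : ∀ n, U (ns n) (hh.toLp h) = ∫ x, f (ns n) x * h x := fun n => by
    rw [← hinner (hf _) hh]; rfl
  have e2 : a (hh.toLp h) = ∫ x, g x * h x := by
    have : inner ℝ g (hh.toLp h) = a (hh.toLp h) := by
      simp only [g, InnerProductSpace.toDual_symm_apply]; rfl
    rw [← this, ← hinner (Lp.memLp g) hh, Lp.toLp_coeFn]
  simpa only [e1, e2] using h1

namespace H2

/-- Weak convergence in `H²`. -/
def WeakTendsto (φ : ℕ → H2) (Φ : H2) : Prop :=
  ∀ h : ℝ → ℝ, MemLp h 2 volume →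
    Tendsto (fun n => ∫ x, φ n x * h x) atTop (𝓝 (∫ x, Φ x * h x)) ∧
    Tendsto (fun n => ∫ x, (φ n).d1 x * h x) atTop (𝓝 (∫ x, Φ.d1 x * h x)) ∧
    Tendsto (fun n => ∫ x, (φ n).d2 x * h x) atTop (𝓝 (∫ x, Φ.d2 x * h x))

lemma hasWeakDeriv_of_tendsto {f g : ℕ → ℝ → ℝ} {F G : ℝ → ℝ} (h : ∀ n, HasWeakDeriv (f n) (g n))
    (hf : ∀ k, MemLp k 2 volume → Tendsto (fun n => ∫ x, f n x * k x) atTop (𝓝 (∫ x, F x * k x)))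
    (hg : ∀ k, MemLp k 2 volume → Tendsto (fun n => ∫ x, g n x * k x) atTop (𝓝 (∫ x, G x * k x))) :
    HasWeakDeriv F G := fun η hη hs => by
  have m1 := memLp_two_of_continuous hη.continuous hs
  have m2 := memLp_two_of_continuous (hη.continuous_deriv (by simp)) hs.deriv
  refine tendsto_nhds_unique (hf _ m2) ?_
  simp_rw [fun n => h n η hη hs]
  exact (hg _ m1).neg

/-- Three nested subsequences. The weak derivative relations survive because test functions and
their derivatives belong to L². -/
lemma exists_weakTendsto (φ : ℕ → H2) {B : ℝ} (h0 : ∀ n, mass (φ n) ≤ B)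
    (h1 : ∀ n, (φ n).gradSq ≤ B) (h2 : ∀ n, (φ n).bendSq ≤ B) :
    ∃ Φ : H2, ∃ ns : ℕ → ℕ, StrictMono ns ∧ WeakTendsto (φ ∘ ns) Φ := by
  obtain ⟨f, mf, n0, s0, hf⟩ := exists_weak_limit (fun n => (φ n).memLp) h0
  obtain ⟨g, mg, n1, s1, hg⟩ := exists_weak_limit (fun n => (φ (n0 n)).memLp_d1) (fun n => h1 _)
  obtain ⟨k, mk, n2, s2, hk⟩ :=
    exists_weak_limit (fun n => (φ (n0 (n1 n))).memLp_d2) (fun n => h2 _)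
  have hf' := fun h mh => (hf h mh).comp (s1.comp s2).tendsto_atTop
  have hg' := fun h mh => (hg h mh).comp s2.tendsto_atTop
  exact ⟨⟨f, g, k, mf, mg, mk, hasWeakDeriv_of_tendsto (fun n => (φ (n0 (n1 (n2 n)))).weak_d1) hf' hg',
    hasWeakDeriv_of_tendsto (fun n => (φ (n0 (n1 (n2 n)))).weak_d2) hg' hk⟩, n0 ∘ n1 ∘ n2,
    s0.comp (s1.comp s2), fun h mh => ⟨hf' h mh, hg' h mh, hk h mh⟩⟩

/-- Point values of the continuous representative as pairings with square integrable functions. -/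
lemma rep_eq (φ : H2) (x : ℝ) :
    φ.rep x = (∫ y, φ y * (Ioc x (x + 1)).indicator (fun _ => 1) y)
      - ∫ y, φ.d1 y * (Ioc x (x + 1)).indicator (fun y => x + 1 - y) y := by
  -- The weight is 1 at `x` and 0 at `x + 1`, so the boundary terms of the product rule leave only
  -- the value at `x`.
  have hp : IsPrimitive (fun y => x + 1 - y) (fun _ => -1) :=
    isPrimitive_of_hasDerivAt (fun y => by simpa using (hasDerivAt_id y).const_sub (x + 1))
      continuous_const
  have h := φ.isPrimitive_rep.mul_sub_mul hp x (x + 1)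
  have hle : x ≤ x + 1 := by linarith
  have i1 : IntervalIntegrable (fun y => φ.d1 y * (x + 1 - y)) volume x (x + 1) :=
    (φ.isPrimitive_rep.intervalIntegrable _ _).mul_continuousOn (by fun_prop)
  have i2 : IntervalIntegrable (fun y => φ.rep y * -1) volume x (x + 1) :=
    (φ.continuous_rep.mul continuous_const).intervalIntegrable _ _
  rw [intervalIntegral.integral_add i1 i2, intervalIntegral.integral_of_le hle,
    intervalIntegral.integral_of_le hle, ← integral_indicator measurableSet_Ioc,
    ← integral_indicator measurableSet_Ioc] at h
  have e1 : ∫ y, (Ioc x (x + 1)).indicator (fun y => φ.d1 y * (x + 1 - y)) y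
      = ∫ y, φ.d1 y * (Ioc x (x + 1)).indicator (fun y => x + 1 - y) y := by
    congr 1; ext y; by_cases hy : y ∈ Ioc x (x + 1) <;> simp [hy]
  have e2 : ∫ y, (Ioc x (x + 1)).indicator (fun y => φ.rep y * -1) y
      = -∫ y, φ y * (Ioc x (x + 1)).indicator (fun _ => 1) y := by
    rw [← integral_neg]
    refine integral_congr_ae ?_
    filter_upwards [φ.ae_eq_rep] with y hy
    rw [hy]
    by_cases hy : y ∈ Ioc x (x + 1) <;> simp [hy]
  rw [e1, e2] at h
  linarith

lemma memLp_indicator_Ioc {k : ℝ → ℝ} (hk : Continuous k) (a b : ℝ) :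
    MemLp ((Ioc a b).indicator k) 2 volume := by
  rw [memLp_indicator_iff_restrict measurableSet_Ioc]
  obtain ⟨C, hC⟩ := (isCompact_Icc (a := a) (b := b)).exists_bound_of_continuousOn hk.continuousOn
  have : IsFiniteMeasure (volume.restrict (Ioc a b)) := ⟨by simp⟩
  refine MemLp.of_bound hk.aestronglyMeasurable C ?_
  filter_upwards [ae_restrict_mem measurableSet_Ioc] with x hx
  exact hC x (Ioc_subset_Icc_self hx)

lemma WeakTendsto.rep {φ : ℕ → H2} {Φ : H2} (h : WeakTendsto φ Φ) (x : ℝ) :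
    Tendsto (fun n => (φ n).rep x) atTop (𝓝 (Φ.rep x)) := by
  simp_rw [rep_eq]
  exact (h _ (memLp_indicator_Ioc continuous_const _ _)).1.sub
    (h _ (memLp_indicator_Ioc (by fun_prop) _ _)).2.1

/-- The function g is approximated in L² by a compactly supported k. Dominated convergence handles
k, and Cauchy–Schwarz with the uniform L² bound handles g - k. -/
lemma tendsto_integral_abs_mul {g : ℝ → ℝ} (hg : MemLp g 2 volume) {u : ℕ → ℝ → ℝ}
    (hu : ∀ n, MemLp (u n) 2 volume) {B : ℝ} (hB : ∀ n, ∫ x, u n x ^ 2 ≤ B)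
    (hb : ∀ n, ∀ᵐ x, |u n x| ≤ B) (hlim : ∀ᵐ x, Tendsto (fun n => u n x) atTop (𝓝 0)) :
    Tendsto (fun n => ∫ x, |g x| * |u n x|) atTop (𝓝 0) := by
  rw [Metric.tendsto_atTop]
  intro ε hε
  have hδ : 0 < ε / (2 * (√B + 1)) := by positivity
  obtain ⟨k, hks, hk, hkc, mk⟩ := hg.exists_hasCompactSupport_eLpNorm_sub_le (by norm_num)
    (ε := ENNReal.ofReal (ε / (2 * (√B + 1)))) (by simpa using hδ)
  have mgk : MemLp (fun x => g x - k x) 2 volume := hg.sub mk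
  have hgk : √(∫ x, (g x - k x) ^ 2) ≤ ε / (2 * (√B + 1)) := by
    have e := mgk.eLpNorm_eq_integral_rpow_norm (by norm_num) (by norm_num)
    rw [show (fun x => g x - k x) = g - k from rfl] at e
    rw [e, ENNReal.ofReal_le_ofReal_iff hδ.le] at hk
    simpa [Real.sqrt_eq_rpow] using hk
  have h1 : Tendsto (fun n => ∫ x, |k x| * |u n x|) atTop (𝓝 0) := by
    have := tendsto_integral_of_dominated_convergence (μ := (volume : Measure ℝ))
      (F := fun n x => |k x| * |u n x|) (f := fun _ => 0) (fun x => |k x| * B)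
      (fun n => (integrable_abs_mul_of_memLp mk (hu n)).aestronglyMeasurable)
      ((hkc.integrable_of_hasCompactSupport hks).abs.mul_const B)
      (fun n => by
        filter_upwards [hb n] with x hx
        rw [Real.norm_of_nonneg (by positivity)]
        exact mul_le_mul_of_nonneg_left hx (abs_nonneg _))
      (by
        filter_upwards [hlim] with x hx
        simpa using hx.abs.const_mul |k x|)
    simpa using this
  obtain ⟨N, hN⟩ := Metric.tendsto_atTop.1 h1 (ε / 2) (by positivity)
  refine ⟨N, fun n hn => ?_⟩
  have e1 := hN n hn
  rw [Real.dist_eq, sub_zero] at e1 ⊢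
  rw [abs_of_nonneg (integral_nonneg fun x => by positivity)] at e1 ⊢
  have i1 := integrable_abs_mul_of_memLp mk (hu n)
  have i2 := integrable_abs_mul_of_memLp mgk (hu n)
  have e2 : ∫ x, |g x| * |u n x| ≤ (∫ x, |k x| * |u n x|) + ∫ x, |g x - k x| * |u n x| := by
    rw [← integral_add i1 i2]
    refine integral_mono (integrable_abs_mul_of_memLp hg (hu n)) (i1.add i2) fun x => ?_
    simp only
    rw [← add_mul]
    refine mul_le_mul_of_nonneg_right ?_ (abs_nonneg _)
    have := abs_add_le (k x) (g x - k x)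
    rwa [add_sub_cancel] at this
  have e3 := integral_abs_mul_le mgk (hu n)
  have e4 : √(∫ x, (g x - k x) ^ 2) * √(∫ x, u n x ^ 2) ≤ ε / (2 * (√B + 1)) * √B :=
    mul_le_mul hgk (Real.sqrt_le_sqrt (hB n)) (Real.sqrt_nonneg _) hδ.le
  have e5 : ε / (2 * (√B + 1)) * √B ≤ ε / 2 := by
    rw [div_mul_eq_mul_div, div_le_div_iff₀ (by positivity) (by norm_num)]
    nlinarith [Real.sqrt_nonneg B]
  linarith

lemma potential_le_of_abs_rep_le {p : ℝ} (hp : 1 < p) (φ : H2) {δ : ℝ}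
    (h : ∀ x, |φ.rep x| ≤ δ) : potential p φ ≤ δ ^ (p - 1) * mass φ := by
  unfold potential mass
  rw [← integral_const_mul]
  refine integral_mono_ae (φ.integrable_abs_rpow (by linarith))
    (φ.memLp.integrable_sq.const_mul _) ?_
  filter_upwards [φ.ae_eq_rep] with x hx
  have := abs_rpow_le (r := p + 1) (by linarith) (hx ▸ h x : |φ x| ≤ δ)
  rwa [show p + 1 - 2 = p - 1 by ring] at this

/-! ### Translations and differences. -/

/-- `φ(· + y)`. -/
noncomputable def shift (φ : H2) (y : ℝ) : H2 := φ.affine 1 one_pos y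

lemma mass_shift (φ : H2) (y : ℝ) : mass (φ.shift y) = mass φ := by
  rw [shift, mass_affine]; simp

lemma gradSq_shift (φ : H2) (y : ℝ) : (φ.shift y).gradSq = φ.gradSq := by
  rw [shift, gradSq_affine]; simp

lemma bendSq_shift (φ : H2) (y : ℝ) : (φ.shift y).bendSq = φ.bendSq := by
  rw [shift, bendSq_affine]; simp

lemma potential_shift (p : ℝ) (φ : H2) (y : ℝ) : potential p (φ.shift y) = potential p φ := by
  rw [shift, potential_affine]; simp

lemma energy_shift (p b : ℝ) (φ : H2) (y : ℝ) : energy p b (φ.shift y) = energy p b φ := by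
  rw [energy_eq, energy_eq, quad, quad, gradSq_shift, bendSq_shift, potential_shift]

lemma rep_shift (φ : H2) (y x : ℝ) : (φ.shift y).rep x = φ.rep (x + y) := by
  have h1 : (φ.shift y).rep =ᵐ[volume] fun x => φ.rep (x + y) := by
    have h2 := (measurePreserving_add_right volume y).quasiMeasurePreserving.ae_eq_comp φ.ae_eq_rep
    filter_upwards [(φ.shift y).ae_eq_rep, h2] with z h3 h4
    simp only [Function.comp_apply] at h4
    rw [← h3, ← h4]
    simp [shift, affine]
  have := (Continuous.ae_eq_iff_eq volume (φ.shift y).continuous_rep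
    (φ.continuous_rep.comp (continuous_id.add continuous_const))).1 h1
  exact congrFun this x

/-- `φ - ψ`. -/
def sub (φ ψ : H2) : H2 := φ.addMul ψ (-1)

lemma gradSq_sub_le (φ ψ : H2) : (φ.sub ψ).gradSq ≤ 2 * φ.gradSq + 2 * ψ.gradSq := by
  have h1 := gradSq_addMul φ ψ (-1)
  have h2 := gradSq_addMul φ ψ 1
  have h3 := (φ.addMul ψ 1).gradSq_nonneg
  rw [sub]; linarith

lemma mass_sub_le (φ ψ : H2) : mass (φ.sub ψ) ≤ 2 * mass φ + 2 * mass ψ := by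
  have h1 := mass_addMul φ ψ (-1)
  have h2 := mass_addMul φ ψ 1
  have h3 := (φ.addMul ψ 1).mass_nonneg
  rw [sub]; linarith

lemma sup_le {φ : H2} {B : ℝ} (h0 : mass φ ≤ B) (h1 : φ.gradSq ≤ B) : φ.sup ≤ √(2 * (√B * √B)) := by
  unfold sup; gcongr

lemma potential_add_sub (p : ℝ) (φ ψ : H2) :
    potential p (ψ.addMul (φ.sub ψ) 1) = potential p φ := by
  simp [potential, sub, addMul]

end H2

/-! ### Compactness of minimizing sequences -/

namespace H2

/-- After expanding the square, only the cross term depends on n, and it is a pairing with the fixed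
limit. The same holds for the derivatives. -/
lemma WeakTendsto.mass_sub {φ : ℕ → H2} {Φ : H2} (h : WeakTendsto φ Φ) :
    Tendsto (fun n => mass (φ n) - mass ((φ n).sub Φ)) atTop (𝓝 (mass Φ)) := by
  have h1 : Tendsto (fun n => 2 * (∫ x, φ n x * Φ x) - mass Φ) atTop (𝓝 (mass Φ)) := by
    convert ((h Φ Φ.memLp).1.const_mul 2).sub_const (mass Φ) using 2
    simp only [mass, ← sq]; ring
  refine h1.congr fun n => ?_
  rw [sub, mass_addMul]; ring

lemma WeakTendsto.gradSq_sub {φ : ℕ → H2} {Φ : H2} (h : WeakTendsto φ Φ) :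
    Tendsto (fun n => (φ n).gradSq - ((φ n).sub Φ).gradSq) atTop (𝓝 Φ.gradSq) := by
  have h1 : Tendsto (fun n => 2 * (∫ x, (φ n).d1 x * Φ.d1 x) - Φ.gradSq) atTop (𝓝 Φ.gradSq) := by
    convert ((h Φ.d1 Φ.memLp_d1).2.1.const_mul 2).sub_const Φ.gradSq using 2
    simp only [gradSq, ← sq]; ring
  refine h1.congr fun n => ?_
  rw [sub, gradSq_addMul]; ring

lemma WeakTendsto.bendSq_sub {φ : ℕ → H2} {Φ : H2} (h : WeakTendsto φ Φ) :
    Tendsto (fun n => (φ n).bendSq - ((φ n).sub Φ).bendSq) atTop (𝓝 Φ.bendSq) := by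
  have h1 : Tendsto (fun n => 2 * (∫ x, (φ n).d2 x * Φ.d2 x) - Φ.bendSq) atTop (𝓝 Φ.bendSq) := by
    convert ((h Φ.d2 Φ.memLp_d2).2.2.const_mul 2).sub_const Φ.bendSq using 2
    simp only [bendSq, ← sq]; ring
  refine h1.congr fun n => ?_
  rw [sub, bendSq_addMul]; ring

lemma WeakTendsto.quad_sub {φ : ℕ → H2} {Φ : H2} (h : WeakTendsto φ Φ) (b : ℝ) :
    Tendsto (fun n => (φ n).quad b - ((φ n).sub Φ).quad b) atTop (𝓝 (Φ.quad b)) := by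
  refine ((h.bendSq_sub.sub (h.gradSq_sub.const_mul b)).const_mul (1 / 2)).congr fun n => ?_
  unfold quad; ring

/-- The potential splits along weakly convergent sequences. -/
lemma WeakTendsto.potential_sub {p : ℝ} (hp : 1 < p) {φ : ℕ → H2} {Φ : H2} (h : WeakTendsto φ Φ)
    {B : ℝ} (h0 : ∀ n, mass (φ n) ≤ B) (h1 : ∀ n, (φ n).gradSq ≤ B) :
    Tendsto (fun n => potential p (φ n) - potential p ((φ n).sub Φ)) atTop (𝓝 (potential p Φ)) := by
  set B' := 2 * B + 2 * mass Φ + 2 * Φ.gradSq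
  have m0 : ∀ n, mass ((φ n).sub Φ) ≤ B' := fun n =>
    (mass_sub_le _ _).trans (by linarith [h0 n, Φ.gradSq_nonneg])
  have m1 : ∀ n, ((φ n).sub Φ).gradSq ≤ B' := fun n =>
    (gradSq_sub_le _ _).trans (by linarith [h1 n, Φ.mass_nonneg])
  set S := max (max Φ.sup √(2 * (√B' * √B'))) B'
  have s0 : Φ.sup ≤ S := le_max_of_le_left (le_max_left _ _)
  have s1 : ∀ n, ((φ n).sub Φ).sup ≤ S := fun n =>
    le_max_of_le_left (le_max_of_le_right (sup_le (m0 n) (m1 n)))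
  have hu : Tendsto (fun n => ∫ x, |Φ x| * |(φ n).sub Φ x|) atTop (𝓝 0) := by
    refine tendsto_integral_abs_mul Φ.memLp (fun n => ((φ n).sub Φ).memLp) (B := S)
      (fun n => (m0 n).trans (le_max_right _ _)) (fun n => ?_) ?_
    · filter_upwards [((φ n).sub Φ).ae_abs_le] with x hx using hx.trans (s1 n)
    · filter_upwards [ae_all_iff.2 fun n => (φ n).ae_eq_rep, Φ.ae_eq_rep] with x h2 h3
      have := (h.rep x).sub_const (Φ.rep x)
      rw [sub_self] at this
      refine this.congr fun n => ?_
      rw [← h2 n, ← h3]; simp [sub, addMul, sub_eq_add_neg]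
  have hz := hu.const_mul (2 * (p + 1) * (2 * S) ^ (p - 1) + S ^ (p - 1))
  rw [mul_zero] at hz
  have hd : Tendsto (fun n => potential p (φ n) - potential p Φ - potential p ((φ n).sub Φ))
      atTop (𝓝 0) := by
    refine squeeze_zero_norm (fun n => ?_) hz
    have := abs_potential_add_sub_sub_le hp Φ ((φ n).sub Φ) s0 (s1 n)
    rwa [potential_add_sub] at this
  have := hd.add_const (potential p Φ)
  rw [zero_add] at this
  exact this.congr fun n => by ring

end H2

variable {p b : ℝ}

/-- Non-vanishing: the potential is at most sup^{p-1} · mass. The threshold satisfies δ^{p-1} =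
c/(2L), so a function bounded by δ would have potential at most c/2. The points found serve as
centers of translation. -/
lemma exists_lt_abs_rep (hp : 1 < p) {c L : ℝ} (hc : 0 < c) (hL : 0 < L) :
    ∃ δ, 0 < δ ∧ ∀ φ : H2, mass φ ≤ L → c ≤ potential p φ → ∃ y, δ < |φ.rep y| := by
  have hq : 0 < c / (2 * L) := by positivity
  refine ⟨(c / (2 * L)) ^ (1 / (p - 1)), by positivity, fun φ hm hV => ?_⟩
  by_contra! hall
  have h1 := H2.potential_le_of_abs_rep_le hp φ hall
  rw [← Real.rpow_mul hq.le, one_div_mul_cancel (by linarith), Real.rpow_one] at h1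
  have h2 : c / (2 * L) * mass φ ≤ c / (2 * L) * L := by gcongr
  have h3 : c / (2 * L) * L = c / 2 := by field_simp
  linarith

/-- Above the spectral threshold, minimizing sequences are compact up to translations; what is
recorded is the convergence of the potential. -/
theorem exists_minimizer_tendsto (hp1 : 1 < p) (hp9 : p < 9) {lam : ℝ} (hl : 0 < lam)
    (hneg : cost p b lam < -((max b 0) ^ 2 / 8) * lam) {φ : ℕ → H2}
    (hmass : Tendsto (fun n => mass (φ n)) atTop (𝓝 lam))
    (hE : Tendsto (fun n => energy p b (φ n)) atTop (𝓝 (cost p b lam))) :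
    ∃ Φ : H2, IsMinimizer p b lam Φ ∧ ∃ ns : ℕ → ℕ, StrictMono ns ∧
      Tendsto (fun n => potential p (φ (ns n))) atTop (𝓝 (potential p Φ)) := by
  set κ := (max b 0) ^ 2 / 8
  obtain ⟨L, hL⟩ := hmass.bddAbove_range
  obtain ⟨K, hK⟩ := hE.bddAbove_range
  replace hL : ∀ n, mass (φ n) ≤ L := fun n => hL ⟨n, rfl⟩
  replace hK : ∀ n, energy p b (φ n) ≤ K := fun n => hK ⟨n, rfl⟩
  have hL0 : 0 < L := hl.trans_le (le_of_tendsto' hmass hL)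
  obtain ⟨B, hB0, hB⟩ := H2.exists_bound hp1 hp9 b L K
  -- the potential does not vanish
  set c := (p + 1) * ((-κ * lam - cost p b lam) / 2)
  have hc : 0 < c := mul_pos (by linarith) (by linarith)
  have hVc : ∀ᶠ n in atTop, c ≤ potential p (φ n) := by
    have h1 : Tendsto (fun n => -κ * mass (φ n) - energy p b (φ n)) atTop
        (𝓝 (-κ * lam - cost p b lam)) := (hmass.const_mul _).sub hE
    have h2 := h1.eventually (lt_mem_nhds (show (-κ * lam - cost p b lam) / 2
      < -κ * lam - cost p b lam by linarith))
    filter_upwards [h2] with n hn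
    have h3 := H2.energy_eq p b (φ n)
    have h4 : -κ * mass (φ n) ≤ (φ n).quad b := (φ n).le_quad b
    have h5 : (-κ * lam - cost p b lam) / 2 ≤ 1 / (p + 1) * potential p (φ n) := by linarith
    rwa [one_div_mul_eq_div, le_div_iff₀ (by linarith), mul_comm] at h5
  obtain ⟨δ, hδ, hex⟩ := exists_lt_abs_rep hp1 hc hL0
  -- The lower bound on the potential holds only eventually; for the other indices the shift `0` is
  -- a default.
  have hy : ∀ n, ∃ y, c ≤ potential p (φ n) → δ < |(φ n).rep y| := fun n => by
    by_cases h : c ≤ potential p (φ n)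
    · exact (hex _ (hL n) h).imp fun y hy _ => hy
    · exact ⟨0, fun h' => absurd h' h⟩
  choose y hy using hy
  set ψ : ℕ → H2 := fun n => (φ n).shift (y n)
  have ψm : ∀ n, mass (ψ n) = mass (φ n) := fun n => H2.mass_shift _ _
  have ψg : ∀ n, (ψ n).gradSq = (φ n).gradSq := fun n => H2.gradSq_shift _ _
  have ψb : ∀ n, (ψ n).bendSq = (φ n).bendSq := fun n => H2.bendSq_shift _ _
  have ψV : ∀ n, potential p (ψ n) = potential p (φ n) := fun n => H2.potential_shift _ _ _
  have ψE : ∀ n, energy p b (ψ n) = energy p b (φ n) := fun n => H2.energy_shift _ _ _ _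
  have bm : ∀ n, mass (ψ n) ≤ max L B := fun n => ψm n ▸ (hL n).trans (le_max_left _ _)
  have bg : ∀ n, (ψ n).gradSq ≤ max L B := fun n =>
    ψg n ▸ (hB _ (hL n) (hK n)).2.1.trans (le_max_right _ _)
  have bb : ∀ n, (ψ n).bendSq ≤ max L B := fun n =>
    ψb n ▸ (hB _ (hL n) (hK n)).1.trans (le_max_right _ _)
  obtain ⟨Φ, ns, hns, hw⟩ := H2.exists_weakTendsto ψ bm bg bb
  -- the weak limit is not zero
  have hrep : δ ≤ |Φ.rep 0| := by
    refine ge_of_tendsto (hw.rep 0).abs ?_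
    filter_upwards [hns.tendsto_atTop.eventually hVc] with n hn
    have := hy (ns n) hn
    simp only [Function.comp_apply, ψ, H2.rep_shift, zero_add]
    exact this.le
  have hμ : 0 < mass Φ := by
    refine lt_of_le_of_ne Φ.mass_nonneg fun h0 => ?_
    have : Φ.sup = 0 := by simp [H2.sup, ← h0]
    linarith [Φ.abs_rep_le 0]
  set u : ℕ → H2 := fun n => (ψ (ns n)).sub Φ
  have tm : Tendsto (fun n => mass (ψ (ns n))) atTop (𝓝 lam) := by
    simp only [ψm]; exact hmass.comp hns.tendsto_atTop
  have tE : Tendsto (fun n => energy p b (ψ (ns n))) atTop (𝓝 (cost p b lam)) := by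
    simp only [ψE]; exact hE.comp hns.tendsto_atTop
  have um : Tendsto (fun n => mass (u n)) atTop (𝓝 (lam - mass Φ)) :=
    (tm.sub hw.mass_sub).congr fun n => by simp [u]
  have hν : 0 ≤ lam - mass Φ := ge_of_tendsto' um fun n => (u n).mass_nonneg
  have hVs := hw.potential_sub hp1 (fun n => bm (ns n)) (fun n => bg (ns n))
  have uE : Tendsto (fun n => energy p b (u n)) atTop (𝓝 (cost p b lam - energy p b Φ)) := by
    have h1 := (hw.quad_sub b).sub (hVs.const_mul (1 / (p + 1)))
    rw [← H2.energy_eq] at h1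
    refine (tE.sub h1).congr fun n => ?_
    simp only [Function.comp_apply, u, H2.energy_eq]; ring
  have uc : Tendsto (fun n => cost p b (mass (u n))) atTop (𝓝 (cost p b (lam - mass Φ))) := by
    have h1 := continuousOn_cost (b := b) hp1 hp9 (lam - mass Φ) hν
    exact h1.tendsto.comp (tendsto_nhdsWithin_iff.2
      ⟨um, .of_forall fun n => (u n).mass_nonneg⟩)
  -- The energy splits between the weak limit and the remainder, and m is continuous up to mass
  -- zero, which the remainder may approach.
  have hkey : cost p b (lam - mass Φ) ≤ cost p b lam - energy p b Φ :=
    le_of_tendsto_of_tendsto' uc uE fun n => cost_le hp1 hp9 (u n)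
  -- no mass is lost
  have hfull : mass Φ = lam := by
    by_contra hne
    have hlt : mass Φ < lam := lt_of_le_of_ne (sub_nonneg.1 hν) hne
    -- Enlarging Φ to the full mass gains strictly more than linearly, so the energy of Φ exceeds
    -- its proportional share of m(λ). The remainder costs at least its own share, and the sum
    -- contradicts `hkey`.
    have k1 := cost_le_amplitude (b := b) hp1 hp9 Φ (t := lam / mass Φ) (by positivity)
    rw [div_mul_cancel₀ _ hμ.ne'] at k1
    have hθ : 1 < lam / mass Φ := (one_lt_div hμ).2 hlt
    have k2 : lam / mass Φ < (lam / mass Φ) ^ ((p + 1) / 2) := by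
      conv_lhs => rw [← Real.rpow_one (lam / mass Φ)]
      exact Real.rpow_lt_rpow_of_exponent_lt hθ (by linarith)
    have hV := H2.potential_pos hp1 hμ
    have k3 := mul_lt_mul_of_pos_right k2 (show 0 < 1 / (p + 1) * potential p Φ by positivity)
    have k4 : cost p b lam < lam / mass Φ * energy p b Φ := by
      rw [H2.energy_eq]; linarith
    have k5 : mass Φ / lam * cost p b lam < energy p b Φ := by
      rw [div_mul_eq_mul_div, div_lt_iff₀ hl]
      rw [div_mul_eq_mul_div, lt_div_iff₀ hμ] at k4
      linarith
    have k6 := div_mul_cost_le (b := b) hp1 hp9 hν hl (by linarith)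
    have k7 : (lam - mass Φ) / lam * cost p b lam
        = cost p b lam - mass Φ / lam * cost p b lam := by field_simp
    linarith
  rw [hfull, sub_self, cost_zero hp1 hp9] at hkey
  refine ⟨Φ, isMinimizer_of_energy_le hp1 hp9 hfull (by linarith), ns, hns, ?_⟩
  rw [hfull, sub_self] at um
  -- The supremum of the remainder stays bounded while its mass vanishes.
  have uV : Tendsto (fun n => potential p (u n)) atTop (𝓝 0) := by
    set B' := 2 * max L B + 2 * mass Φ + 2 * Φ.gradSq
    have hz := um.const_mul ((√(2 * (√B' * √B'))) ^ (p - 1))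
    rw [mul_zero] at hz
    refine squeeze_zero (fun n => H2.potential_nonneg p _) (fun n => ?_) hz
    refine (H2.potential_le hp1 _).trans (mul_le_mul_of_nonneg_right ?_ (u n).mass_nonneg)
    refine Real.rpow_le_rpow (u n).sup_nonneg (H2.sup_le ?_ ?_) (by linarith)
    · exact (H2.mass_sub_le _ _).trans (by linarith [bm (ns n), Φ.gradSq_nonneg])
    · exact (H2.gradSq_sub_le _ _).trans (by linarith [bg (ns n), Φ.mass_nonneg])
  have := hVs.add uV
  rw [add_zero] at this
  refine this.congr fun n => ?_
  simp only [Function.comp_apply, u, ← ψV]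
  ring

lemma exists_isMinimizer (hp1 : 1 < p) (hp9 : p < 9) {lam : ℝ} (hl : 0 < lam)
    (hneg : cost p b lam < -((max b 0) ^ 2 / 8) * lam) : ∃ φ, IsMinimizer p b lam φ := by
  have h : ∀ n : ℕ, ∃ φ : H2, mass φ = lam ∧ energy p b φ < cost p b lam + 1 / (n + 1 : ℝ) :=
    fun n => exists_energy_lt hl.le (by positivity)
  choose φ h1 h2 using h
  obtain ⟨Φ, hΦ, -⟩ := exists_minimizer_tendsto hp1 hp9 hl hneg (φ := φ)
    (by simp only [h1]; exact tendsto_const_nhds)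
    (by
      have h3 := (tendsto_one_div_add_atTop_nhds_zero_nat (𝕜 := ℝ)).const_add (cost p b lam)
      rw [add_zero] at h3
      exact tendsto_of_tendsto_of_tendsto_of_le_of_le tendsto_const_nhds h3
        (fun n => h1 n ▸ cost_le hp1 hp9 (φ n)) (fun n => (h2 n).le))
  exact ⟨Φ, hΦ⟩

variable {p b : ℝ}

/-! ### The threshold mass -/

/-- The ratio m(λ)/λ is nonincreasing, so a strict inequality m < -κλ propagates to larger masses.
-/
lemma cost_lt_threshold_of_lt (hp1 : 1 < p) (hp9 : p < 9) {κ lam μ : ℝ} (hμ : 0 < μ)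
    (h : cost p b μ < -κ * μ) (hlt : μ < lam) : cost p b lam < -κ * lam := by
  have hl : 0 < lam := hμ.trans hlt
  have h1 := (div_mul_cost_le (b := b) hp1 hp9 hμ.le hl hlt.le).trans_lt h
  rw [div_mul_eq_mul_div, div_lt_iff₀ hl] at h1
  exact lt_of_mul_lt_mul_left (by linarith : μ * cost p b lam < μ * (-κ * lam)) hμ.le

/-- Per unit of mass, a change of amplitude leaves the quadratic part alone and multiplies the
potential by t^{(p-1)/2}. -/
lemma cost_lt_of_quad_lt (hp1 : 1 < p) (hp9 : p < 9) {κ t : ℝ} (ht : 0 < t) {φ : H2}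
    (h : φ.quad b + κ * mass φ < 1 / (p + 1) * (t ^ ((p - 1) / 2) * potential p φ)) :
    cost p b (t * mass φ) < -κ * (t * mass φ) := by
  refine (cost_le_amplitude hp1 hp9 φ ht.le).trans_lt ?_
  have e : t ^ ((p + 1) / 2) = t * t ^ ((p - 1) / 2) := by
    rw [← Real.rpow_one_add' ht.le (by linarith)]; congr 1; ring
  rw [e]
  have := mul_lt_mul_of_pos_left h ht
  linarith

lemma exists_cost_lt_threshold (hp1 : 1 < p) (hp9 : p < 9) (κ : ℝ) :
    ∃ lam, 0 < lam ∧ cost p b lam < -κ * lam := by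
  obtain ⟨φ, hφ⟩ := H2.exists_mass_pos
  have hV := H2.potential_pos hp1 hφ
  have h1 : Tendsto (fun t : ℝ => 1 / (p + 1) * (t ^ ((p - 1) / 2) * potential p φ)) atTop atTop :=
    ((tendsto_rpow_atTop (by linarith : 0 < (p - 1) / 2)).atTop_mul_const hV).const_mul_atTop
      (by positivity)
  obtain ⟨t, ht, ht0⟩ := ((h1.eventually_gt_atTop (φ.quad b + κ * mass φ)).and
    (eventually_gt_atTop 0)).exists
  exact ⟨t * mass φ, by positivity, cost_lt_of_quad_lt hp1 hp9 ht0 ht⟩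

/-- Under a dilation of factor s at fixed mass the terms in φ'' and φ' scale like s⁴ and s². For
small s the second dominates, and with b > 0 the quadratic part is nonpositive. -/
lemma cost_neg_of_pos (hp1 : 1 < p) (hp9 : p < 9) (hb : 0 < b) {lam : ℝ} (hl : 0 < lam) :
    cost p b lam < 0 := by
  obtain ⟨φ, hφ⟩ := H2.exists_mass_eq hl.le
  have hV := H2.potential_pos hp1 (hφ ▸ hl)
  have hD : 0 < φ.gradSq := by
    refine lt_of_le_of_ne φ.gradSq_nonneg fun h0 => ?_
    have := H2.potential_le hp1 φ
    have hs : φ.sup = 0 := by simp [H2.sup, ← h0]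
    rw [hs, Real.zero_rpow (by linarith), zero_mul] at this
    linarith
  have hT := φ.bendSq_nonneg
  -- The added 1 keeps the denominator positive; all that matters is s² · bendSq ≤ b · gradSq.
  set s := √(b * φ.gradSq / (φ.bendSq + 1))
  have hs : 0 < s := Real.sqrt_pos.2 (by positivity)
  have h2 : s ^ 2 = b * φ.gradSq / (φ.bendSq + 1) := Real.sq_sqrt (by positivity)
  have h3 : s ^ 2 * φ.bendSq ≤ b * φ.gradSq := by
    rw [h2, div_mul_eq_mul_div, div_le_iff₀ (by positivity)]
    nlinarith [mul_pos hb hD]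
  have h4 := cost_le_resize (b := b) hp1 hp9 φ zero_le_one hs
  rw [one_mul, hφ, Real.one_rpow] at h4
  have h5 : 0 < 1 / (p + 1) * (1 * s ^ ((p - 1) / 2) * potential p φ) := by positivity
  have h6 : s ^ 4 * φ.bendSq ≤ b * (s ^ 2 * φ.gradSq) := by
    nlinarith [mul_le_mul_of_nonneg_left h3 (sq_nonneg s)]
  linarith

/-! ### Modulated test functions -/

/-- One of |cos x|, |sin x| is at least 1/2. Adding two phases avoids averaging an oscillating
power. -/
lemma rpow_neg_le_abs_rpow_add {r : ℝ} (hr : 0 ≤ r) (x : ℝ) :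
    (1 / 2 : ℝ) ^ r ≤ |Real.cos x| ^ r + |Real.sin x| ^ r := by
  have h := Real.cos_sq_add_sin_sq x
  have h1 := Real.rpow_nonneg (abs_nonneg (Real.cos x)) r
  have h2 := Real.rpow_nonneg (abs_nonneg (Real.sin x)) r
  rcases le_total (1 / 2) |Real.cos x| with h3 | h3
  · linarith [Real.rpow_le_rpow (by norm_num) h3 hr]
  · have h4 : 1 / 2 ≤ |Real.sin x| := by
      by_contra! h4
      have := sq_abs (Real.cos x)
      have := sq_abs (Real.sin x)
      nlinarith [abs_nonneg (Real.cos x), abs_nonneg (Real.sin x)]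
    linarith [Real.rpow_le_rpow (by norm_num) h4 hr]

/-- The modulated bump functions `η(s x) cos(k x + θ)`. -/
lemma exists_modulated (hp1 : 1 < p) (k : ℝ) :
    ∃ C E c : ℝ, 0 ≤ C ∧ 0 < E ∧ 0 < c ∧ ∀ s : ℝ, 0 < s → s ≤ 1 → ∃ φ : H2,
      (∫ x, (φ.d2 x + k ^ 2 * φ x) ^ 2) ≤ C * s ∧ (k = 0 → φ.gradSq ≤ C * s) ∧
      mass φ ≤ E / s ∧ c / s ≤ potential p φ := by
  let η : ContDiffBump (0 : ℝ) := ⟨1, 2, one_pos, by norm_num⟩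
  have c0 : ContDiff ℝ 2 η := η.contDiff
  have c1 : ContDiff ℝ 1 (deriv η) := c0.deriv'
  have d0 : ∀ x, HasDerivAt η (deriv η x) x := fun x =>
    (c0.differentiable (by norm_num) x).hasDerivAt
  have d1 : ∀ x, HasDerivAt (deriv η) (deriv (deriv η) x) x := fun x =>
    (c1.differentiable (by norm_num) x).hasDerivAt
  have k0 : Continuous η := η.continuous
  have k1 : Continuous (deriv η) := c1.continuous
  have k2 : Continuous (deriv (deriv η)) := c1.continuous_deriv le_rfl
  have hs0 : HasCompactSupport η := η.hasCompactSupport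
  have i0 := (memLp_two_of_continuous k0 hs0).integrable_sq
  have i1 := (memLp_two_of_continuous k1 hs0.deriv).integrable_sq
  have i2 := (memLp_two_of_continuous k2 hs0.deriv.deriv).integrable_sq
  have hη0 : η 0 = 1 := η.one_of_mem_closedBall (by simp [η])
  have kr : Continuous fun x => |η x| ^ (p + 1) :=
    k0.abs.rpow_const fun x => Or.inr (by linarith)
  have ir : HasCompactSupport fun x => |η x| ^ (p + 1) :=
    hs0.comp_left (g := fun x => |x| ^ (p + 1)) (by
      simp [Real.zero_rpow (by linarith : p + 1 ≠ 0)])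
  set E0 := ∫ x, η x ^ 2
  set E1 := ∫ x, deriv η x ^ 2
  set E2 := ∫ x, deriv (deriv η) x ^ 2
  set Er := ∫ x, |η x| ^ (p + 1)
  have hE1 : 0 ≤ E1 := integral_nonneg fun _ => sq_nonneg _
  have hE2 : 0 ≤ E2 := integral_nonneg fun _ => sq_nonneg _
  have hE0 : 0 < E0 := (k0.pow 2).integral_pos_of_hasCompactSupport_nonneg_nonzero (x := 0)
    (hs0.comp_left (g := fun x => x ^ 2) (by simp)) (fun x => sq_nonneg _) (by simp [hη0])
  have hEr : 0 < Er := kr.integral_pos_of_hasCompactSupport_nonneg_nonzero (x := 0)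
    ir (fun x => Real.rpow_nonneg (abs_nonneg _) _) (by simp [hη0])
  refine ⟨2 * E2 + 8 * k ^ 2 * E1 + E1, E0, (1 / 2) * ((1 / 2) ^ (p + 1) * Er), by positivity,
    hE0, by positivity, fun s hs hs1 => ?_⟩
  have scale : ∀ g : ℝ → ℝ, ∫ x, g (s * x) = (∫ x, g x) / s := fun g => by
    have := integral_comp_affine g s 0
    simp only [add_zero] at this
    rw [this, abs_of_pos (inv_pos.2 hs)]; ring
  have scalei : ∀ {g : ℝ → ℝ}, Integrable g → Integrable fun x => g (s * x) := fun hg =>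
    hg.comp_mul_left' hs.ne'
  have hlin : ∀ x : ℝ, HasDerivAt (fun x => s * x) s x := fun x => by
    simpa using (hasDerivAt_id x).const_mul s
  have hcos : ∀ θ x : ℝ, HasDerivAt (fun x => Real.cos (k * x + θ)) (-Real.sin (k * x + θ) * k) x :=
    fun θ x => (Real.hasDerivAt_cos _).comp x (by
      simpa using ((hasDerivAt_id x).const_mul k).add_const θ)
  have hsin : ∀ θ x : ℝ, HasDerivAt (fun x => Real.sin (k * x + θ)) (Real.cos (k * x + θ) * k) x :=
    fun θ x => (Real.hasDerivAt_sin _).comp x (by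
      simpa using ((hasDerivAt_id x).const_mul k).add_const θ)
  have e0 : ∀ x, HasDerivAt (fun x => η (s * x)) (deriv η (s * x) * s) x := fun x =>
    (d0 (s * x)).comp x (hlin x)
  have e1 : ∀ x, HasDerivAt (fun x => deriv η (s * x)) (deriv (deriv η) (s * x) * s) x := fun x =>
    (d1 (s * x)).comp x (hlin x)
  have hsupp : ∀ θ : ℝ, HasCompactSupport fun x => η (s * x) * Real.cos (k * x + θ) := fun θ =>
    (hs0.comp_homeomorph (Homeomorph.mulLeft₀ s hs.ne')).mul_right
  let u : ℝ → H2 := fun θ => H2.ofHasDerivAt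
    (f := fun x => η (s * x) * Real.cos (k * x + θ))
    (f' := fun x => deriv η (s * x) * s * Real.cos (k * x + θ)
      + η (s * x) * (-Real.sin (k * x + θ) * k))
    (f'' := fun x => (deriv (deriv η) (s * x) * s * s * Real.cos (k * x + θ)
        + deriv η (s * x) * s * (-Real.sin (k * x + θ) * k))
      + (deriv η (s * x) * s * (-Real.sin (k * x + θ) * k)
        + η (s * x) * (-(Real.cos (k * x + θ) * k) * k)))
    (fun x => (e0 x).mul (hcos θ x))
    (fun x => (((e1 x).mul_const s).mul (hcos θ x)).add
      ((e0 x).mul (((hsin θ x).neg).mul_const k)))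
    (by fun_prop) (hsupp θ)
  -- The term without derivatives of η cancels, leaving s² η'' cos - 2ks η' sin. Its square is of
  -- order s², and integration over a length of order 1/s leaves order s.
  have hQ : ∀ θ, ∫ x, ((u θ).d2 x + k ^ 2 * (u θ) x) ^ 2 ≤ (2 * E2 + 8 * k ^ 2 * E1 + E1) * s := by
    intro θ
    have j1 := (scalei i2).const_mul (2 * s ^ 2)
    have j2 := (scalei i1).const_mul (8 * k ^ 2 * s ^ 2)
    have hle : ∫ x, ((u θ).d2 x + k ^ 2 * (u θ) x) ^ 2
        ≤ ∫ x, (2 * s ^ 2 * deriv (deriv η) (s * x) ^ 2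
          + 8 * k ^ 2 * s ^ 2 * deriv η (s * x) ^ 2) := by
      refine integral_mono_of_nonneg (.of_forall fun x => sq_nonneg _) (j1.add j2)
        (.of_forall fun x => ?_)
      simp only [u, H2.ofHasDerivAt]
      set A := deriv (deriv η) (s * x)
      set B := deriv η (s * x)
      set co := Real.cos (k * x + θ)
      set si := Real.sin (k * x + θ)
      have hc : co ^ 2 ≤ 1 := Real.cos_sq_le_one _
      have hsn : si ^ 2 ≤ 1 := Real.sin_sq_le_one _
      have q1 : (A * s * s * co) ^ 2 ≤ s ^ 2 * A ^ 2 := by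
        have q3 : s ^ 2 * co ^ 2 ≤ 1 := by nlinarith [sq_nonneg co]
        calc (A * s * s * co) ^ 2 = (s ^ 2 * A ^ 2) * (s ^ 2 * co ^ 2) := by ring
          _ ≤ s ^ 2 * A ^ 2 * 1 := mul_le_mul_of_nonneg_left q3 (by positivity)
          _ = _ := mul_one _
      have q2 : (2 * (B * s * k * si)) ^ 2 ≤ 4 * k ^ 2 * s ^ 2 * B ^ 2 := by
        calc (2 * (B * s * k * si)) ^ 2 = (4 * k ^ 2 * s ^ 2 * B ^ 2) * si ^ 2 := by ring
          _ ≤ 4 * k ^ 2 * s ^ 2 * B ^ 2 * 1 := mul_le_mul_of_nonneg_left hsn (by positivity)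
          _ = _ := mul_one _
      nlinarith [sq_nonneg (A * s * s * co + 2 * (B * s * k * si))]
    refine hle.trans ?_
    rw [integral_add j1 j2, integral_const_mul, integral_const_mul,
      scale (fun x => deriv (deriv η) x ^ 2), scale (fun x => deriv η x ^ 2)]
    change 2 * s ^ 2 * (E2 / s) + 8 * k ^ 2 * s ^ 2 * (E1 / s) ≤ _
    have : 2 * s ^ 2 * (E2 / s) + 8 * k ^ 2 * s ^ 2 * (E1 / s)
        = (2 * E2 + 8 * k ^ 2 * E1) * s := by field_simp
    rw [this]
    nlinarith [mul_nonneg hE1 hs.le]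
  -- Needed for b ≤ 0, where no square is completed and the gradient term must be small by itself.
  have hG : ∀ θ, k = 0 → (u θ).gradSq ≤ (2 * E2 + 8 * k ^ 2 * E1 + E1) * s := by
    intro θ hk
    have j2 := (scalei i1).const_mul (s ^ 2)
    have hle : (u θ).gradSq ≤ ∫ x, s ^ 2 * deriv η (s * x) ^ 2 := by
      refine integral_mono_of_nonneg (.of_forall fun x => sq_nonneg _) j2 (.of_forall fun x => ?_)
      simp only [u, H2.ofHasDerivAt, hk]
      set B := deriv η (s * x)
      have hc : Real.cos (0 * x + θ) ^ 2 ≤ 1 := Real.cos_sq_le_one _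
      have := mul_le_mul_of_nonneg_left hc (show 0 ≤ s ^ 2 * B ^ 2 by positivity)
      nlinarith
    refine hle.trans ?_
    rw [integral_const_mul, scale (fun x => deriv η x ^ 2)]
    change s ^ 2 * (E1 / s) ≤ _
    have : s ^ 2 * (E1 / s) = E1 * s := by field_simp
    rw [this]
    have : 0 ≤ (2 * E2 + 8 * k ^ 2 * E1) * s := by positivity
    linarith
  have hM : ∀ θ, mass (u θ) ≤ E0 / s := by
    intro θ
    rw [← scale (fun x => η x ^ 2)]
    refine integral_mono_of_nonneg (.of_forall fun x => sq_nonneg _) (scalei i0)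
      (.of_forall fun x => ?_)
    simp only [u, H2.ofHasDerivAt, mul_pow]
    exact mul_le_of_le_one_right (sq_nonneg _) (Real.cos_sq_le_one _)
  -- The phases 0 and -π/2 give a cosine and a sine. One of the two packets carries at least half of
  -- the sum, and that one is chosen.
  have hV : (1 / 2) ^ (p + 1) * Er / s ≤ potential p (u 0) + potential p (u (-(Real.pi / 2))) := by
    have j1 := (u 0).integrable_abs_rpow (r := p + 1) (by linarith)
    have j2 := (u (-(Real.pi / 2))).integrable_abs_rpow (r := p + 1) (by linarith)
    unfold potential
    rw [← integral_add j1 j2, mul_div_assoc, ← scale (fun x => |η x| ^ (p + 1)),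
      ← integral_const_mul]
    refine integral_mono ((scalei (kr.integrable_of_hasCompactSupport ir)).const_mul _)
      (j1.add j2) fun x => ?_
    simp only [u, H2.ofHasDerivAt, add_zero, ← sub_eq_add_neg, Real.cos_sub_pi_div_two, abs_mul]
    rw [Real.mul_rpow (abs_nonneg _) (abs_nonneg _), Real.mul_rpow (abs_nonneg _) (abs_nonneg _),
      ← mul_add, mul_comm]
    exact mul_le_mul_of_nonneg_left (rpow_neg_le_abs_rpow_add (by linarith) _)
      (Real.rpow_nonneg (abs_nonneg _) _)
  have hc2 : (1 / 2) * ((1 / 2) ^ (p + 1) * Er) / s = (1 / 2) * ((1 / 2) ^ (p + 1) * Er / s) := by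
    ring
  rcases le_total (potential p (u 0)) (potential p (u (-(Real.pi / 2)))) with h | h
  · exact ⟨u (-(Real.pi / 2)), hQ _, hG _, hM _, by rw [hc2]; linarith⟩
  · exact ⟨u 0, hQ _, hG _, hM _, by rw [hc2]; linarith⟩

/-- In the mass subcritical range the cost is below the spectral threshold for every mass. -/
lemma cost_lt_threshold_of_subcritical (hp1 : 1 < p) (hp5 : p < 5) {lam : ℝ} (hl : 0 < lam) :
    cost p b lam < -((max b 0) ^ 2 / 8) * lam := by
  have hp9 : p < 9 := by linarith
  -- The frequency at which ξ⁴ - bξ² is minimal.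
  set k := √(max b 0 / 2)
  have hk : k ^ 2 = max b 0 / 2 := Real.sq_sqrt (by positivity)
  obtain ⟨C, E, c, hC, hE, hc, hex⟩ := exists_modulated hp1 k
  -- The packet exceeds the bottom of the spectrum by O(s). Bringing it to mass λ takes a factor of
  -- at least λs/E, so the gain is at least c2 · s^{(p-1)/2} / s. The ratio of excess to gain is of
  -- order s^{(5-p)/2}, small for p < 5.
  set c2 := 1 / (p + 1) * ((lam / E) ^ ((p - 1) / 2) * c)
  have hc2 : 0 < c2 := by positivity
  obtain ⟨s, hs, hs1, hsm⟩ : ∃ s : ℝ, 0 < s ∧ s ≤ 1 ∧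
      C * (1 / 2 + |b| / 2) * s ^ ((5 - p) / 2) < c2 := by
    have h1 : Tendsto (fun s : ℝ => C * (1 / 2 + |b| / 2) * s ^ ((5 - p) / 2)) (𝓝[>] 0) (𝓝 0) := by
      have := ((Real.continuousAt_rpow_const 0 ((5 - p) / 2) (Or.inr (by linarith))).tendsto.const_mul
        (C * (1 / 2 + |b| / 2)))
      rw [Real.zero_rpow (by linarith), mul_zero] at this
      exact this.mono_left nhdsWithin_le_nhds
    have h2 : ∀ᶠ s : ℝ in 𝓝[>] 0, s ≤ 1 :=
      nhdsWithin_le_nhds (Iic_mem_nhds (zero_lt_one (α := ℝ)))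
    have h3 : ∀ᶠ s : ℝ in 𝓝[>] 0, 0 < s := self_mem_nhdsWithin
    obtain ⟨s, h4, h5, h6⟩ := (h3.and (h2.and (h1.eventually (gt_mem_nhds hc2)))).exists
    exact ⟨s, h4, h5, h6⟩
  obtain ⟨φ, hQ, hG, hM, hV⟩ := hex s hs hs1
  have hV0 : 0 < potential p φ := (by positivity : 0 < c / s).trans_le hV
  have hM0 : 0 < mass φ := by
    refine lt_of_le_of_ne φ.mass_nonneg fun h0 => ?_
    have := H2.potential_le hp1 φ
    rw [← h0, mul_zero] at this
    linarith
  have hquad : φ.quad b + (max b 0) ^ 2 / 8 * mass φ ≤ C * (1 / 2 + |b| / 2) * s := by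
    have h1 := H2.integral_sq_addMul φ.memLp_d2 φ.memLp (k ^ 2)
    change _ = φ.bendSq + _ + _ * mass φ at h1
    rw [show ∫ x, φ.d2 x * φ x = -φ.gradSq by rw [φ.gradSq_eq, neg_neg]] at h1
    rw [h1] at hQ
    unfold H2.quad
    have hCs : 0 ≤ C * s := by positivity
    rcases le_total b 0 with hb | hb
    · have hk0 : k = 0 := by simp [k, max_eq_right hb]
      have h2 := hG hk0
      rw [hk0] at hQ
      rw [max_eq_right hb, abs_of_nonpos hb]
      have h3 := mul_le_mul_of_nonneg_left h2 (neg_nonneg.2 hb)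
      nlinarith
    · rw [max_eq_left hb] at hk ⊢
      rw [hk] at hQ
      rw [abs_of_nonneg hb]
      nlinarith [mul_nonneg hb hCs]
  have key := cost_lt_of_quad_lt (b := b) hp1 hp9 (κ := (max b 0) ^ 2 / 8) (t := lam / mass φ)
    (by positivity) (φ := φ) ?_
  · rwa [div_mul_cancel₀ _ hM0.ne'] at key
  · refine hquad.trans_lt ?_
    have h1 : lam / E * s ≤ lam / mass φ := by
      rw [div_mul_eq_mul_div, div_le_div_iff₀ hE hM0]
      rw [le_div_iff₀ hs] at hM
      nlinarith
    have h2 : (lam / E) ^ ((p - 1) / 2) * s ^ ((p - 1) / 2) ≤ (lam / mass φ) ^ ((p - 1) / 2) := by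
      rw [← Real.mul_rpow (by positivity) hs.le]
      exact Real.rpow_le_rpow (by positivity) h1 (by linarith)
    have h3 : ((lam / E) ^ ((p - 1) / 2) * s ^ ((p - 1) / 2)) * (c / s)
        ≤ (lam / mass φ) ^ ((p - 1) / 2) * potential p φ :=
      mul_le_mul h2 hV (by positivity) (by positivity)
    have h4 : c2 * (s ^ ((p - 1) / 2) / s)
        ≤ 1 / (p + 1) * ((lam / mass φ) ^ ((p - 1) / 2) * potential p φ) := by
      have := mul_le_mul_of_nonneg_left h3 (show 0 ≤ 1 / (p + 1) by positivity)
      refine le_trans (le_of_eq ?_) this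
      simp only [c2]; ring
    refine lt_of_lt_of_le ?_ h4
    have h5 : C * (1 / 2 + |b| / 2) * s
        = C * (1 / 2 + |b| / 2) * s ^ ((5 - p) / 2) * (s ^ ((p - 1) / 2) / s) := by
      have : s ^ ((5 - p) / 2) * s ^ ((p - 1) / 2) = s * s := by
        rw [← Real.rpow_add hs, show (5 - p) / 2 + (p - 1) / 2 = (2 : ℝ) by ring, Real.rpow_two, sq]
      rw [mul_assoc _ (s ^ ((5 - p) / 2)), ← mul_div_assoc, this]
      field_simp
    rw [h5]
    exact mul_lt_mul_of_pos_right hsm (by positivity)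

/-! ### Supergradients of concave functions -/

section supergradient

variable {f : ℝ → ℝ}

lemma tendsto_add_slope_right {x L : ℝ} (h : HasDerivWithinAt f L (Ioi x) x) :
    Tendsto (fun ε => (f (x + ε) - f x) / ε) (𝓝[>] 0) (𝓝 L) := by
  rw [hasDerivWithinAt_iff_tendsto_slope' (by simp)] at h
  have h1 : Tendsto (fun ε : ℝ => x + ε) (𝓝[>] 0) (𝓝[>] x) := by
    refine tendsto_nhdsWithin_iff.2 ⟨?_, ?_⟩
    · have : Tendsto (fun ε : ℝ => x + ε) (𝓝 0) (𝓝 (x + 0)) :=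
        tendsto_const_nhds.add tendsto_id
      rw [add_zero] at this
      exact this.mono_left nhdsWithin_le_nhds
    · filter_upwards [self_mem_nhdsWithin] with ε hε
      simpa using hε
  refine (h.comp h1).congr fun ε => ?_
  simp [slope_def_field]

lemma tendsto_add_slope_left {x L : ℝ} (h : HasDerivWithinAt f L (Iio x) x) :
    Tendsto (fun ε => (f (x + ε) - f x) / ε) (𝓝[<] 0) (𝓝 L) := by
  rw [hasDerivWithinAt_iff_tendsto_slope' (by simp)] at h
  have h1 : Tendsto (fun ε : ℝ => x + ε) (𝓝[<] 0) (𝓝[<] x) := by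
    refine tendsto_nhdsWithin_iff.2 ⟨?_, ?_⟩
    · have : Tendsto (fun ε : ℝ => x + ε) (𝓝 0) (𝓝 (x + 0)) :=
        tendsto_const_nhds.add tendsto_id
      rw [add_zero] at this
      exact this.mono_left nhdsWithin_le_nhds
    · filter_upwards [self_mem_nhdsWithin] with ε hε
      simpa using hε
  refine (h.comp h1).congr fun ε => ?_
  simp [slope_def_field]

lemma exists_oneSided_deriv (hf : ConcaveOn ℝ (Ici 0) f) {x : ℝ} (hx : 0 < x) :
    ∃ Lr Ll, HasDerivWithinAt f Lr (Ioi x) x ∧ HasDerivWithinAt f Ll (Iio x) x := by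
  have hx' : x ∈ interior (Ici (0 : ℝ)) := by simpa using hx
  have h1 := (hf.neg.hasDerivWithinAt_rightDeriv_of_mem_interior hx').neg
  have h2 := (hf.neg.hasDerivWithinAt_leftDeriv_of_mem_interior hx').neg
  rw [neg_neg] at h1 h2
  exact ⟨_, _, h1, h2⟩

/-- A supergradient lies between the one-sided derivatives. -/
lemma supergradient_mem {x S Lr Ll : ℝ} (hx : 0 < x)
    (hr : Tendsto (fun ε => (f (x + ε) - f x) / ε) (𝓝[>] 0) (𝓝 Lr))
    (hl : Tendsto (fun ε => (f (x + ε) - f x) / ε) (𝓝[<] 0) (𝓝 Ll))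
    (hS : ∀ y, 0 ≤ y → f y ≤ f x + S * (y - x)) : Lr ≤ S ∧ S ≤ Ll := by
  constructor
  · refine le_of_tendsto hr ?_
    filter_upwards [self_mem_nhdsWithin] with ε hε
    have hε' : 0 < ε := hε
    rw [div_le_iff₀ hε']
    have := hS (x + ε) (by positivity)
    rw [add_sub_cancel_left] at this
    linarith
  · refine ge_of_tendsto hl ?_
    filter_upwards [self_mem_nhdsWithin,
      mem_nhdsWithin_of_mem_nhds (Ioi_mem_nhds (neg_lt_zero.2 hx))] with ε hε hε2
    have hε' : ε < 0 := hε
    have hε3 : -x < ε := hε2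
    rw [le_div_iff_of_neg hε']
    have := hS (x + ε) (by linarith)
    rw [add_sub_cancel_left] at this
    linarith

/-- Supergradients at points `x + δ` converge with the difference quotients at `x`. -/
lemma tendsto_supergradient {ι : Type*} {l : Filter ι} {x L : ℝ} {δ S : ι → ℝ}
    (hδ : ∀ᶠ j in l, δ j ≠ 0)
    (h1 : Tendsto (fun j => (f (x + δ j) - f x) / δ j) l (𝓝 L))
    (h2 : Tendsto (fun j => (f (x + 2 * δ j) - f x) / (2 * δ j)) l (𝓝 L))
    (hS1 : ∀ᶠ j in l, f x ≤ f (x + δ j) + S j * (x - (x + δ j)))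
    (hS2 : ∀ᶠ j in l, f (x + 2 * δ j) ≤ f (x + δ j) + S j * (x + 2 * δ j - (x + δ j))) :
    Tendsto S l (𝓝 L) := by
  set g := fun j => (f (x + δ j) - f x) / δ j
  set k := fun j => (f (x + 2 * δ j) - f x) / (2 * δ j)
  have h3 : Tendsto (fun j => S j - g j) l (𝓝 0) := by
    have h4 : Tendsto (fun j => |2 * (k j - g j)|) l (𝓝 0) := by
      have := ((h2.sub h1).const_mul 2).abs
      simpa using this
    refine squeeze_zero_norm' ?_ h4
    filter_upwards [hδ, hS1, hS2] with j a1 a2 a3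
    have e1 : f (x + δ j) = f x + g j * δ j := by
      simp only [g]; field_simp; ring
    have e2 : f (x + 2 * δ j) = f x + 2 * k j * δ j := by
      simp only [k]; field_simp; ring
    rw [e1] at a2 a3
    rw [e2] at a3
    -- The supergradient at x + δ lies between the slope `g` over [x, x+δ] and the slope 2k - g over
    -- [x+δ, x+2δ], in an order set by the sign of δ. Both slopes tend to L.
    have b1 : 0 ≤ (g j - S j) * δ j := by linarith
    have b2 : 0 ≤ (S j - g j - 2 * (k j - g j)) * δ j := by linarith
    rw [Real.norm_eq_abs]
    rcases lt_or_gt_of_ne a1 with hn | hp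
    · have c1 : 0 ≤ S j - g j := by nlinarith
      have c2 : S j - g j ≤ 2 * (k j - g j) := by nlinarith
      rw [abs_of_nonneg c1, abs_of_nonneg (c1.trans c2)]; exact c2
    · have c1 : S j - g j ≤ 0 := by nlinarith
      have c2 : 2 * (k j - g j) ≤ S j - g j := by nlinarith
      rw [abs_of_nonpos c1, abs_of_nonpos (c2.trans c1)]; linarith
  have := h3.add h1
  rw [zero_add] at this
  exact this.congr fun j => by ring

/-! ### Derivatives of locally Lipschitz functions and second order touching. -/

lemma integral_deriv_eq_sub_of_lipschitz (hf : ∀ c, ∃ K : ℝ≥0, LipschitzOnWith K f (Icc 0 c))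
    {a c : ℝ} (ha : 0 ≤ a) (hac : a ≤ c) :
    IntervalIntegrable (deriv f) volume a c ∧ ∫ x in a..c, deriv f x = f c - f a := by
  obtain ⟨K, hK⟩ := hf c
  have h : AbsolutelyContinuousOnInterval f a c := by
    refine (hK.mono ?_).absolutelyContinuousOnInterval
    rw [uIcc_of_le hac]
    exact Icc_subset_Icc_left ha
  exact ⟨h.intervalIntegrable_deriv, h.integral_deriv_eq_sub⟩

lemma ae_differentiableAt_of_lipschitz (hf : ∀ c, ∃ K : ℝ≥0, LipschitzOnWith K f (Icc 0 c)) :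
    ∀ᵐ x : ℝ, 0 < x → DifferentiableAt ℝ f x := by
  have h : ∀ n : ℕ, ∀ᵐ x : ℝ, x ∈ uIcc (0 : ℝ) n → DifferentiableAt ℝ f x := fun n => by
    obtain ⟨K, hK⟩ := hf n
    rw [← uIcc_of_le (Nat.cast_nonneg n)] at hK
    exact hK.absolutelyContinuousOnInterval.ae_differentiableAt
  filter_upwards [ae_all_iff.2 h] with x hx h0
  obtain ⟨n, hn⟩ := exists_nat_ge x
  exact hx n (by rw [uIcc_of_le (Nat.cast_nonneg n)]; exact ⟨h0.le, hn⟩)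

/-- A second order touching argument: if `f ≤ G` near `a` with contact at `a`, then the
derivative of `deriv f` at `a`, along the points of differentiability, is at most the second
derivative of `G`. -/
lemma neg_two_mul_le_of_touching (hf : ∀ c, ∃ K : ℝ≥0, LipschitzOnWith K f (Icc 0 c))
    {a w' G₂ : ℝ} {A : Set ℝ} {G G₁ : ℝ → ℝ} (ha : 0 < a) (hA : ∀ᵐ x : ℝ, a < x → x ∈ A)
    (hω : HasDerivWithinAt (fun x => -2 * deriv f x) w' A a)
    (hG : ∀ᶠ x in 𝓝 a, HasDerivAt G (G₁ x) x) (hGc : ∀ᶠ x in 𝓝 a, ContinuousAt G₁ x)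
    (hG₁ : HasDerivAt G₁ G₂ a) (h1 : G₁ a = deriv f a) (h0 : G a = f a)
    (hle : ∀ᶠ x in 𝓝 a, f x ≤ G x) : -2 * G₂ ≤ w' := by
  by_contra! hlt
  -- With this choice G₂ + w'/2 = -4η, which absorbs the two linearization errors η and η/2 and
  -- still leaves less than -η.
  set η := (-2 * G₂ - w') / 8
  have hη : 0 < η := by simp only [η]; linarith
  have e1 : ∀ᶠ x in 𝓝 a, |G₁ x - G₁ a - (x - a) * G₂| ≤ η * |x - a| := by
    have := hG₁.isLittleO.def hη
    simpa [Real.norm_eq_abs] using this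
  have e2 : ∀ᶠ x in 𝓝 a, x ∈ A →
      |-2 * deriv f x - -2 * deriv f a - (x - a) * w'| ≤ η * |x - a| := by
    have := hω.isLittleO.def hη
    rw [eventually_nhdsWithin_iff] at this
    simpa [Real.norm_eq_abs] using this
  obtain ⟨r, hr, hall⟩ := Metric.eventually_nhds_iff.1
    (hG.and (hGc.and (hle.and (e1.and e2))))
  set c := a + r / 2
  have hac : a < c := by simp only [c]; linarith
  have hin : ∀ x ∈ Icc a c, dist x a < r := fun x hx => by
    rw [Real.dist_eq, abs_of_nonneg (by linarith [hx.1])]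
    have : x ≤ a + r / 2 := hx.2
    linarith
  obtain ⟨if', hif⟩ := integral_deriv_eq_sub_of_lipschitz hf ha.le hac.le
  have iG : IntervalIntegrable G₁ volume a c := by
    refine ContinuousOn.intervalIntegrable fun x hx => ?_
    rw [uIcc_of_le hac.le] at hx
    exact (hall (hin x hx)).2.1.continuousWithinAt
  have hiG : ∫ x in a..c, G₁ x = G c - G a := by
    refine intervalIntegral.integral_eq_sub_of_hasDerivAt (fun x hx => ?_) iG
    rw [uIcc_of_le hac.le] at hx
    exact (hall (hin x hx)).1
  have hpos : 0 < ∫ x in a..c, η * (x - a) := by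
    refine intervalIntegral.intervalIntegral_pos_of_pos_on
      (Continuous.intervalIntegrable (by fun_prop) _ _) (fun x hx => ?_) hac
    exact mul_pos hη (sub_pos.2 hx.1)
  -- Integrating from the contact point puts G strictly below f at `c`, against `hle`.
  have hmono : ∫ x in a..c, (G₁ x - deriv f x) ≤ ∫ x in a..c, -(η * (x - a)) := by
    refine intervalIntegral.integral_mono_ae_restrict hac.le (iG.sub if')
      (Continuous.intervalIntegrable (by fun_prop) _ _) ?_
    rw [EventuallyLE, ae_restrict_iff' measurableSet_Icc]
    have hne : ∀ᵐ x : ℝ, x ≠ a := by simp [ae_iff]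
    filter_upwards [hA, hne] with x hxA hxa hx
    have hax : a < x := lt_of_le_of_ne hx.1 (Ne.symm hxa)
    obtain ⟨-, -, -, b1, b2⟩ := hall (hin x hx)
    have b3 := b2 (hxA hax)
    rw [abs_of_pos (sub_pos.2 hax)] at b1 b3
    have b4 := (abs_le.1 b1).2
    have b5 := (abs_le.1 b3).2
    have b6 : G₂ + w' / 2 = -4 * η := by simp only [η]; ring
    have b7 : (x - a) * G₂ + (x - a) * w' / 2 = -4 * η * (x - a) := by rw [← b6]; ring
    have b8 : 0 < η * (x - a) := mul_pos hη (sub_pos.2 hax)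
    rw [h1] at b4
    linarith
  rw [intervalIntegral.integral_sub iG if', hiG, hif, intervalIntegral.integral_neg, h0] at hmono
  have := (hall (hin c ⟨hac.le, le_rfl⟩)).2.2.1
  linarith

end supergradient

variable {p b : ℝ}

/-! ### The derivative of the multiplier -/

/-- The Pohozaev identity. -/
lemma IsMinimizer.pohozaev (hp1 : 1 < p) (hp9 : p < 9) {lam : ℝ} {φ : H2}
    (h : IsMinimizer p b lam φ) :
    2 * φ.bendSq - b * φ.gradSq = 1 / (p + 1) * ((p - 1) / 2 * potential p φ) := by
  have hd : HasDerivAt (fun s : ℝ => (1 / 2) * (s ^ 4 * φ.bendSq - b * (s ^ 2 * φ.gradSq))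
      - 1 / (p + 1) * (s ^ ((p - 1) / 2) * potential p φ))
      ((1 / 2) * (4 * 1 ^ 3 * φ.bendSq - b * (2 * 1 * φ.gradSq))
        - 1 / (p + 1) * ((p - 1) / 2 * 1 ^ ((p - 1) / 2 - 1) * potential p φ)) 1 := by
    have h4 : HasDerivAt (fun s : ℝ => s ^ 4) (4 * 1 ^ 3) 1 := by simpa using hasDerivAt_pow 4 (1 : ℝ)
    have h2 : HasDerivAt (fun s : ℝ => s ^ 2) (2 * 1) 1 := by simpa using hasDerivAt_pow 2 (1 : ℝ)
    have hr : HasDerivAt (fun s : ℝ => s ^ ((p - 1) / 2))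
        ((p - 1) / 2 * 1 ^ ((p - 1) / 2 - 1)) 1 :=
      Real.hasDerivAt_rpow_const (Or.inl one_ne_zero)
    exact (((h4.mul_const _).sub ((h2.mul_const _).const_mul b)).const_mul (1 / 2)).sub
      ((hr.mul_const _).const_mul _)
  -- Dilations at fixed mass are admissible competitors.
  have hmin : IsLocalMin (fun s : ℝ => (1 / 2) * (s ^ 4 * φ.bendSq - b * (s ^ 2 * φ.gradSq))
      - 1 / (p + 1) * (s ^ ((p - 1) / 2) * potential p φ)) 1 := by
    filter_upwards [lt_mem_nhds (zero_lt_one (α := ℝ))] with s hs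
    have h1 := cost_le_resize (b := b) hp1 hp9 φ zero_le_one hs
    rw [one_mul, h.1, ← h.energy_eq_cost, H2.energy_eq, H2.quad] at h1
    simpa using h1
  have := hmin.hasDerivAt_eq_zero hd
  rw [Real.one_rpow] at this
  linarith

/-- The trial curve that changes the amplitude and, at rate `c`, the length scale. -/
lemma IsMinimizer.exists_trial (hp1 : 1 < p) (hp9 : p < 9) {lam : ℝ} (hl : 0 < lam) {φ : H2}
    (h : IsMinimizer p b lam φ) : ∃ N : ℝ, ∀ c : ℝ, ∃ G G₁ : ℝ → ℝ,
      (∀ᶠ x in 𝓝 lam, HasDerivAt G (G₁ x) x) ∧ (∀ᶠ x in 𝓝 lam, ContinuousAt G₁ x) ∧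
      HasDerivAt G₁ (-(p - 1) / (4 * lam ^ 2) * potential p φ
        - 2 * c / lam * (potential p φ / (p + 1)) * ((p - 1) / 2) ^ 2 + c ^ 2 * N) lam ∧
      G₁ lam = -φ.mult p b / 2 ∧ G lam = cost p b lam ∧
      ∀ᶠ x in 𝓝 lam, cost p b x ≤ G x := by
  set r := (p - 1) / 2
  set q := (p + 1) / 2
  set T := φ.bendSq
  set D := φ.gradSq
  set V := potential p φ
  have hpo : 2 * T - b * D = 1 / (p + 1) * (r * V) := h.pohozaev hp1 hp9
  have hp0 : p + 1 ≠ 0 := by linarith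
  -- This is the second derivative of the energy in the dilation factor alone, at factor 1.
  refine ⟨6 * T - b * D - V / (p + 1) * (r * (r - 1)), fun c => ?_⟩
  let t : ℝ → ℝ := fun x => x / lam
  let s : ℝ → ℝ := fun x => 1 + c * (x - lam)
  let G : ℝ → ℝ := fun x => t x * ((1 / 2) * (s x ^ 4 * T - b * (s x ^ 2 * D)))
    - 1 / (p + 1) * (t x ^ q * s x ^ r * V)
  let G₁ : ℝ → ℝ := fun x => (1 / lam) * ((1 / 2) * (s x ^ 4 * T - b * (s x ^ 2 * D)))
    + t x * ((1 / 2) * ((4 * s x ^ 3 * c) * T - b * ((2 * s x * c) * D)))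
    - 1 / (p + 1) * (((1 / lam) * q * t x ^ (q - 1) * s x ^ r
      + t x ^ q * (c * r * s x ^ (r - 1))) * V)
  have ht : ∀ x, HasDerivAt t (1 / lam) x := fun x => (hasDerivAt_id x).div_const lam
  have hs : ∀ x, HasDerivAt s c x := fun x => by
    exact ((((hasDerivAt_id x).sub_const lam).const_mul c).const_add 1).congr_deriv (mul_one c)
  have hs4 : ∀ x, HasDerivAt (fun x => s x ^ 4) (4 * s x ^ 3 * c) x := fun x => by
    simpa using (hs x).fun_pow 4
  have hs3 : ∀ x, HasDerivAt (fun x => s x ^ 3) (3 * s x ^ 2 * c) x := fun x => by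
    simpa using (hs x).fun_pow 3
  have hs2 : ∀ x, HasDerivAt (fun x => s x ^ 2) (2 * s x * c) x := fun x => by
    simpa using (hs x).fun_pow 2
  have t1 : t lam = 1 := div_self hl.ne'
  have s1 : s lam = 1 := by simp [s]
  have tpos : ∀ᶠ x in 𝓝 lam, 0 < t x :=
    (ht lam).continuousAt.eventually (lt_mem_nhds (t1 ▸ one_pos))
  have spos : ∀ᶠ x in 𝓝 lam, 0 < s x :=
    (hs lam).continuousAt.eventually (lt_mem_nhds (s1 ▸ one_pos))
  have hG₁d : ∀ x, 0 < t x → 0 < s x → HasDerivAt G₁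
      ((1 / lam) * ((1 / 2) * ((4 * s x ^ 3 * c) * T - b * ((2 * s x * c) * D)))
      + ((1 / lam) * ((1 / 2) * ((4 * s x ^ 3 * c) * T - b * ((2 * s x * c) * D)))
        + t x * ((1 / 2) * ((4 * (3 * s x ^ 2 * c) * c) * T - b * ((2 * c * c) * D))))
      - 1 / (p + 1) * (((((1 / lam) * q * ((1 / lam) * (q - 1) * t x ^ (q - 1 - 1))) * s x ^ r
          + (1 / lam) * q * t x ^ (q - 1) * (c * r * s x ^ (r - 1)))
        + ((1 / lam) * q * t x ^ (q - 1) * (c * r * s x ^ (r - 1))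
          + t x ^ q * (c * r * (c * (r - 1) * s x ^ (r - 1 - 1))))) * V)) x := by
    intro x h1 h2
    have a1 := (((hs4 x).mul_const T).sub (((hs2 x).mul_const D).const_mul b)).const_mul (1 / 2)
    have a2 := ((((hs3 x).const_mul 4).mul_const c).mul_const T).sub
      (((((hs x).const_mul 2).mul_const c).mul_const D).const_mul b) |>.const_mul (1 / 2)
    have a3 := ((ht x).rpow_const (p := q - 1) (Or.inl h1.ne')).const_mul ((1 / lam) * q)
    have a4 := (hs x).rpow_const (p := r) (Or.inl h2.ne')
    have a5 := (ht x).rpow_const (p := q) (Or.inl h1.ne')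
    have a6 := ((hs x).rpow_const (p := r - 1) (Or.inl h2.ne')).const_mul (c * r)
    exact ((a1.const_mul (1 / lam)).add ((ht x).mul a2)).sub
      ((((a3.mul a4).add (a5.mul a6)).mul_const V).const_mul (1 / (p + 1)))
  refine ⟨G, G₁, ?_, ?_, ?_, ?_, ?_, ?_⟩
  · filter_upwards [tpos, spos] with x h1 h2
    have a1 := (((hs4 x).mul_const T).sub (((hs2 x).mul_const D).const_mul b)).const_mul (1 / 2)
    have a4 := (hs x).rpow_const (p := r) (Or.inl h2.ne')
    have a5 := (ht x).rpow_const (p := q) (Or.inl h1.ne')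
    exact ((ht x).mul a1).sub (((a5.mul a4).mul_const V).const_mul (1 / (p + 1)))
  · filter_upwards [tpos, spos] with x h1 h2
    exact (hG₁d x h1 h2).continuousAt
  -- The mixed term is (2c/λ)(2T - bD - q r V/(p+1)). By Pohozaev and q - 1 = r it equals -(2c/λ) r²
  -- V/(p+1).
  · refine (hG₁d lam (t1 ▸ one_pos) (s1 ▸ one_pos)).congr_deriv ?_
    rw [t1, s1]
    simp only [Real.one_rpow, one_pow, mul_one, one_mul]
    have e : b * D = 2 * T - 1 / (p + 1) * (r * V) := by linarith
    have e2 : b * (2 * c * D) = 2 * c * (b * D) := by ring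
    have e3 : b * (2 * c * c * D) = 2 * c * c * (b * D) := by ring
    rw [e2, e3, e]
    simp only [r, q]
    field_simp
    ring
  -- The terms in c cancel by Pohozaev, so the slope at `lam` is that of the pure amplitude ray.
  · simp only [G₁]
    rw [t1, s1]
    simp only [Real.one_rpow, one_pow, mul_one, one_mul]
    have e : b * D = 2 * T - 1 / (p + 1) * (r * V) := by linarith
    have e2 : b * (2 * c * D) = 2 * c * (b * D) := by ring
    rw [H2.mult, H2.quad, h.1, e2]
    change _ = -((V - 2 * (1 / 2 * (T - b * D))) / lam) / 2
    rw [e]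
    simp only [r, q]
    field_simp
    ring
  · simp only [G]
    rw [t1, s1, ← h.energy_eq_cost, H2.energy_eq, H2.quad]
    simp only [Real.one_rpow, one_pow, one_mul]
    rfl
  · filter_upwards [tpos, spos] with x h1 h2
    have := cost_le_resize (b := b) hp1 hp9 φ h1.le h2
    rwa [h.1, div_mul_cancel₀ _ hl.ne'] at this

/-- For small c > 0 the linear term beats the quadratic one. -/
lemma exists_pos_sub_sq_pos {α : ℝ} (hα : 0 < α) (N : ℝ) : ∃ c : ℝ, 0 < α * c - 2 * c ^ 2 * N := by
  refine ⟨α / (2 * (|N| + 1)), ?_⟩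
  have hN : 0 < |N| + 1 := by positivity
  have h1 : N < |N| + 1 := by linarith [le_abs_self N]
  have e : α * (α / (2 * (|N| + 1))) - 2 * (α / (2 * (|N| + 1))) ^ 2 * N
      = α ^ 2 / (2 * (|N| + 1) ^ 2) * ((|N| + 1) - N) := by field_simp
  rw [e]
  exact mul_pos (by positivity) (by linarith)

/-- The amplitude ray alone gives the non-strict bound; the dilation at a suitable rate c
contributes the strictly positive excess αc - 2c²N. -/
lemma IsMinimizer.lt_deriv_multiplier (hp1 : 1 < p) (hp9 : p < 9) {lam : ℝ} (hl : 0 < lam) {φ : H2}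
    (h : IsMinimizer p b lam φ) {A : Set ℝ} {w' : ℝ} (hA : ∀ᵐ x : ℝ, lam < x → x ∈ A)
    (hd : deriv (cost p b) lam = -φ.mult p b / 2)
    (hω : HasDerivWithinAt (fun x => -2 * deriv (cost p b) x) w' A lam) :
    (p - 1) / (2 * lam ^ 2) * potential p φ < w' := by
  obtain ⟨N, hN⟩ := h.exists_trial hp1 hp9 hl
  have hV := H2.potential_pos hp1 (h.1 ▸ hl)
  set α := 4 / lam * (potential p φ / (p + 1)) * ((p - 1) / 2) ^ 2
  have hα : 0 < α := by
    have : 0 < (p - 1) / 2 := by linarith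
    positivity
  obtain ⟨c, hc⟩ := exists_pos_sub_sq_pos hα N
  obtain ⟨G, G₁, g1, g2, g3, g4, g5, g6⟩ := hN c
  have := neg_two_mul_le_of_touching (fun c => cost_lipschitzOnWith hp1 hp9 c) hl hA hω g1 g2 g3
    (g4.trans hd.symm) g5 g6
  refine lt_of_lt_of_le ?_ this
  have e : -2 * (-(p - 1) / (4 * lam ^ 2) * potential p φ
        - 2 * c / lam * (potential p φ / (p + 1)) * ((p - 1) / 2) ^ 2 + c ^ 2 * N)
      = (p - 1) / (2 * lam ^ 2) * potential p φ + (α * c - 2 * c ^ 2 * N) := by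
    simp only [α]; field_simp; ring
  rw [e]; linarith

variable {p b : ℝ}

/-! ### Dependence of the multiplier on the mass -/

/-- Λ is the infimum of the masses at which m lies below the spectral line -κλ. Every larger mass
inherits the inequality, and for p < 5 every positive mass has it. -/
lemma exists_threshold (hp1 : 1 < p) (hp9 : p < 9) :
    ∃ Λ : ℝ, 0 ≤ Λ ∧ (p < 5 → Λ = 0) ∧
      ∀ lam, Λ < lam → cost p b lam < -((max b 0) ^ 2 / 8) * lam := by
  set κ := (max b 0) ^ 2 / 8
  set s := {μ : ℝ | 0 < μ ∧ cost p b μ < -κ * μ}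
  have hs : s.Nonempty := exists_cost_lt_threshold hp1 hp9 κ
  refine ⟨sInf s, Real.sInf_nonneg fun μ hμ => hμ.1.le, fun h5 => ?_, fun lam hl => ?_⟩
  · have : s = Ioi 0 := Subset.antisymm (fun μ hμ => hμ.1) fun μ hμ =>
      ⟨hμ, cost_lt_threshold_of_subcritical hp1 h5 hμ⟩
    rw [this, csInf_Ioi]
  · obtain ⟨μ, hμ, hlt⟩ := exists_lt_of_csInf_lt hs hl
    exact cost_lt_threshold_of_lt hp1 hp9 hμ.1 hμ.2 hlt

lemma IsMinimizer.cost_le (hp1 : 1 < p) (hp9 : p < 9) {lam : ℝ} (hl : 0 < lam) {φ : H2}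
    (h : IsMinimizer p b lam φ) (y : ℝ) (hy : 0 ≤ y) :
    cost p b y ≤ cost p b lam + -φ.mult p b / 2 * (y - lam) := by
  rcases eq_or_ne y lam with rfl | hne
  · simp
  · exact (h.cost_lt hp1 hp9 hl hy hne).le

/-- By `IsMinimizer.mult_eq` only the potential has to converge, together with the continuity of m.
-/
lemma tendsto_mult (hp1 : 1 < p) (hp9 : p < 9) {ι : Type*} {l : Filter ι} {lam : ℝ} (hl : 0 < lam)
    {x : ι → ℝ} {φ : ι → H2} {Φ : H2} (hx : Tendsto x l (𝓝 lam))
    (hφ : ∀ j, IsMinimizer p b (x j) (φ j)) (hΦ : IsMinimizer p b lam Φ)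
    (hV : Tendsto (fun j => potential p (φ j)) l (𝓝 (potential p Φ))) :
    Tendsto (fun j => (φ j).mult p b) l (𝓝 (Φ.mult p b)) := by
  simp only [fun j => (hφ j).mult_eq hp1, hΦ.mult_eq hp1]
  exact ((hV.const_mul _).sub (((continuousAt_cost hp1 hp9 hl).tendsto.comp hx).const_mul 2)).div
    hx (ne_of_gt hl)

/-- The multipliers of minimizers of nearby mass `lam + δ` converge with the difference
quotients. -/
lemma tendsto_mult_of_slope (hp1 : 1 < p) (hp9 : p < 9) {ι : Type*} {l : Filter ι} {lam L : ℝ}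
    (hl : 0 < lam) {δ : ι → ℝ} {φ : ι → H2} (hδ : Tendsto δ l (𝓝 0)) (hδ0 : ∀ᶠ j in l, δ j ≠ 0)
    (hφ : ∀ j, IsMinimizer p b (lam + δ j) (φ j))
    (h1 : Tendsto (fun j => (cost p b (lam + δ j) - cost p b lam) / δ j) l (𝓝 L))
    (h2 : Tendsto (fun j => (cost p b (lam + 2 * δ j) - cost p b lam) / (2 * δ j)) l (𝓝 L)) :
    Tendsto (fun j => -(φ j).mult p b / 2) l (𝓝 L) := by
  have hpos : ∀ᶠ j in l, -(lam / 2) < δ j := hδ.eventually (lt_mem_nhds (by linarith))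
  refine tendsto_supergradient hδ0 h1 h2 ?_ ?_
  · filter_upwards [hpos] with j hj
    exact (hφ j).cost_le hp1 hp9 (by linarith) lam hl.le
  · filter_upwards [hpos] with j hj
    exact (hφ j).cost_le hp1 hp9 (by linarith) _ (by linarith)

/-- A limit of difference quotients of m is attained as -ω/2 by some minimizer at λ itself, obtained
by compactness from minimizers at nearby masses. -/
lemma exists_minimizer_mult_eq (hp1 : 1 < p) (hp9 : p < 9) {lam L : ℝ} (hl : 0 < lam)
    (hneg : cost p b lam < -((max b 0) ^ 2 / 8) * lam) {δ : ℕ → ℝ} {φ : ℕ → H2}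
    (hδ : Tendsto δ atTop (𝓝 0)) (hδ0 : ∀ j, δ j ≠ 0)
    (hφ : ∀ j, IsMinimizer p b (lam + δ j) (φ j))
    (h1 : Tendsto (fun j => (cost p b (lam + δ j) - cost p b lam) / δ j) atTop (𝓝 L))
    (h2 : Tendsto (fun j => (cost p b (lam + 2 * δ j) - cost p b lam) / (2 * δ j)) atTop (𝓝 L)) :
    ∃ Φ, IsMinimizer p b lam Φ ∧ -Φ.mult p b / 2 = L := by
  have hx : Tendsto (fun j => lam + δ j) atTop (𝓝 lam) := by
    simpa using hδ.const_add lam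
  obtain ⟨Φ, hΦ, ns, hns, hV⟩ := exists_minimizer_tendsto hp1 hp9 hl hneg (φ := φ)
    (by simp only [fun j => (hφ j).1]; exact hx)
    (by
      simp only [fun j => (hφ j).energy_eq_cost]
      exact (continuousAt_cost hp1 hp9 hl).tendsto.comp hx)
  refine ⟨Φ, hΦ, ?_⟩
  have k1 := tendsto_mult hp1 hp9 hl (hx.comp hns.tendsto_atTop) (fun j => hφ (ns j)) hΦ hV
  have k2 := (tendsto_mult_of_slope hp1 hp9 hl hδ (.of_forall hδ0) hφ h1 h2).comp hns.tendsto_atTop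
  exact tendsto_nhds_unique (k1.neg.div_const 2) k2

/-- The gradient part of the distance bounds the supremum of the difference. Its vanishing L² norm
then kills both its potential and the cross term. -/
lemma tendsto_potential_of_shiftDistSq (hp1 : 1 < p) {φ : ℕ → H2} {y : ℕ → ℝ} {Φ : H2}
    (h : Tendsto (fun j => shiftDistSq (φ j) (y j) Φ) atTop (𝓝 0)) :
    Tendsto (fun j => potential p (φ j)) atTop (𝓝 (potential p Φ)) := by
  set u : ℕ → H2 := fun j => ((φ j).shift (y j)).sub Φ
  have e0 : ∀ j, mass (u j) = ∫ x, (φ j (x + y j) - Φ x) ^ 2 := fun j => by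
    simp [mass, u, H2.sub, H2.addMul, H2.shift, H2.affine, sub_eq_add_neg]
  have e1 : ∀ j, (u j).gradSq = ∫ x, ((φ j).d1 (x + y j) - Φ.d1 x) ^ 2 := fun j => by
    simp [H2.gradSq, u, H2.sub, H2.addMul, H2.shift, H2.affine, sub_eq_add_neg]
  have hdist : ∀ j, mass (u j) ≤ shiftDistSq (φ j) (y j) Φ ∧
      (u j).gradSq ≤ shiftDistSq (φ j) (y j) Φ := fun j => by
    have a1 := (u j).mass_nonneg
    have a2 := (u j).gradSq_nonneg
    have a3 : 0 ≤ ∫ x, ((φ j).d2 (x + y j) - Φ.d2 x) ^ 2 := integral_nonneg fun _ => sq_nonneg _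
    rw [shiftDistSq, ← e0, ← e1]
    constructor <;> linarith
  have um : Tendsto (fun j => mass (u j)) atTop (𝓝 0) :=
    squeeze_zero (fun j => (u j).mass_nonneg) (fun j => (hdist j).1) h
  obtain ⟨B, hB⟩ := h.bddAbove_range
  have hB' : ∀ j, shiftDistSq (φ j) (y j) Φ ≤ B := fun j => hB ⟨j, rfl⟩
  set S := max Φ.sup √(2 * (√B * √B))
  have us : ∀ j, (u j).sup ≤ S := fun j =>
    le_max_of_le_right (H2.sup_le ((hdist j).1.trans (hB' j)) ((hdist j).2.trans (hB' j)))
  have uV : Tendsto (fun j => potential p (u j)) atTop (𝓝 0) := by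
    have hz := um.const_mul (S ^ (p - 1))
    rw [mul_zero] at hz
    refine squeeze_zero (fun j => H2.potential_nonneg p _) (fun j => ?_) hz
    exact (H2.potential_le hp1 _).trans (mul_le_mul_of_nonneg_right
      (Real.rpow_le_rpow (u j).sup_nonneg (us j) (by linarith)) (u j).mass_nonneg)
  have hd : Tendsto (fun j => potential p (φ j) - potential p Φ - potential p (u j)) atTop
      (𝓝 0) := by
    have hS0 : 0 ≤ S := Φ.sup_nonneg.trans (le_max_left _ _)
    have hz := ((um.sqrt.const_mul (√(mass Φ)))).const_mul
      (2 * (p + 1) * (2 * S) ^ (p - 1) + S ^ (p - 1))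
    rw [Real.sqrt_zero, mul_zero, mul_zero] at hz
    refine squeeze_zero_norm (fun j => ?_) hz
    have k := H2.abs_potential_add_sub_sub_le hp1 Φ (u j) (le_max_left _ _) (us j)
    rw [H2.potential_add_sub, H2.potential_shift] at k
    exact k.trans (mul_le_mul_of_nonneg_left (integral_abs_mul_le Φ.memLp (u j).memLp)
      (by positivity))
  have := (hd.add uV).add_const (potential p Φ)
  rw [zero_add, zero_add] at this
  exact this.congr fun j => by ring

lemma UniqueMinimizer.potential_eq {lam : ℝ} (h : UniqueMinimizer p b lam) {φ ψ : H2}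
    (hφ : IsMinimizer p b lam φ) (hψ : IsMinimizer p b lam ψ) : potential p φ = potential p ψ := by
  obtain ⟨σ, τ, y, hσ, hτ, hae⟩ := h φ ψ hφ hψ
  have h1 : potential p ψ = ∫ x, |φ (τ * x + y)| ^ (p + 1) := by
    refine integral_congr_ae ?_
    filter_upwards [hae] with x hx
    rw [hx, abs_mul]
    rcases hσ with rfl | rfl <;> simp
  rw [h1, integral_comp_affine (fun x => |φ x| ^ (p + 1)) τ y]
  rcases hτ with rfl | rfl <;> simp [potential]

lemma UniqueMinimizer.mult_eq (hp1 : 1 < p) {lam : ℝ} (h : UniqueMinimizer p b lam) {φ ψ : H2}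
    (hφ : IsMinimizer p b lam φ) (hψ : IsMinimizer p b lam ψ) : φ.mult p b = ψ.mult p b := by
  rw [hφ.mult_eq hp1, hψ.mult_eq hp1, h.potential_eq hφ hψ]

lemma tendsto_two_mul_nhdsGT : Tendsto (fun ε : ℝ => 2 * ε) (𝓝[>] 0) (𝓝[>] 0) := by
  refine tendsto_nhdsWithin_iff.2 ⟨?_, ?_⟩
  · have : Tendsto (fun ε : ℝ => 2 * ε) (𝓝 0) (𝓝 (2 * 0)) := tendsto_id.const_mul 2
    rw [mul_zero] at this
    exact this.mono_left nhdsWithin_le_nhds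
  · filter_upwards [self_mem_nhdsWithin] with ε hε
    simpa using hε

lemma tendsto_two_mul_nhdsLT : Tendsto (fun ε : ℝ => 2 * ε) (𝓝[<] 0) (𝓝[<] 0) := by
  refine tendsto_nhdsWithin_iff.2 ⟨?_, ?_⟩
  · have : Tendsto (fun ε : ℝ => 2 * ε) (𝓝 0) (𝓝 (2 * 0)) := tendsto_id.const_mul 2
    rw [mul_zero] at this
    exact this.mono_left nhdsWithin_le_nhds
  · filter_upwards [self_mem_nhdsWithin] with ε hε
    have : ε < 0 := hε
    simp only [mem_Iio]; linarith

/-- Multipliers of limit waves are one-sided derivatives of the cost. -/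
lemma IsLimitWave.mult_eq_or (hp1 : 1 < p) (hp9 : p < 9) {lam Lr Ll : ℝ} (hl : 0 < lam) {Φ : H2}
    (h : IsLimitWave p b lam Φ)
    (hr : Tendsto (fun ε => (cost p b (lam + ε) - cost p b lam) / ε) (𝓝[>] 0) (𝓝 Lr))
    (hL : Tendsto (fun ε => (cost p b (lam + ε) - cost p b lam) / ε) (𝓝[<] 0) (𝓝 Ll)) :
    -Φ.mult p b / 2 = Lr ∨ -Φ.mult p b / 2 = Ll := by
  obtain ⟨hΦ, δ, y, φ, hδ0, hδ, hφ, hdist⟩ := h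
  have hx : Tendsto (fun j => lam + δ j) atTop (𝓝 lam) := by simpa using hδ.const_add lam
  have hm := (tendsto_mult hp1 hp9 hl hx hφ hΦ
    (tendsto_potential_of_shiftDistSq hp1 hdist)).neg.div_const 2
  -- If infinitely many δ are positive, the filter is restricted to those indices; otherwise δ is
  -- eventually negative. Either way the difference quotients are one-sided.
  by_cases hfreq : ∃ᶠ j in atTop, 0 < δ j
  · left
    set l := atTop ⊓ 𝓟 {j | 0 < δ j}
    have hne : l.NeBot := frequently_mem_iff_neBot.1 hfreq
    have hδl : Tendsto δ l (𝓝[>] 0) := tendsto_nhdsWithin_iff.2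
      ⟨hδ.mono_left inf_le_left, mem_inf_of_right (mem_principal_self _)⟩
    exact tendsto_nhds_unique (hm.mono_left inf_le_left)
      (tendsto_mult_of_slope hp1 hp9 hl (hδ.mono_left inf_le_left) (.of_forall hδ0) hφ
        (hr.comp hδl) (hr.comp (tendsto_two_mul_nhdsGT.comp hδl)))
  · right
    have hev : ∀ᶠ j in atTop, δ j < 0 := by
      filter_upwards [not_frequently.1 hfreq] with j hj
      exact lt_of_le_of_ne (not_lt.1 hj) (hδ0 j)
    have hδl : Tendsto δ atTop (𝓝[<] 0) := tendsto_nhdsWithin_iff.2 ⟨hδ, hev⟩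
    exact tendsto_nhds_unique hm
      (tendsto_mult_of_slope hp1 hp9 hl hδ (.of_forall hδ0) hφ
        (hL.comp hδl) (hL.comp (tendsto_two_mul_nhdsLT.comp hδl)))

/-- Uniqueness of the minimizer makes the cost differentiable. -/
lemma UniqueMinimizer.differentiableAt (hp1 : 1 < p) (hp9 : p < 9) {Λ lam : ℝ} (hΛ : 0 ≤ Λ)
    (hneg : ∀ μ, Λ < μ → cost p b μ < -((max b 0) ^ 2 / 8) * μ) (hl : Λ < lam)
    (h : UniqueMinimizer p b lam) : DifferentiableAt ℝ (cost p b) lam := by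
  have hl0 : 0 < lam := hΛ.trans_lt hl
  obtain ⟨Lr, Ll, hr, hL⟩ := exists_oneSided_deriv (concaveOn_cost (b := b) hp1 hp9) hl0
  have hex : ∀ μ, Λ < μ → ∃ φ, IsMinimizer p b μ φ := fun μ hμ =>
    exists_isMinimizer hp1 hp9 (hΛ.trans_lt hμ) (hneg μ hμ)
  -- The factor keeps `lam - δ j` above Λ, where minimizers exist.
  set δ : ℕ → ℝ := fun j => (lam - Λ) / 2 * (1 / ((j : ℝ) + 1))
  have hδpos : ∀ j, 0 < δ j := fun j => mul_pos (by linarith) (by positivity)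
  have hδle : ∀ j, δ j ≤ (lam - Λ) / 2 := fun j => by
    refine mul_le_of_le_one_right (by linarith) ?_
    rw [div_le_one (by positivity)]
    linarith [(Nat.cast_nonneg j : (0 : ℝ) ≤ j)]
  have hδ : Tendsto δ atTop (𝓝 0) := by
    have := (tendsto_one_div_add_atTop_nhds_zero_nat (𝕜 := ℝ)).const_mul ((lam - Λ) / 2)
    rwa [mul_zero] at this
  have hδr : Tendsto δ atTop (𝓝[>] 0) := tendsto_nhdsWithin_iff.2 ⟨hδ, .of_forall hδpos⟩
  have hδl : Tendsto (fun j => -δ j) atTop (𝓝[<] 0) := tendsto_nhdsWithin_iff.2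
    ⟨by simpa using hδ.neg, .of_forall fun j => neg_lt_zero.2 (hδpos j)⟩
  have sr := tendsto_add_slope_right hr
  have sl := tendsto_add_slope_left hL
  choose φ hφ using fun j => hex (lam + δ j) (by linarith [hδpos j])
  choose ψ hψ using fun j => hex (lam + -δ j) (by linarith [hδle j])
  obtain ⟨Φ, hΦ, e1⟩ := exists_minimizer_mult_eq hp1 hp9 hl0 (hneg lam hl) hδ
    (fun j => (hδpos j).ne') hφ (sr.comp hδr) (sr.comp (tendsto_two_mul_nhdsGT.comp hδr))
  obtain ⟨Ψ, hΨ, e2⟩ := exists_minimizer_mult_eq hp1 hp9 hl0 (hneg lam hl) (δ := fun j => -δ j)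
    (by simpa using hδ.neg) (fun j => neg_ne_zero.2 (hδpos j).ne') hψ (sl.comp hδl)
    (sl.comp (tendsto_two_mul_nhdsLT.comp hδl))
  -- Both one-sided derivatives come from multipliers of minimizers at `lam`, and the symmetries
  -- preserve the potential.
  have heq : Lr = Ll := by rw [← e1, ← e2, h.mult_eq hp1 hΦ hΨ]
  subst heq
  have := hL.union hr
  rw [Iio_union_Ioi, compl_eq_univ_sdiff, hasDerivWithinAt_sdiff_singleton,
    hasDerivWithinAt_univ] at this
  exact this.differentiableAt

end Kawahara

/-! ### The main theorem. -/

theorem theorem3 (p b : ℝ) (hp1 : 1 < p) (hp9 : p < 9) :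
    -- `m_b` is finite, concave, Lipschitz on bounded intervals and a.e. differentiable on `(0, ∞)`
    (∀ lam : ℝ, 0 < lam →
      (Kawahara.energies p b lam).Nonempty ∧ BddBelow (Kawahara.energies p b lam)) ∧
    ConcaveOn ℝ (Ioi 0) (Kawahara.cost p b) ∧
    (∀ a c : ℝ, 0 ≤ a → a < c → ∃ K : ℝ≥0, LipschitzOnWith K (Kawahara.cost p b) (Ioo a c)) ∧
    (∀ᵐ lam : ℝ, 0 < lam → DifferentiableAt ℝ (Kawahara.cost p b) lam) ∧
    -- if `b > 0` then `m_b` is negative and strictly decreasing on all of `(0, ∞)`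
    (0 < b → (∀ lam : ℝ, 0 < lam → Kawahara.cost p b lam < 0) ∧
      StrictAntiOn (Kawahara.cost p b) (Ioi 0)) ∧
    -- the threshold `Λ`, which is `0` for `p < 5`, and the a.e. defined function `ω`
    ∃ (Λ : ℝ) (ω : ℝ → ℝ), 0 ≤ Λ ∧ (p < 5 → Λ = 0) ∧
      (∀ lam : ℝ, Λ < lam → Kawahara.cost p b lam < 0) ∧
      StrictAntiOn (Kawahara.cost p b) (Ioi Λ) ∧
      -- minimizers exist and each has a unique Lagrange multiplier
      (∀ lam : ℝ, Λ < lam → ∃ φ, Kawahara.IsMinimizer p b lam φ) ∧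
      (∀ lam : ℝ, Λ < lam → ∀ φ, Kawahara.IsMinimizer p b lam φ →
        ∃! w : ℝ, Kawahara.IsMultiplier p b φ w) ∧
      -- where `m_b` is differentiable, the multiplier is `ω lam` for every minimizer
      (∀ lam ∈ Kawahara.diffSet p b Λ, ∀ (φ : Kawahara.H2) (w : ℝ),
        Kawahara.IsMinimizer p b lam φ → Kawahara.IsMultiplier p b φ w →
          HasDerivAt (Kawahara.cost p b) (-w / 2) lam ∧ w = ω lam) ∧
      (∀ lam₁ lam₂ : ℝ, Λ < lam₁ → lam₁ < lam₂ →
        IntervalIntegrable ω volume lam₁ lam₂ ∧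
        Kawahara.cost p b lam₂ - Kawahara.cost p b lam₁
          = -(1 / 2) * ∫ lam in lam₁..lam₂, ω lam) ∧
      -- monotonicity and differentiability of `ω`, as a function on the set where `m_b'` exists
      StrictMonoOn ω (Kawahara.diffSet p b Λ) ∧
      (∀ᵐ lam : ℝ, Λ < lam → lam ∈ Kawahara.diffSet p b Λ ∧
        DifferentiableWithinAt ℝ ω (Kawahara.diffSet p b Λ) lam) ∧
      (∀ lam ∈ Kawahara.diffSet p b Λ, ∀ w' : ℝ,
        HasDerivWithinAt ω w' (Kawahara.diffSet p b Λ) lam →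
        ∀ φ, Kawahara.IsMinimizer p b lam φ →
          (p - 1) / (2 * lam ^ 2) * Kawahara.potential p φ < w' ∧
          0 < (p - 1) / (2 * lam ^ 2) * Kawahara.potential p φ) ∧
      -- one-sided derivatives of `m_b` at every point, and limit waves
      (∀ lam : ℝ, Λ < lam → ∃ Lr Ll : ℝ,
        Tendsto (fun ε => (Kawahara.cost p b (lam + ε) - Kawahara.cost p b lam) / ε)
          (𝓝[>] 0) (𝓝 Lr) ∧
        Tendsto (fun ε => (Kawahara.cost p b (lam + ε) - Kawahara.cost p b lam) / ε)
          (𝓝[<] 0) (𝓝 Ll) ∧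
        (∀ (φ : Kawahara.H2) (w : ℝ),
          Kawahara.IsMinimizer p b lam φ → Kawahara.IsMultiplier p b φ w →
            Lr ≤ -w / 2 ∧ -w / 2 ≤ Ll) ∧
        (∀ (Φ : Kawahara.H2) (w : ℝ),
          Kawahara.IsLimitWave p b lam Φ → Kawahara.IsMultiplier p b Φ w →
            -w / 2 = Lr ∨ -w / 2 = Ll)) ∧
      -- uniqueness of the minimizer gives continuity of `ω`, pointwise and globally
      (∀ lam : ℝ, Λ < lam → Kawahara.UniqueMinimizer p b lam →
        lam ∈ Kawahara.diffSet p b Λ ∧ ContinuousWithinAt ω (Kawahara.diffSet p b Λ) lam) ∧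
      ((∀ lam : ℝ, Λ < lam → Kawahara.UniqueMinimizer p b lam) →
        Kawahara.diffSet p b Λ = Ioi Λ ∧ ContinuousOn ω (Ioi Λ)) := by
  have hLip := fun c => Kawahara.cost_lipschitzOnWith (p := p) (b := b) hp1 hp9 c
  have hae := Kawahara.ae_differentiableAt_of_lipschitz hLip
  have hconc := Kawahara.concaveOn_cost (p := p) (b := b) hp1 hp9
  refine ⟨fun lam hl => ⟨Kawahara.energies_nonempty hl.le, Kawahara.energies_bddBelow hp1 hp9 lam⟩,
    hconc.subset Ioi_subset_Ici_self (convex_Ioi 0), fun a c ha _ => ?_, hae,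
    fun hb => ⟨fun lam hl => Kawahara.cost_neg_of_pos hp1 hp9 hb hl, fun x hx y _ hxy =>
      Kawahara.cost_lt_cost hp1 hp9 hx (Kawahara.cost_neg_of_pos hp1 hp9 hb hx) hxy⟩, ?_⟩
  · obtain ⟨K, hK⟩ := hLip c
    exact ⟨K, hK.mono fun x hx => ⟨ha.trans hx.1.le, hx.2.le⟩⟩
  obtain ⟨Λ, hΛ, hΛ5, hneg⟩ := Kawahara.exists_threshold (b := b) hp1 hp9
  have hpos : ∀ {lam}, Λ < lam → 0 < lam := fun h => hΛ.trans_lt h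
  have hneg0 : ∀ lam, Λ < lam → Kawahara.cost p b lam < 0 := fun lam hl =>
    (hneg lam hl).trans_le (by
      have := mul_nonneg (show 0 ≤ (max b 0) ^ 2 / 8 by positivity) (hpos hl).le
      linarith)
  have hex : ∀ lam, Λ < lam → ∃ φ, Kawahara.IsMinimizer p b lam φ := fun lam hl =>
    Kawahara.exists_isMinimizer hp1 hp9 (hpos hl) (hneg lam hl)
  have hmult : ∀ {lam φ w}, Λ < lam → Kawahara.IsMinimizer p b lam φ →
      Kawahara.IsMultiplier p b φ w → w = φ.mult p b := fun hl hφ hw =>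
    hw.eq_mult hp1 (hφ.1 ▸ hpos hl)
  -- At a point of differentiability the one-sided derivatives coincide and enclose the
  -- supergradient.
  have hderiv : ∀ lam ∈ Kawahara.diffSet p b Λ, ∀ φ, Kawahara.IsMinimizer p b lam φ →
      HasDerivAt (Kawahara.cost p b) (-φ.mult p b / 2) lam := by
    intro lam hlam φ hφ
    have hd := hlam.2.hasDerivAt
    have h := Kawahara.supergradient_mem (hpos hlam.1)
      (Kawahara.tendsto_add_slope_right hd.hasDerivWithinAt)
      (Kawahara.tendsto_add_slope_left hd.hasDerivWithinAt)
      (hφ.cost_le hp1 hp9 (hpos hlam.1))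
    rwa [le_antisymm h.1 h.2] at hd
  have hmem : ∀ᵐ lam : ℝ, Λ < lam → lam ∈ Kawahara.diffSet p b Λ := by
    filter_upwards [hae] with x hx hxΛ using ⟨hxΛ, hx (hpos hxΛ)⟩
  -- The strict supergradient inequalities at x and y, each evaluated at the other point, are added.
  have hmono : StrictMonoOn (fun x => -2 * deriv (Kawahara.cost p b) x)
      (Kawahara.diffSet p b Λ) := by
    intro x hx y hy hxy
    obtain ⟨φ, hφ⟩ := hex x hx.1
    obtain ⟨ψ, hψ⟩ := hex y hy.1
    have h1 := hφ.cost_lt hp1 hp9 (hpos hx.1) (hpos hy.1).le hxy.ne'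
    have h2 := hψ.cost_lt hp1 hp9 (hpos hy.1) (hpos hx.1).le hxy.ne
    simp only [(hderiv x hx φ hφ).deriv, (hderiv y hy ψ hψ).deriv]
    nlinarith [sub_pos.2 hxy]
  -- No uniqueness is needed here: the derivative of m, restricted to the points where it exists, is
  -- continuous by the squeeze between difference quotients. Uniqueness only serves to put `lam`
  -- into this set.
  have hcont : ∀ lam ∈ Kawahara.diffSet p b Λ,
      ContinuousWithinAt (fun x => -2 * deriv (Kawahara.cost p b) x)
        (Kawahara.diffSet p b Λ) lam := by
    intro lam hlam
    have hl0 := hpos hlam.1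
    rw [← continuousWithinAt_sdiff_self]
    set l := 𝓝[Kawahara.diffSet p b Λ \ {lam}] lam
    refine Tendsto.const_mul (-2) ?_
    have hd := hasDerivAt_iff_tendsto_slope_zero.1 hlam.2.hasDerivAt
    have hδ : Tendsto (fun x => x - lam) l (𝓝 0) := by
      have : Tendsto (fun x => x - lam) (𝓝 lam) (𝓝 (lam - lam)) := tendsto_id.sub_const lam
      rw [sub_self] at this
      exact this.mono_left nhdsWithin_le_nhds
    have hne : ∀ᶠ x in l, x - lam ≠ 0 := by
      filter_upwards [self_mem_nhdsWithin] with x hx using sub_ne_zero.2 hx.2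
    have hδ1 : Tendsto (fun x => x - lam) l (𝓝[≠] 0) := tendsto_nhdsWithin_iff.2 ⟨hδ, hne⟩
    have hδ2 : Tendsto (fun x => 2 * (x - lam)) l (𝓝[≠] 0) := by
      refine tendsto_nhdsWithin_iff.2 ⟨by simpa using hδ.const_mul 2, ?_⟩
      filter_upwards [hne] with x hx
      simpa using hx
    have hgt : ∀ᶠ x in l, lam / 2 < x :=
      mem_nhdsWithin_of_mem_nhds (Ioi_mem_nhds (by linarith))
    refine Kawahara.tendsto_supergradient (f := Kawahara.cost p b) (x := lam)
      (δ := fun x => x - lam) hne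
      ((hd.comp hδ1).congr fun x => by simp [div_eq_inv_mul])
      ((hd.comp hδ2).congr fun x => by simp [div_eq_inv_mul]) ?_ ?_
    · filter_upwards [self_mem_nhdsWithin] with x hx
      obtain ⟨φ, hφ⟩ := hex x hx.1.1
      rw [(hderiv x hx.1 φ hφ).deriv, add_sub_cancel]
      exact hφ.cost_le hp1 hp9 (hpos hx.1.1) lam hl0.le
    · filter_upwards [self_mem_nhdsWithin, hgt] with x hx hx2
      obtain ⟨φ, hφ⟩ := hex x hx.1.1
      rw [(hderiv x hx.1 φ hφ).deriv, add_sub_cancel]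
      exact hφ.cost_le hp1 hp9 (hpos hx.1.1) _ (by linarith)
  have huniq : ∀ lam : ℝ, Λ < lam → Kawahara.UniqueMinimizer p b lam →
      lam ∈ Kawahara.diffSet p b Λ := fun lam hl hu =>
    ⟨hl, hu.differentiableAt hp1 hp9 hΛ hneg hl⟩
  -- Where m is not differentiable `deriv` is 0, so ω has the default value 0 there; above Λ this is
  -- a null set, invisible to the integral.
  refine ⟨Λ, fun x => -2 * deriv (Kawahara.cost p b) x, hΛ, hΛ5, hneg0,
    fun x hx y _ hxy => Kawahara.cost_lt_cost hp1 hp9 (hpos hx) (hneg0 x hx) hxy, hex,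
    fun lam hl φ hφ => ⟨φ.mult p b, hφ.isMultiplier hp1 hp9 (hpos hl),
      fun w hw => hmult hl hφ hw⟩, ?_, ?_, hmono, ?_, ?_, ?_,
    fun lam hl hu => ⟨huniq lam hl hu, hcont lam (huniq lam hl hu)⟩, ?_⟩
  · intro lam hlam φ w hφ hw
    have h1 := hderiv lam hlam φ hφ
    rw [hmult hlam.1 hφ hw]
    exact ⟨h1, by simp only [h1.deriv]; ring⟩
  · intro lam₁ lam₂ h1 h2
    obtain ⟨i1, i2⟩ := Kawahara.integral_deriv_eq_sub_of_lipschitz hLip (hpos h1).le h2.le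
    refine ⟨i1.const_mul (-2), ?_⟩
    rw [intervalIntegral.integral_const_mul, i2]
    ring
  -- Lebesgue's theorem on monotone functions, on the set of points of differentiability.
  · filter_upwards [hmem, hmono.monotoneOn.ae_differentiableWithinAt_of_mem] with x h1 h2 h3
    exact ⟨h1 h3, h2 (h1 h3)⟩
  · intro lam hlam w' hw φ hφ
    refine ⟨hφ.lt_deriv_multiplier hp1 hp9 (hpos hlam.1) (hmem.mono fun x hx hlx =>
      hx (hlam.1.trans hlx)) (hderiv lam hlam φ hφ).deriv hw, ?_⟩
    have hV := Kawahara.H2.potential_pos hp1 (hφ.1 ▸ hpos hlam.1)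
    have hl0 := hpos hlam.1
    have : 0 < p - 1 := by linarith
    positivity
  · intro lam hl
    obtain ⟨Lr, Ll, hr, hL⟩ := Kawahara.exists_oneSided_deriv hconc (hpos hl)
    have sr := Kawahara.tendsto_add_slope_right hr
    have sl := Kawahara.tendsto_add_slope_left hL
    refine ⟨Lr, Ll, sr, sl, fun φ w hφ hw => ?_, fun Φ w hΦ hw => ?_⟩
    · rw [hmult hl hφ hw]
      exact Kawahara.supergradient_mem (hpos hl) sr sl (hφ.cost_le hp1 hp9 (hpos hl))
    · rw [hmult hl hΦ.1 hw]
      exact hΦ.mult_eq_or hp1 hp9 (hpos hl) sr sl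
  · intro hu
    have hset : Kawahara.diffSet p b Λ = Ioi Λ :=
      Subset.antisymm (fun x hx => hx.1) fun x hx => huniq x hx (hu x hx)
    exact ⟨hset, fun x hx => hset ▸ hcont x (huniq x hx (hu x hx))⟩
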